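/- Setting. Let $f=\frac1n\sum_{i=1}^n f_i$ with $n\ge1$ and differentiable $f_i:\mathbb R^d\to\mathbb R$ such that $\|\nabla f_i(x)-\nabla f_i(y)\|\le L_i\|x-y\|$ for all $x,y$. Put $\tilde L=\sqrt{\frac1n\sum_i L_i^2}$. Except for EF21-Prox, assume $f^{\inf}=\inf f>-\infty$ and put $\delta^0=f(x^0)-f^{\inf}$. A contractive compressor with parameter $\alpha\in(0,1]$ is a (possibly randomized) map $\mathcal C:\mathbb R^d\to\mathbb R^d$ with $\mathbb E\|\mathcal C(x)-x\|^2\le(1-\alpha)\|x\|^2$ for all $x$; in each call it uses fresh randomness, independent over rounds and of all other random choices (for different nodes in the same round, the randomness may be dependent). The output $\hat x^T$ is uniform on $\{x^0,\dots,x^{T-1}\}$, and $\#\mathrm{grad}$ counts the gradients computed at a node in $T$ rounds, initialization included. Write $g^t=\frac1n\sum_i g_i^t$. The methods (stepsize $\gamma>0$; unless stated otherwise $x^{t+1}=x^t-\gamma g^t$, $g_i^0=\nabla f_i(x^0)$, $g_i^{t+1}=g_i^t+\mathcal C(\nabla f_i(x^{t+1})-g_i^t)$): EF21-PP: in each round a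 random set $S_t$ of nodes is drawn, independently over rounds, with $\mathbf{Prob}(i\in S_t)=p\in(0,1]$ for every $i$, and $g_i^{t+1}=g_i^t$ for $i\notin S_t$ (such nodes compute nothing). EF21-BC: $x^{t+1}=x^t-\gamma g^t$, $\tilde g_i^{t+1}=\tilde g_i^t+\mathcal C_w(\nabla f_i(x^{t+1})-\tilde g_i^t)$, $g^{t+1}=g^t+\mathcal C_M(\frac1n\sum_i\tilde g_i^{t+1}-g^t)$, $\tilde g_i^0=\nabla f_i(x^0)$, $g^0=\nabla f(x^0)$, where $\mathcal C_w,\mathcal C_M$ are contractive with parameters $\alpha_w,\alpha_M\in(0,1]$. EF21-HB: $x^{t+1}=x^t-\gamma v^t$, $v^0=g^0$, $v^{t+1}=\eta v^t+g^{t+1}$, $\eta\in[0,1)$. EF21-Prox: $x^{t+1}=\operatorname{prox}_{\gamma r}(x^t-\gamma g^t)$, where $r:\mathbb R^d\to\mathbb R\cup\{+\infty\}$ is proper, closed and convex, $\operatorname{prox}_{\gamma r}(x)=\arg\min_y\{r(y)+\frac1{2\gamma}\|y-x\|^2\}$, $\Phi=f+r$, $\Phi^{\inf}=\inf\Phi>-\infty$,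 $r(x^0)<\infty$, $\tilde L>0$; here $\delta^0=\Phi(x^0)-\Phi^{\inf}$ and $\mathcal G_\gamma(x)=\frac1\gamma\big(x-\operatorname{prox}_{\gamma r}(x-\gamma\nabla f(x))\big)$. EF21-SGD: $\nabla f_i(x^{t+1})$ is replaced by the average $\hat g_i(x^{t+1})$ of $\tau_i$ fresh independent stochastic gradients at $x^{t+1}$, and $g_i^0=\hat g_i(x^0)$; at every $x$, a stochastic gradient of $f_i$ is unbiased with variance at most $\sigma_i^2$; $\sigma^2=\frac1n\sum_i\sigma_i^2$. EF21-PAGE (batch size $1$): $f_i=\frac1m\sum_{j=1}^m f_{ij}$ with $m\ge1$ and differentiable $f_{ij}$, $g_i^0=v_i^0=\nabla f_i(x^0)$, $g_i^{t+1}=g_i^t+\mathcal C(v_i^{t+1}-g_i^t)$, where, with probability $p=\frac1{m+1}$, $v_i^{t+1}=\nabla f_i(x^{t+1})$, and otherwise $v_i^{t+1}=v_i^t+\nabla f_{ij}(x^{t+1})-\nabla f_{ij}(x^t)$ for a random index $j$, independent of this coin. For a random index of node $i$ and all $x,y$, $\nabla f_{ij}(y)-\nabla f_{ij}(x)$ has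 mean $\nabla f_i(y)-\nabla f_i(x)$ and variance at most $\mathcal L_i^2\|y-x\|^2$; $\tilde{\mathcal L}=\sqrt{\frac{1-p}n\sum_i\mathcal L_i^2}$; here $\#\mathrm{grad}$ counts gradients of the $f_{ij}$. Claim. There is an absolute constant $K$ such that the following holds for each method. There is a stepsize $\gamma>0$, depending only on $n$, the $L_i$ and the parameters $\alpha,p,\alpha_w,\alpha_M,\eta,m,\mathcal L_i,\sigma_i$ that apply to the method, such that for all functions, $x^0$ and $\varepsilon>0$ as above there is $T\ge1$ (and, for EF21-SGD, batch sizes $\tau_i\ge1$) with $\mathbb E\|\nabla f(\hat x^T)\|^2\le\varepsilon^2$ (for EF21-Prox, $\mathbb E\|\mathcal G_\gamma(\hat x^T)\|^2\le\varepsilon^2$), where $T\le KX+1$ and $\#\mathrm{grad}$ is bounded as follows. (a) EF21-PP: $X=\frac{\tilde L\delta^0}{p\alpha\varepsilon^2}$ and $\mathbb E[\#\mathrm{grad}]\le K\big(\frac{\tilde L\delta^0}{\alpha\varepsilon^2}+1\big)$ at each node. EF21-BC: $X=\frac{\tilde L\delta^0}{\alpha_w\alpha_M\varepsilon^2}$;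 EF21-HB: $X=\frac{\tilde L\delta^0}{\varepsilon^2}\big(\frac1\alpha+\frac1{1-\eta}\big)$; EF21-Prox: $X=\frac{\tilde L\delta^0}{\alpha\varepsilon^2}$; in these three cases $\#\mathrm{grad}\le K(X+1)$ at each node. (b) EF21-SGD: $X=\frac{\tilde L\delta^0}{\alpha\varepsilon^2}$, and the average over the nodes satisfies $\overline{\#\mathrm{grad}}\le K\Big(\frac{\tilde L\delta^0}{\alpha\varepsilon^2}+\frac{\tilde L\delta^0\sigma^2}{\alpha^3\varepsilon^4}+1\Big)$. (c) EF21-PAGE: $X=\frac{(\tilde L+\tilde{\mathcal L})\delta^0}{\alpha\varepsilon^2}+\frac{\sqrt m\,\tilde{\mathcal L}\delta^0}{\varepsilon^2}$, and the average over the nodes of the expected number of gradients satisfies $\overline{\#\mathrm{grad}}\le K(m+X)$. -/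

import Mathlib

open MeasureTheory ProbabilityTheory
open scoped ENNReal

noncomputable section

namespace EF21

/-- The Euclidean space `ℝ^d`. -/
abbrev E (d : ℕ) : Type := EuclideanSpace ℝ (Fin d)

/-- The average `(1/n) ∑ᵢ vᵢ`. -/
def mean {n : ℕ} {V : Type*} [AddCommGroup V] [Module ℝ V] (v : Fin n → V) : V :=
  (n : ℝ)⁻¹ • ∑ i, v i

/-- The objective `f = (1/n) ∑ᵢ fᵢ`. -/
def avg {n d : ℕ} (f : Fin n → E d → ℝ) : E d → ℝ := fun x => mean fun i => f i x

/-- The quadratic mean `√((1/n) ∑ᵢ Lᵢ²)`. -/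
def rms {n : ℕ} (L : Fin n → ℝ) : ℝ := √(mean fun i => L i ^ 2)

/-- Every `fᵢ` is differentiable with an `Lᵢ`-Lipschitz gradient. -/
structure IsSmooth {n d : ℕ} (f : Fin n → E d → ℝ) (L : Fin n → ℝ) : Prop where
  differentiable : ∀ i, Differentiable ℝ (f i)
  lipschitz : ∀ i x y, ‖gradient (f i) x - gradient (f i) y‖ ≤ L i * ‖x - y‖

/-- The initial gap `f(x) - inf f`; it is only used for `f` bounded below. -/
def gap {d : ℕ} (f : E d → ℝ) (x : E d) : ℝ := f x - ⨅ y, f y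

/-! ### Randomness -/

/-- A randomized map `x ↦ 𝒞 s x`, with a random seed `s` of law `ν`, is a contractive compressor
with parameter `α`: `𝔼 ‖𝒞(x) - x‖² ≤ (1 - α) ‖x‖²` for every `x`. -/
structure IsContractive {S : Type*} [MeasurableSpace S] {d : ℕ} (𝒞 : S → E d → E d)
    (ν : Measure S) (α : ℝ) : Prop where
  measurable : Measurable (Function.uncurry 𝒞)
  contract : ∀ x, ∫⁻ s, ‖𝒞 s x - x‖ₑ ^ 2 ∂ν ≤ ENNReal.ofReal (1 - α) * ‖x‖ₑ ^ 2

/-- `ξ t ω i` is the random input used by node `i` in round `t`. It has law `law i`, and different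
rounds are independent. Inside one round, the inputs of different nodes may depend on each other
in an arbitrary way. -/
structure IsFreshNoise {Ω ι : Type*} [MeasurableSpace Ω] {S : ι → Type*}
    [∀ i, MeasurableSpace (S i)] (law : ∀ i, Measure (S i)) (ξ : ℕ → Ω → ∀ i, S i)
    (μ : Measure Ω) : Prop where
  measurable : ∀ t, Measurable (ξ t)
  indep : iIndepFun ξ μ
  law_eq : ∀ t i, μ.map (fun ω => ξ t ω i) = law i

/-- Two noise processes are independent of each other. -/
def IndepNoise {Ω S S' : Type*} [MeasurableSpace Ω] [MeasurableSpace S] [MeasurableSpace S']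
    (ξ : ℕ → Ω → S) (ζ : ℕ → Ω → S') (μ : Measure Ω) : Prop :=
  IndepFun (fun ω t => ξ t ω) (fun ω t => ζ t ω) μ

/-- The Bernoulli law: `true` with probability `p`, `false` with probability `1 - p`. -/
def bernoulliLaw (p : ℝ) : Measure Bool :=
  ENNReal.ofReal p • Measure.dirac true + ENNReal.ofReal (1 - p) • Measure.dirac false

/-- `𝔼 ‖G(x̂ᵀ)‖²`, where `x̂ᵀ` is chosen uniformly at random from `x⁰, …, xᵀ⁻¹`, independently of
the run of the method. -/
def meanSqAtOutput {Ω : Type*} [MeasurableSpace Ω] {d : ℕ} (μ : Measure Ω) (G : E d → E d)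
    (x : ℕ → Ω → E d) (T : ℕ) : ℝ≥0∞ :=
  ∫⁻ q, ‖G (x q.2 q.1)‖ₑ ^ 2 ∂(μ.prod (uniformOn (Set.Iio T)))

/-! ### The methods

Each method is a recursion along a realization of its random inputs; `cost i` counts the gradients
that node `i` has computed so far, those of the initialization included. -/

/-- State of EF21-PP, EF21-Prox and EF21-SGD. -/
structure State (n d : ℕ) where
  x : E d
  g : Fin n → E d
  cost : Fin n → ℕ

/-- EF21-PP. Node `i` takes part in round `t` if `A t i = true`. -/
def runPP {n d : ℕ} {S : Type*} (f : Fin n → E d → ℝ) (𝒞 : S → E d → E d) (γ : ℝ) (x₀ : E d)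
    (ξ : ℕ → Fin n → S) (A : ℕ → Fin n → Bool) : ℕ → State n d
  | 0 => ⟨x₀, fun i => gradient (f i) x₀, fun _ => 1⟩
  | t + 1 =>
    let s := runPP f 𝒞 γ x₀ ξ A t
    let x' := s.x - γ • mean s.g
    ⟨x',
     fun i => if A t i then s.g i + 𝒞 (ξ t i) (gradient (f i) x' - s.g i) else s.g i,
     fun i => if A t i then s.cost i + 1 else s.cost i⟩

/-- State of EF21-BC: `gw i` is the estimator of node `i`, `g` the one broadcast by the master. -/
structure StateBC (n d : ℕ) where
  x : E d
  gw : Fin n → E d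
  g : E d
  cost : Fin n → ℕ

/-- EF21-BC, with compressor `𝒞w` at the nodes and `𝒞M` at the master. -/
def runBC {n d : ℕ} {S S' : Type*} (f : Fin n → E d → ℝ) (𝒞w : S → E d → E d)
    (𝒞M : S' → E d → E d) (γ : ℝ) (x₀ : E d) (ξ : ℕ → Fin n → S) (ζ : ℕ → S') : ℕ → StateBC n d
  | 0 => ⟨x₀, fun i => gradient (f i) x₀, gradient (avg f) x₀, fun _ => 1⟩
  | t + 1 =>
    let s := runBC f 𝒞w 𝒞M γ x₀ ξ ζ t
    let x' := s.x - γ • s.g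
    let gw' := fun i => s.gw i + 𝒞w (ξ t i) (gradient (f i) x' - s.gw i)
    ⟨x', gw', s.g + 𝒞M (ζ t) (mean gw' - s.g), fun i => s.cost i + 1⟩

/-- State of EF21-HB. -/
structure StateHB (n d : ℕ) where
  x : E d
  g : Fin n → E d
  v : E d
  cost : Fin n → ℕ

/-- EF21-HB with momentum parameter `η`. -/
def runHB {n d : ℕ} {S : Type*} (f : Fin n → E d → ℝ) (𝒞 : S → E d → E d) (γ η : ℝ) (x₀ : E d)
    (ξ : ℕ → Fin n → S) : ℕ → StateHB n d
  | 0 => ⟨x₀, fun i => gradient (f i) x₀, mean fun i => gradient (f i) x₀, fun _ => 1⟩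
  | t + 1 =>
    let s := runHB f 𝒞 γ η x₀ ξ t
    let x' := s.x - γ • s.v
    let g' := fun i => s.g i + 𝒞 (ξ t i) (gradient (f i) x' - s.g i)
    ⟨x', g', η • s.v + mean g', fun i => s.cost i + 1⟩

/-- A regularizer `r : ℝ^d → ℝ ∪ {+∞}` that is proper, closed and convex. -/
structure IsProperClosedConvex {d : ℕ} (r : E d → EReal) : Prop where
  ne_bot : ∀ x, r x ≠ ⊥
  proper : ∃ x, r x ≠ ⊤
  closed : LowerSemicontinuous r
  convex : Convex ℝ {q : E d × ℝ | r q.1 ≤ (q.2 : EReal)}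

/-- The proximal map, `prox_{γr}(x) = argmin_y { r(y) + ‖y - x‖² / (2γ) }`. -/
def prox {d : ℕ} (γ : ℝ) (r : E d → EReal) (x : E d) : E d :=
  Classical.epsilon fun y =>
    IsMinOn (fun z => r z + ((‖z - x‖ ^ 2 / (2 * γ) : ℝ) : EReal)) Set.univ y

/-- The gradient mapping `𝒢_γ(x) = (1/γ) (x - prox_{γr}(x - γ ∇f(x)))`. -/
def gradMap {d : ℕ} (γ : ℝ) (r : E d → EReal) (f : E d → ℝ) (x : E d) : E d :=
  γ⁻¹ • (x - prox γ r (x - γ • gradient f x))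

/-- EF21-Prox. -/
def runProx {n d : ℕ} {S : Type*} (f : Fin n → E d → ℝ) (r : E d → EReal) (𝒞 : S → E d → E d)
    (γ : ℝ) (x₀ : E d) (ξ : ℕ → Fin n → S) : ℕ → State n d
  | 0 => ⟨x₀, fun i => gradient (f i) x₀, fun _ => 1⟩
  | t + 1 =>
    let s := runProx f r 𝒞 γ x₀ ξ t
    let x' := prox γ r (s.x - γ • mean s.g)
    ⟨x', fun i => s.g i + 𝒞 (ξ t i) (gradient (f i) x' - s.g i), fun i => s.cost i + 1⟩

/-- `h x z` is an unbiased stochastic estimator of `G x` with variance at most `σ²`, the sample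
`z` having law `D`. -/
structure IsUnbiasedBoundedVariance {Z : Type*} [MeasurableSpace Z] {d : ℕ} (D : Measure Z)
    (h : E d → Z → E d) (G : E d → E d) (σ : ℝ) : Prop where
  measurable : Measurable (Function.uncurry h)
  integrable : ∀ x, Integrable (h x) D
  unbiased : ∀ x, ∫ z, h x z ∂D = G x
  variance : ∀ x, ∫⁻ z, ‖h x z - G x‖ₑ ^ 2 ∂D ≤ ENNReal.ofReal (σ ^ 2)

/-- EF21-SGD with batch size `τ i` at node `i`. The batch `z 0 i` gives the initial estimators
`gᵢ⁰`, and the batch `z (t + 1) i` is drawn in round `t`. -/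
def runSGD {n d : ℕ} {S Z : Type*} (h : Fin n → E d → Z → E d) (𝒞 : S → E d → E d) (γ : ℝ)
    (x₀ : E d) {τ : Fin n → ℕ} (ξ : ℕ → Fin n → S) (z : ℕ → ∀ i, Fin (τ i) → Z) : ℕ → State n d
  | 0 => ⟨x₀, fun i => mean fun j => h i x₀ (z 0 i j), τ⟩
  | t + 1 =>
    let s := runSGD h 𝒞 γ x₀ ξ z t
    let x' := s.x - γ • mean s.g
    ⟨x',
     fun i => s.g i + 𝒞 (ξ t i) ((mean fun j => h i x' (z (t + 1) i j)) - s.g i),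
     fun i => s.cost i + τ i⟩

/-- Average smoothness of one node, for batches of one sample `j` of law `q`: the differences
`∇f_j(y) - ∇f_j(x)` are unbiased estimators of `∇f(y) - ∇f(x)`, where `f = (1/m) ∑ⱼ f_j`, with
variance at most `ℓ² ‖y - x‖²`. -/
structure IsAvgSmooth {m d : ℕ} (q : Measure (Fin m)) (f : Fin m → E d → ℝ) (ℓ : ℝ) : Prop where
  differentiable : ∀ j, Differentiable ℝ (f j)
  unbiased : ∀ x y, ∫ j, (gradient (f j) y - gradient (f j) x) ∂q =
    gradient (avg f) y - gradient (avg f) x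
  variance : ∀ x y,
    ∫⁻ j, ‖(gradient (f j) y - gradient (f j) x) -
      (gradient (avg f) y - gradient (avg f) x)‖ₑ ^ 2 ∂q ≤ ENNReal.ofReal (ℓ ^ 2 * ‖y - x‖ ^ 2)

/-- State of EF21-PAGE. -/
structure StatePAGE (n d : ℕ) where
  x : E d
  g : Fin n → E d
  v : Fin n → E d
  cost : Fin n → ℕ

/-- EF21-PAGE with batches of size one, for `fᵢ = (1/m) ∑ⱼ fᵢⱼ`. In round `t` node `i` uses the
coin `(c t i).1` and, if it shows `false`, the sample `(c t i).2`. The gradient of `fᵢ` costs `m`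
gradients of summands, a gradient difference of one summand costs two. -/
def runPAGE {n m d : ℕ} {S : Type*} (f : Fin n → Fin m → E d → ℝ) (𝒞 : S → E d → E d) (γ : ℝ)
    (x₀ : E d) (ξ : ℕ → Fin n → S) (c : ℕ → Fin n → Bool × Fin m) : ℕ → StatePAGE n d
  | 0 => ⟨x₀, fun i => gradient (avg (f i)) x₀, fun i => gradient (avg (f i)) x₀, fun _ => m⟩
  | t + 1 =>
    let s := runPAGE f 𝒞 γ x₀ ξ c t
    let x' := s.x - γ • mean s.g
    let v' := fun i =>
      if (c t i).1 then gradient (avg (f i)) x'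
      else s.v i + (gradient (f i (c t i).2) x' - gradient (f i (c t i).2) s.x)
    ⟨x', fun i => s.g i + 𝒞 (ξ t i) (v' i - s.g i), v',
     fun i => s.cost i + if (c t i).1 then m else 2⟩

end EF21

end

open EF21

/-! Every method is an inexact gradient scheme, and one Lyapunov argument serves all six. For a
function with `L`-Lipschitz gradient, a step `x - γ g` gains `γ/2 ‖∇F(x)‖²` and roughly `γ/2 ‖g‖²`,
and loses `γ/2 ‖g - ∇F(x)‖²` (`HasLipGrad.step`). Compressing the difference between a gradient and
its estimator shrinks the squared estimation error in expectation by a factor `1 - a`. Moving the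
iterate spoils half of this contraction and adds a multiple of `L̃² ‖x' - x‖² / a`
(`contraction_young`, `IsSmooth.gradErr_contract`). If the error enters the potential with a weight
of order `γ / a`, its contraction pays for the loss in the descent step, and the gain in `‖g‖²` pays
for the displacement as soon as `γ L̃ / a` is small. Hence the potential drops in expectation by a
multiple of `γ ‖∇F(x)‖²` per round. Summing over the rounds (`NoisePair.sum_lintegral_le`) and
dividing by `T` gives the rate, since `γ` is of order `a / L̃`.

The methods differ in what the error consists of. Partial participation only changes `a` from `α` to
`p α`. Bidirectional compression adds the distance between the master estimator and the mean of the
node estimators. Heavy ball becomes a plain inexact gradient method for an extrapolated iterate.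
With stochastic gradients each round adds a noise term, made small by the batch sizes. PAGE splits
the error into `g - v` and `v - ∇f`. The proximal method needs the variational inequality of the
prox and bounds the gradient mapping by the step length and the estimation error.

All random quantities are nonnegative, so the expectations are Lebesgue integrals, collected in
`ExpLE`, and no moment has to be shown finite in advance. The errors are averages over the nodes and
are bounded node by node; only the law of each node's input enters, so nodes may be dependent within
a round. The independence needed is that of the current inputs from the past, and of the two noise
sources from each other.

The scale `X` may be tiny, and `L̃` may vanish. For all methods but the proximal one, `X ≤ 1/2`
calls for a single round: then `‖∇F(x⁰)‖² ≤ 2 L̃ δ⁰ ≤ ε²` already holds. -/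

namespace EF21

/-! ### Averages over the nodes. -/

section Mean

variable {n : ℕ}

lemma mean_le_mean {u v : Fin n → ℝ} (h : ∀ i, u i ≤ v i) : mean u ≤ mean v := by
  unfold mean
  exact smul_le_smul_of_nonneg_left (Finset.sum_le_sum fun i _ => h i) (by positivity)

lemma mean_nonneg {u : Fin n → ℝ} (h : ∀ i, 0 ≤ u i) : 0 ≤ mean u := by
  unfold mean
  exact smul_nonneg (by positivity) (Finset.sum_nonneg fun i _ => h i)

lemma mean_add {V : Type*} [AddCommGroup V] [Module ℝ V] (u v : Fin n → V) :
    (mean fun i => u i + v i) = mean u + mean v := by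
  simp [mean, Finset.sum_add_distrib]

lemma mean_sub {V : Type*} [AddCommGroup V] [Module ℝ V] (u v : Fin n → V) :
    (mean fun i => u i - v i) = mean u - mean v := by
  simp [mean, Finset.sum_sub_distrib, smul_sub]

lemma mean_const_mul (c : ℝ) (u : Fin n → ℝ) : (mean fun i => c * u i) = c * mean u := by
  simp only [mean, ← Finset.mul_sum, smul_eq_mul]; ring

lemma mean_mul_const (c : ℝ) (u : Fin n → ℝ) : (mean fun i => u i * c) = mean u * c := by
  simp only [mean, ← Finset.sum_mul, smul_eq_mul]; ring

lemma mean_const {V : Type*} [AddCommGroup V] [Module ℝ V] (hn : 0 < n) (v : V) :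
    (mean fun _ : Fin n => v) = v := by
  have : (n : ℝ) ≠ 0 := by positivity
  simp only [mean, Finset.sum_const, Finset.card_univ, Fintype.card_fin]
  rw [← Nat.cast_smul_eq_nsmul ℝ, smul_smul, inv_mul_cancel₀ this, one_smul]

lemma norm_mean_sq_le {V : Type*} [NormedAddCommGroup V] [NormedSpace ℝ V] (v : Fin n → V) :
    ‖mean v‖ ^ 2 ≤ mean fun i => ‖v i‖ ^ 2 := by
  rcases Nat.eq_zero_or_pos n with rfl | hn
  · simp [mean]
  have hn' : (0 : ℝ) < n := by exact_mod_cast hn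
  have h1 : ‖∑ i, v i‖ ^ 2 ≤ (n : ℝ) * ∑ i, ‖v i‖ ^ 2 := by
    calc ‖∑ i, v i‖ ^ 2 ≤ (∑ i, ‖v i‖) ^ 2 := by gcongr; exact norm_sum_le _ _
      _ ≤ _ := by simpa using sq_sum_le_card_mul_sum_sq (s := Finset.univ) (f := fun i => ‖v i‖)
  simp only [mean, norm_smul, norm_inv, Real.norm_natCast, mul_pow, smul_eq_mul]
  calc (n : ℝ)⁻¹ ^ 2 * ‖∑ i, v i‖ ^ 2 ≤ (n : ℝ)⁻¹ ^ 2 * ((n : ℝ) * ∑ i, ‖v i‖ ^ 2) := by gcongr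
    _ = _ := by field_simp

lemma rms_nonneg (L : Fin n → ℝ) : 0 ≤ rms L := Real.sqrt_nonneg _

lemma sq_rms (L : Fin n → ℝ) : rms L ^ 2 = mean fun i => L i ^ 2 :=
  Real.sq_sqrt (mean_nonneg fun _ => sq_nonneg _)

end Mean

/-! ### Young's inequality and perturbed contractions. -/

section Young

variable {V : Type*} [SeminormedAddCommGroup V]

lemma norm_add_sq_le_young (a b : V) {s : ℝ} (hs : 0 < s) :
    ‖a + b‖ ^ 2 ≤ (1 + s) * ‖a‖ ^ 2 + (1 + 1 / s) * ‖b‖ ^ 2 := by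
  have h1 := norm_add_le a b
  have h2 : ‖a + b‖ ^ 2 ≤ (‖a‖ + ‖b‖) ^ 2 := by gcongr
  have h3 : 0 ≤ (s * ‖a‖ - ‖b‖) ^ 2 / s := by positivity
  have h4 : (s * ‖a‖ - ‖b‖) ^ 2 / s = s * ‖a‖ ^ 2 - 2 * ‖a‖ * ‖b‖ + 1 / s * ‖b‖ ^ 2 := by
    field_simp
    ring
  nlinarith

lemma norm_add_sq_le_two (a b : V) : ‖a + b‖ ^ 2 ≤ 2 * ‖a‖ ^ 2 + 2 * ‖b‖ ^ 2 := by
  have := norm_add_sq_le_young a b one_pos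
  linarith

lemma norm_sub_sq_le_two (a b : V) : ‖a - b‖ ^ 2 ≤ 2 * ‖a‖ ^ 2 + 2 * ‖b‖ ^ 2 := by
  simpa [sub_eq_add_neg] using norm_add_sq_le_two a (-b)

/-- A contraction by `1 - a` absorbs a perturbation `b` at the price of halving the rate. -/
lemma contraction_young {a : ℝ} (ha : 0 < a) (ha1 : a ≤ 1) (u b : V) :
    (1 - a) * ‖u + b‖ ^ 2 ≤ (1 - a / 2) * ‖u‖ ^ 2 + 2 / a * ‖b‖ ^ 2 := by
  -- The parameter `a / 2` in Young's inequality gives up half of the contraction, which leaves a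
  -- factor of order `1 / a` on `b`.
  have h := norm_add_sq_le_young u b (half_pos ha)
  have h0 : 0 ≤ 1 - a := by linarith
  have h1 : (1 - a) * (1 + a / 2) ≤ 1 - a / 2 := by nlinarith
  have h2 : (1 - a) * (1 + 1 / (a / 2)) ≤ 2 / a := by
    have : 1 / (a / 2) = 2 / a := by field_simp
    rw [this]
    have : a * (2 / a) = 2 := by field_simp
    nlinarith
  calc (1 - a) * ‖u + b‖ ^ 2
      ≤ (1 - a) * ((1 + a / 2) * ‖u‖ ^ 2 + (1 + 1 / (a / 2)) * ‖b‖ ^ 2) := by gcongr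
    _ = ((1 - a) * (1 + a / 2)) * ‖u‖ ^ 2 + ((1 - a) * (1 + 1 / (a / 2))) * ‖b‖ ^ 2 := by ring
    _ ≤ _ := by gcongr

end Young

/-! ### Functions with Lipschitz gradient: descent inequality and gradient errors. -/

section Smooth

variable {n d : ℕ}

/-- `F` is differentiable and its gradient is `L`-Lipschitz. -/
structure HasLipGrad (F : E d → ℝ) (L : ℝ) : Prop where
  nonneg : 0 ≤ L
  differentiable : Differentiable ℝ F
  lipschitz : ∀ x y, ‖gradient F x - gradient F y‖ ≤ L * ‖x - y‖

lemma hasGradientAt_avg {f : Fin n → E d → ℝ} (hf : ∀ i, Differentiable ℝ (f i)) (x : E d) :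
    HasGradientAt (avg f) (mean fun i => gradient (f i) x) x := by
  have h : HasFDerivAt (avg f) ((n : ℝ)⁻¹ • ∑ i, fderiv ℝ (f i) x) x :=
    (HasFDerivAt.fun_sum (u := Finset.univ) fun i _ => (hf i x).hasFDerivAt).const_smul (n : ℝ)⁻¹
  have := h.hasGradientAt
  convert this using 1
  simp [mean, gradient]

lemma gradient_avg {f : Fin n → E d → ℝ} (hf : ∀ i, Differentiable ℝ (f i)) (x : E d) :
    gradient (avg f) x = mean fun i => gradient (f i) x :=
  (hasGradientAt_avg hf x).gradient

lemma differentiable_avg {f : Fin n → E d → ℝ} (hf : ∀ i, Differentiable ℝ (f i)) :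
    Differentiable ℝ (avg f) := fun x => (hasGradientAt_avg hf x).differentiableAt

lemma IsSmooth.gradient_avg {f : Fin n → E d → ℝ} {L : Fin n → ℝ} (hf : IsSmooth f L) (x : E d) :
    gradient (avg f) x = mean fun i => gradient (f i) x :=
  EF21.gradient_avg hf.differentiable x

lemma IsSmooth.norm_sub_sq_le {f : Fin n → E d → ℝ} {L : Fin n → ℝ} (hf : IsSmooth f L)
    (i : Fin n) (x y : E d) :
    ‖gradient (f i) x - gradient (f i) y‖ ^ 2 ≤ L i ^ 2 * ‖x - y‖ ^ 2 := by
  rw [← mul_pow]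
  exact pow_le_pow_left₀ (norm_nonneg _) (hf.lipschitz i x y) 2

lemma IsSmooth.mean_sq_le {f : Fin n → E d → ℝ} {L : Fin n → ℝ} (hf : IsSmooth f L) (x y : E d) :
    (mean fun i => ‖gradient (f i) x - gradient (f i) y‖ ^ 2) ≤ rms L ^ 2 * ‖x - y‖ ^ 2 := by
  rw [sq_rms, ← mean_mul_const]
  exact mean_le_mean fun i => hf.norm_sub_sq_le i x y

lemma IsSmooth.hasLipGrad {f : Fin n → E d → ℝ} {L : Fin n → ℝ} (hf : IsSmooth f L) :
    HasLipGrad (avg f) (rms L) where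
  nonneg := rms_nonneg L
  differentiable := differentiable_avg hf.differentiable
  lipschitz x y := by
    have h : ‖gradient (avg f) x - gradient (avg f) y‖ ^ 2 ≤ (rms L * ‖x - y‖) ^ 2 := by
      rw [hf.gradient_avg, hf.gradient_avg, ← mean_sub, mul_pow]
      exact (norm_mean_sq_le _).trans (hf.mean_sq_le x y)
    exact le_of_sq_le_sq h (mul_nonneg (rms_nonneg L) (norm_nonneg _))

lemma IsSmooth.continuous_gradient {f : Fin n → E d → ℝ} {L : Fin n → ℝ} (hf : IsSmooth f L)
    (i : Fin n) : Continuous (gradient (f i)) := by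
  refine (LipschitzWith.of_dist_le_mul (K := (L i).toNNReal) fun x y => ?_).continuous
  rw [dist_eq_norm, dist_eq_norm]
  refine (hf.lipschitz i x y).trans ?_
  gcongr
  exact Real.le_coe_toNNReal _

namespace HasLipGrad

variable {F : E d → ℝ} {L : ℝ} (hF : HasLipGrad F L)
include hF

lemma continuous_gradient : Continuous (gradient F) := by
  refine (LipschitzWith.of_dist_le_mul (K := L.toNNReal) fun x y => ?_).continuous
  rw [dist_eq_norm, dist_eq_norm]
  refine (hF.lipschitz x y).trans ?_
  gcongr
  exact Real.le_coe_toNNReal _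

lemma descent (x y : E d) :
    F y ≤ F x + inner ℝ (gradient F x) (y - x) + L / 2 * ‖y - x‖ ^ 2 := by
  -- `h` is the restriction of `F` to the segment minus its quadratic upper model. Its derivative is
  -- the inner product of a gradient difference with `y - x`, minus `L s ‖y - x‖²`, hence
  -- nonpositive by the Lipschitz bound and Cauchy–Schwarz.
  set h : ℝ → ℝ := fun s =>
    F (x + s • (y - x)) - s * inner ℝ (gradient F x) (y - x) - L / 2 * ‖y - x‖ ^ 2 * s ^ 2
    with hh
  have hd : ∀ s, HasDerivAt h (inner ℝ (gradient F (x + s • (y - x))) (y - x)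
      - inner ℝ (gradient F x) (y - x) - L / 2 * ‖y - x‖ ^ 2 * (2 * s)) s := by
    intro s
    have h1 : HasDerivAt (fun s : ℝ => x + s • (y - x)) (y - x) s := by
      simpa using ((hasDerivAt_id s).smul_const (y - x)).const_add x
    have h2 : HasDerivAt (fun s : ℝ => F (x + s • (y - x)))
        (inner ℝ (gradient F (x + s • (y - x))) (y - x)) s := by
      have := (hF.differentiable (x + s • (y - x))).hasFDerivAt.comp_hasDerivAt s h1
      rwa [← inner_gradient_left] at this
    have h3 : HasDerivAt (fun s : ℝ => s ^ 2) (2 * s) s := by simpa using hasDerivAt_pow 2 s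
    have h4 : HasDerivAt (fun s : ℝ => s * inner ℝ (gradient F x) (y - x))
        (inner ℝ (gradient F x) (y - x)) s := by
      simpa using (hasDerivAt_id s).mul_const (inner ℝ (gradient F x) (y - x))
    exact (h2.sub h4).sub (h3.const_mul _)
  have hanti : AntitoneOn h (Set.Icc 0 1) := by
    refine antitoneOn_of_deriv_nonpos (convex_Icc 0 1)
      (fun s _ => (hd s).continuousAt.continuousWithinAt)
      (fun s _ => (hd s).differentiableAt.differentiableWithinAt) fun s hs => ?_
    rw [interior_Icc] at hs
    rw [(hd s).deriv, ← inner_sub_left]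
    have h1 := real_inner_le_norm (gradient F (x + s • (y - x)) - gradient F x) (y - x)
    have h2 := hF.lipschitz (x + s • (y - x)) x
    rw [add_sub_cancel_left, norm_smul, Real.norm_of_nonneg hs.1.le] at h2
    nlinarith [norm_nonneg (y - x)]
  have := hanti (Set.left_mem_Icc.2 zero_le_one) (Set.right_mem_Icc.2 zero_le_one) zero_le_one
  simp only [hh, one_smul, zero_smul, add_zero, add_sub_cancel] at this
  linarith

/-- One inexact gradient step `x ↦ x - γ g`. -/
lemma step {γ : ℝ} (hγ : 0 < γ) (x g : E d) :
    F (x - γ • g) + γ / 2 * ‖gradient F x‖ ^ 2 + (γ / 2 - L * γ ^ 2 / 2) * ‖g‖ ^ 2 ≤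
      F x + γ / 2 * ‖g - gradient F x‖ ^ 2 := by
  have h := hF.descent x (x - γ • g)
  have e : x - γ • g - x = -(γ • g) := by abel
  rw [e, inner_neg_right, norm_neg, inner_smul_right, norm_smul, Real.norm_of_nonneg hγ.le,
    mul_pow] at h
  rw [norm_sub_sq_real, real_inner_comm]
  nlinarith

/-- An exact gradient step of length `1 / L` lowers `F` by `‖∇F(x)‖² / (2 L)`, which cannot exceed
the gap. This bound makes a single round sufficient when the scale of the problem is small. -/
lemma sq_norm_gradient_le (hb : BddBelow (Set.range F)) (x : E d) :
    ‖gradient F x‖ ^ 2 ≤ 2 * L * gap F x := by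
  have key : ∀ s : ℝ, 0 ≤ s → (s - L * s ^ 2 / 2) * ‖gradient F x‖ ^ 2 ≤ gap F x := by
    intro s hs
    have h := hF.descent x (x - s • gradient F x)
    have e : x - s • gradient F x - x = -(s • gradient F x) := by abel
    rw [e, inner_neg_right, norm_neg, inner_smul_right, norm_smul, Real.norm_of_nonneg hs,
      mul_pow, real_inner_self_eq_norm_sq] at h
    have h2 := ciInf_le hb (x - s • gradient F x)
    unfold gap
    nlinarith
  rcases hF.nonneg.eq_or_lt with h0 | hL
  · rw [← h0]
    by_contra hcon
    have hpos : 0 < ‖gradient F x‖ ^ 2 := by linarith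
    -- For `L = 0` the step may be arbitrarily long. This length would lower `F` by `gap F x + 1`,
    -- below its infimum.
    have h1 := key ((gap F x + 1) / ‖gradient F x‖ ^ 2) (by
      have : 0 ≤ gap F x := by simpa using key 0 le_rfl
      positivity)
    rw [← h0] at h1
    rw [zero_mul, zero_div, sub_zero, div_mul_cancel₀ _ hpos.ne'] at h1
    linarith
  · have h1 := key (1 / L) (by positivity)
    have : 1 / L - L * (1 / L) ^ 2 / 2 = 1 / (2 * L) := by field_simp; ring
    rw [this, div_mul_eq_mul_div, one_mul, div_le_iff₀ (by positivity)] at h1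
    linarith

end HasLipGrad

lemma gap_nonneg {F : E d → ℝ} (hb : BddBelow (Set.range F)) (x : E d) : 0 ≤ gap F x :=
  sub_nonneg.2 (ciInf_le hb x)

/-- The mean squared error of gradient estimators `gᵢ` at `x`. -/
noncomputable def gradErr (f : Fin n → E d → ℝ) (g : Fin n → E d) (x : E d) : ℝ :=
  mean fun i => ‖g i - gradient (f i) x‖ ^ 2

lemma gradErr_nonneg (f : Fin n → E d → ℝ) (g : Fin n → E d) (x : E d) : 0 ≤ gradErr f g x :=
  mean_nonneg fun _ => sq_nonneg _

lemma IsSmooth.norm_mean_sub_sq_le {f : Fin n → E d → ℝ} {L : Fin n → ℝ} (hf : IsSmooth f L)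
    (g : Fin n → E d) (x : E d) : ‖mean g - gradient (avg f) x‖ ^ 2 ≤ gradErr f g x := by
  rw [hf.gradient_avg, ← mean_sub]
  exact norm_mean_sq_le _

/-- The factor `1 - a` is what compression leaves of the error at the new point `y`. Averaging
`contraction_young` over the nodes returns to the old point `x`, and the averaged gradient
displacement produces exactly `rms L`. -/
lemma IsSmooth.gradErr_contract {f : Fin n → E d → ℝ} {L : Fin n → ℝ} (hf : IsSmooth f L)
    {a : ℝ} (ha : 0 < a) (ha1 : a ≤ 1) (g : Fin n → E d) (x y : E d) :
    (1 - a) * gradErr f g y ≤ (1 - a / 2) * gradErr f g x + 2 / a * (rms L ^ 2 * ‖y - x‖ ^ 2) := by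
  calc (1 - a) * gradErr f g y
      = mean fun i => (1 - a) * ‖g i - gradient (f i) y‖ ^ 2 := (mean_const_mul _ _).symm
    _ ≤ mean fun i => (1 - a / 2) * ‖g i - gradient (f i) x‖ ^ 2 +
          2 / a * ‖gradient (f i) y - gradient (f i) x‖ ^ 2 := by
        refine mean_le_mean fun i => ?_
        have := contraction_young ha ha1 (g i - gradient (f i) x)
          (gradient (f i) x - gradient (f i) y)
        rwa [sub_add_sub_cancel, norm_sub_rev (gradient (f i) x)] at this
    _ = (1 - a / 2) * gradErr f g x +
          2 / a * mean fun i => ‖gradient (f i) y - gradient (f i) x‖ ^ 2 := by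
        rw [mean_add, mean_const_mul, mean_const_mul]; rfl
    _ ≤ _ := by gcongr; exact hf.mean_sq_le y x

lemma IsSmooth.gradErr_le_two {f : Fin n → E d → ℝ} {L : Fin n → ℝ} (hf : IsSmooth f L)
    (g : Fin n → E d) (x y : E d) :
    gradErr f g y ≤ 2 * gradErr f g x + 2 * (rms L ^ 2 * ‖y - x‖ ^ 2) := by
  calc gradErr f g y
      ≤ mean fun i => 2 * ‖g i - gradient (f i) x‖ ^ 2 +
          2 * ‖gradient (f i) y - gradient (f i) x‖ ^ 2 := by
        refine mean_le_mean fun i => ?_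
        have := norm_sub_sq_le_two (g i - gradient (f i) x) (gradient (f i) y - gradient (f i) x)
        rwa [sub_sub_sub_cancel_right] at this
    _ = 2 * gradErr f g x + 2 * mean fun i => ‖gradient (f i) y - gradient (f i) x‖ ^ 2 := by
        rw [mean_add, mean_const_mul, mean_const_mul]; rfl
    _ ≤ _ := by gcongr; exact hf.mean_sq_le y x

end Smooth

/-! ### Bounds on expectations of nonnegative random variables. -/

section Expectation

/-- `h` is a nonnegative random variable with expectation at most `B`. -/
structure ExpLE {W : Type*} [MeasurableSpace W] (ρ : Measure W) (h : W → ℝ) (B : ℝ) : Prop where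
  measurable : Measurable h
  nonneg : ∀ w, 0 ≤ h w
  bound_nonneg : 0 ≤ B
  lintegral_le : ∫⁻ w, ENNReal.ofReal (h w) ∂ρ ≤ ENNReal.ofReal B

namespace ExpLE

variable {W W' : Type*} [MeasurableSpace W] [MeasurableSpace W'] {ρ : Measure W} {σ : Measure W'}
  {h h' : W → ℝ} {B B' : ℝ}

lemma const [IsProbabilityMeasure ρ] {c : ℝ} (hc : 0 ≤ c) : ExpLE ρ (fun _ => c) c :=
  ⟨measurable_const, fun _ => hc, hc, by simp⟩

lemma add (H : ExpLE ρ h B) (H' : ExpLE ρ h' B') : ExpLE ρ (fun w => h w + h' w) (B + B') where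
  measurable := H.measurable.add H'.measurable
  nonneg w := add_nonneg (H.nonneg w) (H'.nonneg w)
  bound_nonneg := add_nonneg H.bound_nonneg H'.bound_nonneg
  lintegral_le := by
    simp_rw [ENNReal.ofReal_add (H.nonneg _) (H'.nonneg _)]
    rw [lintegral_add_left H.measurable.ennreal_ofReal,
      ENNReal.ofReal_add H.bound_nonneg H'.bound_nonneg]
    exact add_le_add H.lintegral_le H'.lintegral_le

lemma const_mul (H : ExpLE ρ h B) {c : ℝ} (hc : 0 ≤ c) : ExpLE ρ (fun w => c * h w) (c * B) where
  measurable := H.measurable.const_mul c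
  nonneg w := mul_nonneg hc (H.nonneg w)
  bound_nonneg := mul_nonneg hc H.bound_nonneg
  lintegral_le := by
    simp_rw [ENNReal.ofReal_mul hc]
    rw [lintegral_const_mul _ H.measurable.ennreal_ofReal]
    gcongr
    exact H.lintegral_le

lemma mono (H : ExpLE ρ h B) (hm : Measurable h') (h0 : ∀ w, 0 ≤ h' w) (hle : ∀ w, h' w ≤ h w)
    (hB : B ≤ B') : ExpLE ρ h' B' :=
  ⟨hm, h0, H.bound_nonneg.trans hB,
    (lintegral_mono fun w => ENNReal.ofReal_le_ofReal (hle w)).trans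
      (H.lintegral_le.trans (ENNReal.ofReal_le_ofReal hB))⟩

lemma congr (H : ExpLE ρ h B) (e : ∀ w, h' w = h w) : ExpLE ρ h' B := by
  rwa [funext e]

lemma mono_right (H : ExpLE ρ h B) (hB : B ≤ B') : ExpLE ρ h B' :=
  H.mono H.measurable H.nonneg (fun _ => le_rfl) hB

lemma mean {n : ℕ} {h : Fin n → W → ℝ} {B : Fin n → ℝ} (H : ∀ i, ExpLE ρ (h i) (B i)) :
    ExpLE ρ (fun w => EF21.mean fun i => h i w) (EF21.mean B) where
  measurable := by
    simp only [EF21.mean, smul_eq_mul]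
    exact (Finset.measurable_sum _ fun i _ => (H i).measurable).const_mul _
  nonneg w := mean_nonneg fun i => (H i).nonneg w
  bound_nonneg := mean_nonneg fun i => (H i).bound_nonneg
  lintegral_le := by
    have hn : (0 : ℝ) ≤ (n : ℝ)⁻¹ := by positivity
    simp only [EF21.mean, smul_eq_mul]
    simp_rw [ENNReal.ofReal_mul hn, ENNReal.ofReal_sum_of_nonneg fun i _ => (H i).nonneg _]
    rw [lintegral_const_mul _ (Finset.measurable_sum _ fun i _ => (H i).measurable.ennreal_ofReal),
      lintegral_finsetSum _ fun i _ => (H i).measurable.ennreal_ofReal,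
      ENNReal.ofReal_sum_of_nonneg fun i _ => (H i).bound_nonneg]
    gcongr with i
    exact (H i).lintegral_le

lemma of_map {φ : W → W'} (hφ : Measurable φ) {k : W' → ℝ} (H : ExpLE (ρ.map φ) k B) :
    ExpLE ρ (fun w => k (φ w)) B where
  measurable := H.measurable.comp hφ
  nonneg w := H.nonneg _
  bound_nonneg := H.bound_nonneg
  lintegral_le := by
    have := H.lintegral_le
    rwa [lintegral_map H.measurable.ennreal_ofReal hφ] at this

/-- Tonelli as conditioning: the second input is averaged first, with the first one frozen, and the
resulting bound is then averaged over the first. `prod_symm` conditions in the other order. -/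
lemma prod [SFinite σ] {k : W × W' → ℝ} (hk : Measurable k)
    (H : ∀ w, ExpLE σ (fun w' => k (w, w')) (h w)) (H' : ExpLE ρ h B) : ExpLE (ρ.prod σ) k B where
  measurable := hk
  nonneg w := (H w.1).nonneg w.2
  bound_nonneg := H'.bound_nonneg
  lintegral_le := by
    rw [lintegral_prod _ hk.ennreal_ofReal.aemeasurable]
    exact (lintegral_mono fun w => (H w).lintegral_le).trans H'.lintegral_le

lemma prod_symm [SFinite ρ] [SFinite σ] {k : W × W' → ℝ} {h : W' → ℝ} (hk : Measurable k)
    (H : ∀ w', ExpLE ρ (fun w => k (w, w')) (h w')) (H' : ExpLE σ h B) :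
    ExpLE (ρ.prod σ) k B where
  measurable := hk
  nonneg w := (H w.2).nonneg w.1
  bound_nonneg := H'.bound_nonneg
  lintegral_le := by
    rw [lintegral_prod_symm _ hk.ennreal_ofReal.aemeasurable]
    exact (lintegral_mono fun w => (H w).lintegral_le).trans H'.lintegral_le

lemma fst [IsProbabilityMeasure ρ] [IsProbabilityMeasure σ] (H : ExpLE ρ h B) :
    ExpLE (ρ.prod σ) (fun w => h w.1) B :=
  H.prod (H.measurable.comp measurable_fst) fun w => const (H.nonneg w)

lemma snd [IsProbabilityMeasure ρ] [IsProbabilityMeasure σ] {k : W' → ℝ} (H : ExpLE σ k B) :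
    ExpLE (ρ.prod σ) (fun w => k w.2) B :=
  H.prod_symm (H.measurable.comp measurable_snd) fun w => const (H.nonneg w)

end ExpLE

lemma ofReal_norm_sq {V : Type*} [SeminormedAddCommGroup V] (v : V) :
    ENNReal.ofReal (‖v‖ ^ 2) = ‖v‖ₑ ^ 2 := by
  rw [ENNReal.ofReal_pow (norm_nonneg _), ofReal_norm]

lemma IsContractive.measurable_apply {S : Type*} [MeasurableSpace S] {d : ℕ} {𝒞 : S → E d → E d}
    {ν : Measure S} {α : ℝ} (h𝒞 : IsContractive 𝒞 ν α) {W : Type*} [MeasurableSpace W]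
    {s : W → S} {y : W → E d} (hs : Measurable s) (hy : Measurable y) :
    Measurable fun w => 𝒞 (s w) (y w) :=
  h𝒞.measurable.comp (hs.prodMk hy)

lemma IsContractive.expLE {S : Type*} [MeasurableSpace S] {d : ℕ} {𝒞 : S → E d → E d}
    {ν : Measure S} {α : ℝ} (h𝒞 : IsContractive 𝒞 ν α) (hα : α ≤ 1) (y : E d) :
    ExpLE ν (fun s => ‖𝒞 s y - y‖ ^ 2) ((1 - α) * ‖y‖ ^ 2) where
  measurable := by
    have := h𝒞.measurable_apply measurable_id (measurable_const (a := y))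
    simp only [id] at this
    fun_prop
  nonneg _ := sq_nonneg _
  bound_nonneg := mul_nonneg (by linarith) (sq_nonneg _)
  lintegral_le := by
    rw [ENNReal.ofReal_mul (by linarith), ofReal_norm_sq]
    simp_rw [ofReal_norm_sq]
    exact h𝒞.contract y

/-- The compressed update `g + 𝒞(y - g)` is closer to `y` than `g`. -/
lemma IsContractive.expLE_update {S : Type*} [MeasurableSpace S] {d : ℕ} {𝒞 : S → E d → E d}
    {ν : Measure S} {α : ℝ} (h𝒞 : IsContractive 𝒞 ν α) (hα : α ≤ 1) (g y : E d) :
    ExpLE ν (fun s => ‖g + 𝒞 s (y - g) - y‖ ^ 2) ((1 - α) * ‖g - y‖ ^ 2) := by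
  have := h𝒞.expLE hα (y - g)
  rw [norm_sub_rev y g] at this
  convert this using 4
  abel

end Expectation

/-! ### Independence of the past from the current inputs, and the Lyapunov argument. -/

section Independence

/-- The σ-algebra generated by the first `a` terms of a process. -/
abbrev history {Ω U : Type*} [mU : MeasurableSpace U] (ξ : ℕ → Ω → U) (a : ℕ) : MeasurableSpace Ω :=
  ⨆ s ∈ Set.Iio a, mU.comap (ξ s)

lemma history_mono {Ω U : Type*} [MeasurableSpace U] (ξ : ℕ → Ω → U) {a b : ℕ} (h : a ≤ b) :
    history ξ a ≤ history ξ b :=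
  biSup_mono fun _ hs => lt_of_lt_of_le hs h

/-- The state before round `t` is a function of the earlier inputs only. The shift `k` counts the
terms of `ζ` that initialization has used up: it is `1` for EF21-SGD, whose initial estimators are
already random, and `0` otherwise. -/
lemma measurable_history {Ω U V 𝒳 : Type*} [mU : MeasurableSpace U] [mV : MeasurableSpace V]
    [MeasurableSpace 𝒳] {ξ : ℕ → Ω → U} {ζ : ℕ → Ω → V} {k : ℕ} {X : ℕ → Ω → 𝒳}
    {F : 𝒳 → U × V → 𝒳} (hF : Measurable (Function.uncurry F))
    (h0 : Measurable[history ζ k] (X 0))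
    (hX : ∀ t ω, X (t + 1) ω = F (X t ω) (ξ t ω, ζ (t + k) ω)) (t : ℕ) :
    Measurable[history ξ t ⊔ history ζ (t + k)] (X t) := by
  induction t with
  | zero => rw [zero_add]; exact h0.mono le_sup_right le_rfl
  | succ t ih =>
    have e : X (t + 1) = fun ω => Function.uncurry F (X t ω, (ξ t ω, ζ (t + k) ω)) :=
      funext (hX t)
    rw [e]
    have m1 : Measurable[history ξ (t + 1) ⊔ history ζ (t + 1 + k)] (X t) :=
      ih.mono (sup_le_sup (history_mono ξ (by omega)) (history_mono ζ (by omega))) le_rfl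
    have m2 : Measurable[history ξ (t + 1) ⊔ history ζ (t + 1 + k)] (ξ t) :=
      (comap_measurable (ξ t)).mono (le_sup_of_le_left
        (le_iSup₂_of_le (f := fun s (_ : s ∈ Set.Iio (t + 1)) => mU.comap (ξ s)) t
          (by simp) le_rfl)) le_rfl
    have m3 : Measurable[history ξ (t + 1) ⊔ history ζ (t + 1 + k)] (ζ (t + k)) :=
      (comap_measurable (ζ (t + k))).mono (le_sup_of_le_right
        (le_iSup₂_of_le (f := fun s (_ : s ∈ Set.Iio (t + 1 + k)) => mV.comap (ζ s)) (t + k)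
          (by simp) le_rfl)) le_rfl
    exact hF.comp (m1.prodMk (m2.prodMk m3))

variable {Ω : Type*} [MeasurableSpace Ω] {μ : Measure Ω}

/-- A finite intersection over the disjoint union splits into a left and a right part. The two parts
are independent by `h`, and each factorizes inside its own family. -/
lemma iIndep_sumElim {ι κ : Type*} {m₁ : ι → MeasurableSpace Ω} {m₂ : κ → MeasurableSpace Ω}
    (h₁ : iIndep m₁ μ) (h₂ : iIndep m₂ μ) (h : Indep (⨆ i, m₁ i) (⨆ i, m₂ i) μ) :
    iIndep (Sum.elim m₁ m₂) μ := by
  rw [iIndep_iff]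
  intro s f hf
  have e1 : (⋂ i ∈ s, f i) =
      (⋂ i ∈ s.toLeft, f (Sum.inl i)) ∩ (⋂ i ∈ s.toRight, f (Sum.inr i)) := by
    ext ω
    simp
  have e2 : ∏ i ∈ s, μ (f i) =
      (∏ i ∈ s.toLeft, μ (f (Sum.inl i))) * ∏ i ∈ s.toRight, μ (f (Sum.inr i)) := by
    conv_lhs => rw [← Finset.toLeft_disjSum_toRight (u := s)]
    exact Finset.prod_disjSum _ _ _
  have hl : ∀ i ∈ s.toLeft, MeasurableSet[m₁ i] (f (Sum.inl i)) :=
    fun i hi => hf _ (Finset.mem_toLeft.1 hi)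
  have hr : ∀ i ∈ s.toRight, MeasurableSet[m₂ i] (f (Sum.inr i)) :=
    fun i hi => hf _ (Finset.mem_toRight.1 hi)
  rw [e1, e2, ← h₁.meas_biInter hl, ← h₂.meas_biInter hr]
  refine (Indep_iff _ _ _).1 h _ _ ?_ ?_
  · exact Finset.measurableSet_biInter _ fun i hi => (le_iSup m₁ i) _ (hl i hi)
  · exact Finset.measurableSet_biInter _ fun i hi => (le_iSup m₂ i) _ (hr i hi)

/-- A constant generates the trivial σ-algebra, whose only sets are `∅` and everything. This
provides a dummy second noise source for the methods that have only one. -/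
lemma iIndepFun_const {ι S : Type*} [MeasurableSpace S] [IsProbabilityMeasure μ] (c : ι → S) :
    iIndepFun (fun i (_ : Ω) => c i) μ := by
  rw [iIndepFun_iff_iIndep, iIndep_iff]
  intro s f hf
  have hf' : ∀ i ∈ s, f i = ∅ ∨ f i = Set.univ := fun i hi => by
    have := hf i hi
    rwa [MeasurableSpace.comap_const, MeasurableSpace.measurableSet_bot_iff] at this
  by_cases h : ∃ i ∈ s, f i = ∅
  · obtain ⟨i, hi, h0⟩ := h
    rw [Finset.prod_eq_zero hi (by simp [h0])]
    refine measure_mono_null (Set.biInter_subset_of_mem hi) (by simp [h0])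
  · push Not at h
    have h1 : ∀ i ∈ s, f i = Set.univ := fun i hi =>
      (hf' i hi).resolve_left (Set.nonempty_iff_ne_empty.1 (h i hi))
    rw [Finset.prod_congr rfl fun i hi => by rw [h1 i hi], Set.iInter₂_congr h1]
    simp

/-- Two independent sequences of independent random inputs. -/
structure NoisePair {U V : Type*} [MeasurableSpace U] [MeasurableSpace V] (ξ : ℕ → Ω → U)
    (ζ : ℕ → Ω → V) (μ : Measure Ω) : Prop where
  measurable₁ : ∀ t, Measurable (ξ t)
  measurable₂ : ∀ t, Measurable (ζ t)
  indep₁ : iIndepFun ξ μ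
  indep₂ : iIndepFun ζ μ
  indep : IndepNoise ξ ζ μ

namespace NoisePair

variable {U V : Type*} [mU : MeasurableSpace U] [mV : MeasurableSpace V] {ξ : ℕ → Ω → U}
  {ζ : ℕ → Ω → V}

lemma iIndep_comap (H : NoisePair ξ ζ μ) :
    iIndep (Sum.elim (fun t => mU.comap (ξ t)) (fun t => mV.comap (ζ t))) μ := by
  refine iIndep_sumElim H.indep₁.iIndep H.indep₂.iIndep ?_
  have := (IndepFun_iff_Indep _ _ _).1 H.indep
  simpa only [MeasurableSpace.pi, MeasurableSpace.comap_iSup, MeasurableSpace.comap_comp,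
    Function.comp_def] using this

lemma comap_le (H : NoisePair ξ ζ μ) (i : ℕ ⊕ ℕ) :
    Sum.elim (fun t => mU.comap (ξ t)) (fun t => mV.comap (ζ t)) i ≤ ‹MeasurableSpace Ω› := by
  rcases i with t | t
  · exact (H.measurable₁ t).comap_le
  · exact (H.measurable₂ t).comap_le

/-- Past and present inputs sit at disjoint indices of one jointly independent family. -/
lemma indep_history (H : NoisePair ξ ζ μ) (a b : ℕ) :
    Indep (history ξ a ⊔ history ζ b) (mU.comap (ξ a) ⊔ mV.comap (ζ b)) μ := by
  have h := indep_iSup_of_disjoint H.comap_le H.iIndep_comap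
    (S := Sum.inl '' Set.Iio a ∪ Sum.inr '' Set.Iio b) (T := {Sum.inl a, Sum.inr b}) (by
      rw [Set.disjoint_left]
      rintro i (⟨s, hs, rfl⟩ | ⟨s, hs, rfl⟩) hi
      · simp at hi hs; omega
      · simp at hi hs; omega)
  rw [iSup_union, iSup_image, iSup_image, iSup_pair] at h
  exact h

lemma indepFun_pair (H : NoisePair ξ ζ μ) (a b : ℕ) : IndepFun (ξ a) (ζ b) μ := by
  rw [IndepFun_iff_Indep]
  have h := indep_iSup_of_disjoint H.comap_le H.iIndep_comap
    (S := {Sum.inl a}) (T := {Sum.inr b}) (by simp)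
  simpa only [iSup_singleton, Sum.elim_inl, Sum.elim_inr] using h

lemma history_le (H : NoisePair ξ ζ μ) (a b : ℕ) :
    history ξ a ⊔ history ζ b ≤ ‹MeasurableSpace Ω› :=
  sup_le (iSup₂_le fun s _ => (H.measurable₁ s).comap_le)
    (iSup₂_le fun s _ => (H.measurable₂ s).comap_le)

lemma indepFun_of_history (H : NoisePair ξ ζ μ) {𝒳 : Type*} [MeasurableSpace 𝒳] {a b : ℕ}
    {X : Ω → 𝒳} (hX : Measurable[history ξ a ⊔ history ζ b] X) :
    IndepFun X (fun ω => (ξ a ω, ζ b ω)) μ := by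
  rw [IndepFun_iff_Indep]
  refine indep_of_indep_of_le (H.indep_history a b) hX.comap_le ?_
  exact (MeasurableSpace.comap_prodMk _ _).le

lemma measurable_run (H : NoisePair ξ ζ μ) {𝒳 : Type*} [MeasurableSpace 𝒳] {k : ℕ}
    {X : ℕ → Ω → 𝒳} {F : 𝒳 → U × V → 𝒳} (hF : Measurable (Function.uncurry F))
    (h0 : Measurable[history ζ k] (X 0))
    (hX : ∀ t ω, X (t + 1) ω = F (X t ω) (ξ t ω, ζ (t + k) ω)) (t : ℕ) : Measurable (X t) :=
  (measurable_history hF h0 hX t).mono (H.history_le _ _) le_rfl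

/-- The Lyapunov argument: if one round decreases the potential `Ψ` by at least `N` in expectation,
up to an error `c`, then the expectations of `N` along the run sum up to at most the initial
potential plus the accumulated errors. -/
theorem sum_lintegral_le [IsProbabilityMeasure μ] (H : NoisePair ξ ζ μ) {𝒳 : Type*}
    [MeasurableSpace 𝒳] {k : ℕ} {X : ℕ → Ω → 𝒳} {F : 𝒳 → U × V → 𝒳}
    (hF : Measurable (Function.uncurry F)) (h0 : Measurable[history ζ k] (X 0))
    (hX : ∀ t ω, X (t + 1) ω = F (X t ω) (ξ t ω, ζ (t + k) ω))
    {D : 𝒳 → Prop} (hD0 : ∀ ω, D (X 0 ω)) (hD : ∀ x w, D x → D (F x w))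
    {Ψ N : 𝒳 → ℝ} {c : ℝ} (hΨ : Measurable Ψ) (hN : Measurable N) (hN0 : ∀ x, 0 ≤ N x)
    (hstep : ∀ t x, D x → ∃ B, ExpLE ((μ.map (ξ t)).prod (μ.map (ζ (t + k))))
      (fun w => Ψ (F x w)) B ∧ B + N x ≤ Ψ x + c) (T : ℕ) :
    ∑ t ∈ Finset.range T, ∫⁻ ω, ENNReal.ofReal (N (X t ω)) ∂μ ≤
      ∫⁻ ω, ENNReal.ofReal (Ψ (X 0 ω)) ∂μ + T * ENNReal.ofReal c := by
  have hmeas := measurable_history hF h0 hX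
  have hXm := H.measurable_run hF h0 hX
  have hXD : ∀ t ω, D (X t ω) := by
    intro t ω
    induction t with
    | zero => exact hD0 ω
    | succ t ih => rw [hX]; exact hD _ _ ih
  have one : ∀ t, ∫⁻ ω, ENNReal.ofReal (Ψ (X (t + 1) ω)) ∂μ +
      ∫⁻ ω, ENNReal.ofReal (N (X t ω)) ∂μ ≤
      ∫⁻ ω, ENNReal.ofReal (Ψ (X t ω)) ∂μ + ENNReal.ofReal c := by
    intro t
    have hu : Measurable fun ω => (ξ t ω, ζ (t + k) ω) :=
      (H.measurable₁ t).prodMk (H.measurable₂ _)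
    -- The two current inputs are independent of each other, and the pair is independent of the
    -- state. The expectation after the round is therefore an iterated integral with the state
    -- frozen, to which the one-step hypothesis applies pointwise.
    have hlaw : μ.map (fun ω => (ξ t ω, ζ (t + k) ω)) = (μ.map (ξ t)).prod (μ.map (ζ (t + k))) :=
      (H.indepFun_pair t (t + k)).map_prod_eq_prod_map_map (H.measurable₁ t).aemeasurable
        (H.measurable₂ _).aemeasurable
    have hjoint := (H.indepFun_of_history (hmeas t)).map_prod_eq_prod_map_map
      (hXm t).aemeasurable hu.aemeasurable
    rw [hlaw] at hjoint
    have hΨF : Measurable fun p : 𝒳 × (U × V) => ENNReal.ofReal (Ψ (F p.1 p.2)) :=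
      (hΨ.comp hF).ennreal_ofReal
    have := Measure.isProbabilityMeasure_map (μ := μ) (H.measurable₁ t).aemeasurable
    have := Measure.isProbabilityMeasure_map (μ := μ) (H.measurable₂ (t + k)).aemeasurable
    have := Measure.isProbabilityMeasure_map (μ := μ) (hXm t).aemeasurable
    have e : ∫⁻ ω, ENNReal.ofReal (Ψ (X (t + 1) ω)) ∂μ =
        ∫⁻ ω, ∫⁻ w, ENNReal.ofReal (Ψ (F (X t ω) w))
          ∂((μ.map (ξ t)).prod (μ.map (ζ (t + k)))) ∂μ := by
      simp_rw [hX]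
      rw [← lintegral_map (g := fun ω => (X t ω, (ξ t ω, ζ (t + k) ω)))
        hΨF ((hXm t).prodMk hu), hjoint, lintegral_prod _ hΨF.aemeasurable,
        lintegral_map (Measurable.lintegral_prod_right' hΨF) (hXm t)]
    have hNX : Measurable fun ω => ENNReal.ofReal (N (X t ω)) :=
      (hN.comp (hXm t)).ennreal_ofReal
    rw [e, ← lintegral_add_right _ hNX]
    calc _ ≤ ∫⁻ ω, (ENNReal.ofReal (Ψ (X t ω)) + ENNReal.ofReal c) ∂μ := by
          refine lintegral_mono fun ω => ?_
          obtain ⟨B, hB, hle⟩ := hstep t (X t ω) (hXD t ω)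
          calc _ ≤ ENNReal.ofReal B + ENNReal.ofReal (N (X t ω)) := by
                gcongr; exact hB.lintegral_le
            _ = ENNReal.ofReal (B + N (X t ω)) :=
                (ENNReal.ofReal_add hB.bound_nonneg (hN0 _)).symm
            _ ≤ ENNReal.ofReal (Ψ (X t ω) + c) := ENNReal.ofReal_le_ofReal hle
            _ ≤ _ := ENNReal.ofReal_add_le
      _ = _ := by rw [lintegral_add_right _ measurable_const]; simp
  have tele : ∀ T : ℕ, ∫⁻ ω, ENNReal.ofReal (Ψ (X T ω)) ∂μ +
      ∑ t ∈ Finset.range T, ∫⁻ ω, ENNReal.ofReal (N (X t ω)) ∂μ ≤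
      ∫⁻ ω, ENNReal.ofReal (Ψ (X 0 ω)) ∂μ + T * ENNReal.ofReal c := by
    intro T
    induction T with
    | zero => simp
    | succ T ih =>
      rw [Finset.sum_range_succ]
      calc _ = (∫⁻ ω, ENNReal.ofReal (Ψ (X (T + 1) ω)) ∂μ +
              ∫⁻ ω, ENNReal.ofReal (N (X T ω)) ∂μ) +
              ∑ t ∈ Finset.range T, ∫⁻ ω, ENNReal.ofReal (N (X t ω)) ∂μ := by ring
        _ ≤ (∫⁻ ω, ENNReal.ofReal (Ψ (X T ω)) ∂μ + ENNReal.ofReal c) +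
              ∑ t ∈ Finset.range T, ∫⁻ ω, ENNReal.ofReal (N (X t ω)) ∂μ := by
            exact add_le_add_left (one T) _
        _ = (∫⁻ ω, ENNReal.ofReal (Ψ (X T ω)) ∂μ +
              ∑ t ∈ Finset.range T, ∫⁻ ω, ENNReal.ofReal (N (X t ω)) ∂μ) + ENNReal.ofReal c := by
            ring
        _ ≤ (∫⁻ ω, ENNReal.ofReal (Ψ (X 0 ω)) ∂μ + T * ENNReal.ofReal c) + ENNReal.ofReal c :=
            add_le_add_left ih _
        _ = _ := by push_cast; ring
  -- The expected potential at time `T` is nonnegative and is dropped.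
  exact le_add_self.trans (tele T)

end NoisePair

end Independence

/-! ### The random output and the average along the run. -/

section Output

variable {Ω : Type*} [MeasurableSpace Ω] {μ : Measure Ω} {d : ℕ}

lemma meanSqAtOutput_eq [IsProbabilityMeasure μ] {G : E d → E d} {x : ℕ → Ω → E d} {T : ℕ}
    (hT : 1 ≤ T) (hG : Measurable G) (hx : ∀ t, Measurable (x t)) :
    meanSqAtOutput μ G x T =
      (T : ℝ≥0∞)⁻¹ * ∑ t ∈ Finset.range T, ∫⁻ ω, ENNReal.ofReal (‖G (x t ω)‖ ^ 2) ∂μ := by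
  have : IsProbabilityMeasure (uniformOn (Set.Iio T)) :=
    isProbabilityMeasure_uniformOn (Set.finite_Iio T) ⟨0, hT⟩
  have hm : Measurable fun q : Ω × ℕ => ‖G (x q.2 q.1)‖ₑ ^ 2 :=
    measurable_from_prod_countable_left fun t => ((hG.comp (hx t)).enorm.pow_const 2)
  unfold meanSqAtOutput
  rw [lintegral_prod_symm _ hm.aemeasurable, uniformOn, ProbabilityTheory.cond,
    lintegral_smul_measure]
  have e : (Set.Iio T : Set ℕ) = ((Finset.range T : Finset ℕ) : Set ℕ) := by
    ext; simp
  rw [e, lintegral_finset, Measure.count_apply_finset]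
  simp

lemma meanSqAtOutput_le [IsProbabilityMeasure μ] {G : E d → E d} {x : ℕ → Ω → E d} {T : ℕ}
    (hT : 1 ≤ T) (hG : Measurable G) (hx : ∀ t, Measurable (x t)) {c δ b ε : ℝ} (hc : 0 < c)
    (hδ : 0 ≤ δ) (hb : 0 ≤ b)
    (hsum : ∑ t ∈ Finset.range T, ∫⁻ ω, ENNReal.ofReal (c * ‖G (x t ω)‖ ^ 2) ∂μ ≤
      ENNReal.ofReal δ + T * ENNReal.ofReal b) (h : δ + T * b ≤ c * T * ε ^ 2) :
    meanSqAtOutput μ G x T ≤ ENNReal.ofReal (ε ^ 2) := by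
  have hT0 : (0 : ℝ) < T := by exact_mod_cast hT
  rw [meanSqAtOutput_eq hT hG hx]
  set I := ∑ t ∈ Finset.range T, ∫⁻ ω, ENNReal.ofReal (‖G (x t ω)‖ ^ 2) ∂μ with hI
  have e : ∑ t ∈ Finset.range T, ∫⁻ ω, ENNReal.ofReal (c * ‖G (x t ω)‖ ^ 2) ∂μ =
      ENNReal.ofReal c * I := by
    rw [hI, Finset.mul_sum]
    refine Finset.sum_congr rfl fun t _ => ?_
    simp_rw [ENNReal.ofReal_mul hc.le]
    exact lintegral_const_mul _ ((hG.comp (hx t)).norm.pow_const 2).ennreal_ofReal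
  have h1 : ENNReal.ofReal c * I ≤ ENNReal.ofReal (c * T * ε ^ 2) := by
    rw [← e]
    refine hsum.trans (le_trans (le_of_eq ?_) (ENNReal.ofReal_le_ofReal h))
    rw [ENNReal.ofReal_add hδ (by positivity), ENNReal.ofReal_mul hT0.le, ENNReal.ofReal_natCast]
  have h2 : I ≤ T * ENNReal.ofReal (ε ^ 2) := by
    rw [mul_assoc, ENNReal.ofReal_mul hc.le, ENNReal.ofReal_mul hT0.le,
      ENNReal.ofReal_natCast] at h1
    exact (ENNReal.mul_le_mul_iff_right (by simpa using hc) ENNReal.ofReal_ne_top).1 h1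
  have hTne : (T : ℝ≥0∞) ≠ 0 := by exact_mod_cast (by omega : T ≠ 0)
  calc (T : ℝ≥0∞)⁻¹ * I ≤ (T : ℝ≥0∞)⁻¹ * (T * ENNReal.ofReal (ε ^ 2)) := by gcongr
    _ = _ := by rw [← mul_assoc, ENNReal.inv_mul_cancel hTne (ENNReal.natCast_ne_top T), one_mul]

lemma meanSqAtOutput_one_le [IsProbabilityMeasure μ] {G : E d → E d} {x : ℕ → Ω → E d} {x₀ : E d}
    (hx0 : ∀ ω, x 0 ω = x₀) (hG : Measurable G) (hx : ∀ t, Measurable (x t)) {ε : ℝ}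
    (h : ‖G x₀‖ ^ 2 ≤ ε ^ 2) : meanSqAtOutput μ G x 1 ≤ ENNReal.ofReal (ε ^ 2) := by
  rw [meanSqAtOutput_eq le_rfl hG hx]
  simpa [hx0] using ENNReal.ofReal_le_ofReal h

end Output

/-! ### Choice of the stepsize and of the number of rounds. -/

section Rounds

/-- A positive number `γ` with `γ R ≤ 1`, and `γ R = 1` whenever possible. -/
noncomputable def stepsize (R : ℝ) : ℝ := if R = 0 then 1 else 1 / R

lemma stepsize_pos {R : ℝ} (hR : 0 ≤ R) : 0 < stepsize R := by
  unfold stepsize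
  split_ifs with h
  · exact one_pos
  · have := hR.lt_of_ne' h
    positivity

lemma stepsize_mul {R : ℝ} (hR : 0 < R) : stepsize R * R = 1 := by
  rw [stepsize, if_neg hR.ne', one_div_mul_cancel hR.ne']

lemma stepsize_mul_le {R : ℝ} (hR : 0 ≤ R) : stepsize R * R ≤ 1 := by
  rcases hR.eq_or_lt with h | h
  · simp [← h]
  · exact (stepsize_mul h).le

/-- The number of rounds: `⌊C X⌋ + 1`, or a single round if `X ≤ 1/2`. -/
noncomputable def rounds (C X : ℝ) : ℕ := if X ≤ 1 / 2 then 1 else ⌊C * X⌋₊ + 1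

lemma one_le_rounds (C X : ℝ) : 1 ≤ rounds C X := by
  unfold rounds; split_ifs <;> omega

lemma rounds_le {C X : ℝ} (hC : 0 ≤ C) (hX : 0 ≤ X) : (rounds C X : ℝ) ≤ C * X + 1 := by
  unfold rounds
  split_ifs
  · simpa using mul_nonneg hC hX
  · push_cast
    have := Nat.floor_le (mul_nonneg hC hX)
    linarith

lemma le_rounds {C X : ℝ} (hX : 1 / 2 < X) : C * X ≤ rounds C X := by
  rw [rounds, if_neg hX.not_ge]
  push_cast
  exact (Nat.lt_floor_add_one _).le

/-- If `X ≤ 1/2`, the output is `x₀`, where the squared gradient norm is at most `2 L gap ≤ 2 X ε² ≤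
ε²`. This branch also covers `L = 0`, where the stepsize has its default value and is not tied to
the scale of the problem. Otherwise there are at least `C X` rounds and the average of the summed
bound is small enough. -/
lemma HasLipGrad.meanSqAtOutput_rounds_le {Ω : Type*} [MeasurableSpace Ω] {μ : Measure Ω}
    [IsProbabilityMeasure μ] {d : ℕ} {F : E d → ℝ} {L : ℝ} (hF : HasLipGrad F L)
    (hb : BddBelow (Set.range F)) {x : ℕ → Ω → E d} {x₀ : E d} (hx0 : ∀ ω, x 0 ω = x₀)
    (hx : ∀ t, Measurable (x t)) {C X c ε : ℝ} (hX : L * gap F x₀ ≤ X * ε ^ 2) (hc : 0 < c)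
    (hsum : ∀ T, ∑ t ∈ Finset.range T, ∫⁻ ω, ENNReal.ofReal (c * ‖gradient F (x t ω)‖ ^ 2) ∂μ ≤
      ENNReal.ofReal (gap F x₀)) (h : 1 / 2 < X → gap F x₀ ≤ c * (C * X) * ε ^ 2) :
    meanSqAtOutput μ (gradient F) x (rounds C X) ≤ ENNReal.ofReal (ε ^ 2) := by
  have hG := hF.continuous_gradient.measurable
  by_cases hX2 : X ≤ 1 / 2
  · rw [rounds, if_pos hX2]
    refine meanSqAtOutput_one_le hx0 hG hx ?_
    have := hF.sq_norm_gradient_le hb x₀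
    nlinarith [sq_nonneg ε]
  · push Not at hX2
    refine meanSqAtOutput_le (one_le_rounds _ _) hG hx hc (gap_nonneg hb x₀) le_rfl
      (by simpa using hsum _) ?_
    calc _ = gap F x₀ := by ring
      _ ≤ _ := h hX2
      _ ≤ _ := by gcongr; exact le_rounds hX2

end Rounds

/-! ### Node inputs and their marginal laws. -/

section Noise

variable {Ω ι : Type*} [MeasurableSpace Ω] {S : ι → Type*} [∀ i, MeasurableSpace (S i)]
  {law : ∀ i, Measure (S i)} {ξ : ℕ → Ω → ∀ i, S i} {μ : Measure Ω}

lemma IsFreshNoise.map_eval (h : IsFreshNoise law ξ μ) (t : ℕ) (i : ι) :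
    (μ.map (ξ t)).map (fun s => s i) = law i := by
  rw [Measure.map_map (measurable_pi_apply i) (h.measurable t)]
  exact h.law_eq t i

lemma IsFreshNoise.isProbabilityMeasure [IsProbabilityMeasure μ] (h : IsFreshNoise law ξ μ)
    (t : ℕ) : IsProbabilityMeasure (μ.map (ξ t)) :=
  Measure.isProbabilityMeasure_map (h.measurable t).aemeasurable

/-- A bound on an expectation over the input of one node, seen in the joint law of a round. -/
lemma IsFreshNoise.expLE (h : IsFreshNoise law ξ μ) (t : ℕ) (i : ι) {k : S i → ℝ} {B : ℝ}
    (H : ExpLE (law i) k B) : ExpLE (μ.map (ξ t)) (fun s => k (s i)) B :=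
  ExpLE.of_map (measurable_pi_apply i) (by rwa [h.map_eval])

lemma IsFreshNoise.noisePair {ι' : Type*} {S' : ι' → Type*} [∀ i, MeasurableSpace (S' i)]
    {law' : ∀ i, Measure (S' i)} {ζ : ℕ → Ω → ∀ i, S' i} (h : IsFreshNoise law ξ μ)
    (h' : IsFreshNoise law' ζ μ) (hi : IndepNoise ξ ζ μ) : NoisePair ξ ζ μ :=
  ⟨h.measurable, h'.measurable, h.indep, h'.indep, hi⟩

lemma IsFreshNoise.noisePair_unit [IsProbabilityMeasure μ] (h : IsFreshNoise law ξ μ) :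
    NoisePair ξ (fun _ _ => ()) μ :=
  ⟨h.measurable, fun _ => measurable_const, h.indep, iIndepFun_const _, indepFun_const_right _ _⟩

/-- Meant for gradient counters: the increment in a round depends on one coin only, so neither
independence nor measurability of the accumulated count `h` is needed. -/
lemma lintegral_add_map {U : Type*} [MeasurableSpace U] {φ : Ω → U} (hφ : Measurable φ)
    {h h' : Ω → ℝ≥0∞} {k : U → ℝ≥0∞} (hk : Measurable k) (e : ∀ ω, h' ω = h ω + k (φ ω)) :
    ∫⁻ ω, h' ω ∂μ = ∫⁻ ω, h ω ∂μ + ∫⁻ u, k u ∂(μ.map φ) := by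
  have hkφ : Measurable fun ω => k (φ ω) := hk.comp hφ
  rw [lintegral_congr e, lintegral_map hk hφ, lintegral_add_right _ hkφ]

lemma measurable_of_eq_const {Ω₀ 𝒳 : Type*} {m : MeasurableSpace Ω₀} [MeasurableSpace 𝒳]
    {X : Ω₀ → 𝒳} (c : 𝒳) (h : ∀ ω, X ω = c) : Measurable[m] X := by
  rw [funext h]
  exact measurable_const

lemma expLE_bernoulliLaw {p u v : ℝ} (hp : 0 ≤ p) (hp1 : p ≤ 1) (hu : 0 ≤ u) (hv : 0 ≤ v) :
    ExpLE (bernoulliLaw p) (fun b => if b = true then u else v) (p * u + (1 - p) * v) where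
  measurable := measurable_of_countable _
  nonneg b := by split_ifs <;> assumption
  bound_nonneg := add_nonneg (mul_nonneg hp hu) (mul_nonneg (by linarith) hv)
  lintegral_le := by
    rw [bernoulliLaw, lintegral_add_measure, lintegral_smul_measure, lintegral_smul_measure,
      lintegral_dirac, lintegral_dirac, ENNReal.ofReal_add (mul_nonneg hp hu)
      (mul_nonneg (by linarith) hv), ENNReal.ofReal_mul hp, ENNReal.ofReal_mul (by linarith)]
    simp

end Noise

/-! ### Measurability of the potentials. -/

section Measurability

variable {n d : ℕ} {W : Type*} [MeasurableSpace W]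

@[fun_prop]
lemma measurable_mean {V : Type*} [AddCommGroup V] [Module ℝ V] [MeasurableSpace V]
    [MeasurableAdd₂ V] [MeasurableConstSMul ℝ V] {h : W → Fin n → V} (hh : Measurable h) :
    Measurable fun w => mean (h w) := by
  unfold mean
  exact (Finset.measurable_sum _ fun i _ => measurable_pi_iff.1 hh i).const_smul _

lemma IsSmooth.measurable_gradErr {f : Fin n → E d → ℝ} {L : Fin n → ℝ} (hf : IsSmooth f L)
    {g : W → Fin n → E d} {x : W → E d} (hg : Measurable g) (hx : Measurable x) :
    Measurable fun w => gradErr f (g w) (x w) := by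
  have := fun i => (hf.continuous_gradient i).measurable
  unfold gradErr
  fun_prop

lemma HasLipGrad.measurable_gap {F : E d → ℝ} {L : ℝ} (hF : HasLipGrad F L)
    {x : W → E d} (hx : Measurable x) : Measurable fun w => gap F (x w) :=
  (hF.differentiable.continuous.measurable.comp hx).sub_const _

lemma HasLipGrad.measurable_sq_norm_gradient {F : E d → ℝ} {L : ℝ} (hF : HasLipGrad F L)
    {x : W → E d} (hx : Measurable x) (c : ℝ) :
    Measurable fun w => c * ‖gradient F (x w)‖ ^ 2 :=
  (((hF.continuous_gradient.measurable.comp hx).norm).pow_const 2).const_mul c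

end Measurability

/-! ### EF21-PP. -/

section PartialParticipation

variable {n d : ℕ} {f : Fin n → E d → ℝ} {L : Fin n → ℝ}

/-- The basic Lyapunov inequality, in deterministic form: the factor `1 - a` at the new point stands
for the expectation after compression. With weight `γ / a`, the halved contraction gains exactly
`γ/2` times the error, which is the loss in `HasLipGrad.step`. It is used with `a = p α` here and
with `a = α / 4` for EF21-SGD. -/
lemma IsSmooth.potential_decrease (hf : IsSmooth f L) {γ a : ℝ} (hγ : 0 < γ) (ha : 0 < a)
    (ha1 : a ≤ 1) (hγL : γ * (4 * rms L / a) ≤ 1) (x : E d) (g : Fin n → E d) :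
    gap (avg f) (x - γ • mean g) + γ / a * ((1 - a) * gradErr f g (x - γ • mean g)) +
      γ / 2 * ‖gradient (avg f) x‖ ^ 2 ≤ gap (avg f) x + γ / a * gradErr f g x := by
  have h1 := hf.hasLipGrad.step hγ x (mean g)
  have h2 := hf.gradErr_contract ha ha1 g x (x - γ • mean g)
  have h3 := hf.norm_mean_sub_sq_le g x
  have e : ‖x - γ • mean g - x‖ ^ 2 = γ ^ 2 * ‖mean g‖ ^ 2 := by
    rw [sub_sub_cancel_left, norm_neg, norm_smul, Real.norm_of_nonneg hγ.le, mul_pow]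
  rw [e] at h2
  have hL := rms_nonneg L
  -- In the unit-free quantity `q ≤ 1/4` the displacement condition reads `2 q² ≤ 1/2 - q a / 2`.
  set q := γ * rms L / a with hq
  have hq0 : 0 ≤ q := by positivity
  have hq1 : q ≤ 1 / 4 := by
    have : γ * (4 * rms L / a) = 4 * q := by rw [hq]; ring
    linarith
  have hγL' : γ * rms L = q * a := by rw [hq]; field_simp
  have hA : γ / a * (2 / a * rms L ^ 2 * γ ^ 2) ≤ γ / 2 - rms L * γ ^ 2 / 2 := by
    have e1 : γ / a * (2 / a * rms L ^ 2 * γ ^ 2) = γ * (2 * q ^ 2) := by rw [hq]; ring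
    have e2 : rms L * γ ^ 2 = γ * (q * a) := by rw [← hγL']; ring
    rw [e1, e2]
    have : 2 * q ^ 2 ≤ 1 / 2 - q * a / 2 := by nlinarith
    nlinarith
  have h4 := mul_le_mul_of_nonneg_left h2 (show 0 ≤ γ / a by positivity)
  have h5 := mul_le_mul_of_nonneg_right hA (sq_nonneg ‖mean g‖)
  have e3 : γ / a * ((1 - a / 2) * gradErr f g x) =
      γ / a * gradErr f g x - γ / 2 * gradErr f g x := by field_simp
  have h6 := mul_le_mul_of_nonneg_left h3 (show 0 ≤ γ / 2 by positivity)
  rw [mul_add, e3] at h4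
  unfold gap
  linarith

/-- One round of EF21-PP on the pair of the iterate and the estimators. -/
noncomputable def stepPP {S : Type*} (f : Fin n → E d → ℝ) (𝒞 : S → E d → E d) (γ : ℝ)
    (s : E d × (Fin n → E d)) (w : (Fin n → S) × (Fin n → Bool)) : E d × (Fin n → E d) :=
  (s.1 - γ • mean s.2, fun i =>
    if w.2 i then s.2 i + 𝒞 (w.1 i) (gradient (f i) (s.1 - γ • mean s.2) - s.2 i) else s.2 i)

lemma IsSmooth.measurable_stepPP {S : Type*} [MeasurableSpace S] {ν : Measure S} {α : ℝ}
    (hf : IsSmooth f L) {𝒞 : S → E d → E d} (h𝒞 : IsContractive 𝒞 ν α) (γ : ℝ) :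
    Measurable (Function.uncurry (stepPP f 𝒞 γ)) := by
  have hg := fun i => (hf.continuous_gradient i).measurable
  have hC := h𝒞.measurable
  have hx : Measurable fun p : (E d × (Fin n → E d)) × ((Fin n → S) × (Fin n → Bool)) =>
      p.1.1 - γ • mean p.1.2 := by fun_prop
  refine hx.prodMk (measurable_pi_lambda _ fun i => ?_)
  refine Measurable.ite ?_ ?_ (by fun_prop)
  · exact measurableSet_eq_fun (by fun_prop) measurable_const
  · refine Measurable.add (by fun_prop) (h𝒞.measurable_apply (by fun_prop) ?_)
    exact ((hg i).comp hx).sub (by fun_prop)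

/-- With probability `p` the error is contracted by `1 - α`, otherwise it is kept; the mean factor
is `p (1 - α) + (1 - p) = 1 - p α`. Participation is frozen first, so that the compressor can be
averaged on each branch. -/
lemma expLE_participate {S : Type*} [MeasurableSpace S] {ν : Measure S} {α p : ℝ}
    {𝒞 : S → E d → E d} (h𝒞 : IsContractive 𝒞 ν α) (hα1 : α ≤ 1) (hp : 0 ≤ p) (hp1 : p ≤ 1)
    {ρ : Measure (Fin n → S)} {σ : Measure (Fin n → Bool)} [IsProbabilityMeasure ρ]
    [IsProbabilityMeasure σ] (i : Fin n) (hρ : ρ.map (fun s => s i) = ν)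
    (hσ : σ.map (fun s => s i) = bernoulliLaw p) (g y : E d) :
    ExpLE (ρ.prod σ) (fun w => ‖(if w.2 i then g + 𝒞 (w.1 i) (y - g) else g) - y‖ ^ 2)
      ((1 - p * α) * ‖g - y‖ ^ 2) := by
  have hC := h𝒞.expLE_update hα1 g y
  have hm : Measurable fun w : (Fin n → S) × (Fin n → Bool) =>
      ‖(if w.2 i then g + 𝒞 (w.1 i) (y - g) else g) - y‖ ^ 2 := by
    have h1 : Measurable fun w : (Fin n → S) × (Fin n → Bool) =>
        if w.2 i then g + 𝒞 (w.1 i) (y - g) else g := by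
      refine Measurable.ite (measurableSet_eq_fun (by fun_prop) measurable_const) ?_
        measurable_const
      exact measurable_const.add (h𝒞.measurable_apply (by fun_prop) measurable_const)
    fun_prop
  have hb : ExpLE σ (fun A => if A i = true then (1 - α) * ‖g - y‖ ^ 2 else ‖g - y‖ ^ 2)
      (p * ((1 - α) * ‖g - y‖ ^ 2) + (1 - p) * ‖g - y‖ ^ 2) := by
    have h := expLE_bernoulliLaw (u := (1 - α) * ‖g - y‖ ^ 2) (v := ‖g - y‖ ^ 2) hp hp1
      hC.bound_nonneg (sq_nonneg _)
    rw [← hσ] at h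
    exact h.of_map (measurable_pi_apply i)
  refine (ExpLE.prod_symm hm (fun A => ?_) hb).mono_right (le_of_eq (by ring))
  by_cases hA : A i = true
  · simp only [hA, if_true]
    rw [← hρ] at hC
    exact hC.of_map (measurable_pi_apply i)
  · simp only [hA, Bool.false_eq_true, if_false]
    exact ExpLE.const (sq_nonneg _)

lemma lintegral_cost_runPP {S Ω : Type*} [MeasurableSpace Ω] {μ : Measure Ω}
    [IsProbabilityMeasure μ] (f : Fin n → E d → ℝ) (𝒞 : S → E d → E d) (γ : ℝ) (x₀ : E d)
    (ξ : ℕ → Ω → Fin n → S) {A : ℕ → Ω → Fin n → Bool} {p : ℝ}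
    (hA : IsFreshNoise (fun _ => bernoulliLaw p) A μ) (i : Fin n) (T : ℕ) :
    ∫⁻ ω, ((runPP f 𝒞 γ x₀ (fun t => ξ t ω) (fun t => A t ω) T).cost i : ℝ≥0∞) ∂μ =
      1 + T * ENNReal.ofReal p := by
  induction T with
  | zero => simp [runPP]
  | succ T ih =>
    have hAm : Measurable fun ω => A T ω i := (measurable_pi_apply i).comp (hA.measurable T)
    have e : ∀ ω, ((runPP f 𝒞 γ x₀ (fun t => ξ t ω) (fun t => A t ω) (T + 1)).cost i : ℝ≥0∞) =
        (runPP f 𝒞 γ x₀ (fun t => ξ t ω) (fun t => A t ω) T).cost i +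
          (fun b : Bool => if b then (1 : ℝ≥0∞) else 0) (A T ω i) := by
      intro ω
      simp only [runPP]
      split_ifs <;> simp
    rw [lintegral_add_map hAm
      (measurable_of_countable fun b : Bool => if b then (1 : ℝ≥0∞) else 0) e, ih, hA.law_eq T i,
      bernoulliLaw, lintegral_add_measure, lintegral_smul_measure, lintegral_smul_measure,
      lintegral_dirac, lintegral_dirac]
    simp
    ring

theorem complexity_PP (n : ℕ) (L : Fin n → ℝ) (α p : ℝ) (hα : 0 < α) (hα1 : α ≤ 1)
    (hp : 0 < p) (hp1 : p ≤ 1) :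
    ∃ γ : ℝ, 0 < γ ∧
    ∀ (d : ℕ) (f : Fin n → E d → ℝ), IsSmooth f L → BddBelow (Set.range (avg f)) →
    ∀ (x₀ : E d) (ε : ℝ), 0 < ε →
    ∃ T : ℕ, 1 ≤ T ∧ (T : ℝ) ≤ 10000 * (rms L * gap (avg f) x₀ / (p * α * ε ^ 2)) + 1 ∧
    ∀ (S : Type*) [MeasurableSpace S] (ν : Measure S) [IsProbabilityMeasure ν]
      (𝒞 : S → E d → E d), IsContractive 𝒞 ν α →
    ∀ (Ω : Type*) [MeasurableSpace Ω] (μ : Measure Ω) [IsProbabilityMeasure μ]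
      (ξ : ℕ → Ω → Fin n → S) (A : ℕ → Ω → Fin n → Bool),
      IsFreshNoise (fun _ => ν) ξ μ → IsFreshNoise (fun _ => bernoulliLaw p) A μ →
      IndepNoise ξ A μ →
    let run := fun t ω => runPP f 𝒞 γ x₀ (fun t => ξ t ω) (fun t => A t ω) t
    meanSqAtOutput μ (gradient (avg f)) (fun t ω => (run t ω).x) T ≤ ENNReal.ofReal (ε ^ 2) ∧
    ∀ i, ∫⁻ ω, ((run T ω).cost i : ENNReal) ∂μ ≤
      ENNReal.ofReal (10000 * (rms L * gap (avg f) x₀ / (α * ε ^ 2) + 1)) := by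
  have hL := rms_nonneg L
  have ha : 0 < p * α := mul_pos hp hα
  have ha1 : p * α ≤ 1 := mul_le_one₀ hp1 hα.le hα1
  have hR : 0 ≤ 4 * rms L / (p * α) := by positivity
  refine ⟨stepsize (4 * rms L / (p * α)), stepsize_pos hR, ?_⟩
  intro d f hf hb x₀ ε hε
  have hδ := gap_nonneg hb x₀
  set δ := gap (avg f) x₀ with hδdef
  set γ := stepsize (4 * rms L / (p * α)) with hγdef
  have hγ : 0 < γ := stepsize_pos hR
  set X := rms L * δ / (p * α * ε ^ 2) with hXdef
  have hX0 : 0 ≤ X := by positivity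
  -- The potential drops by `γ/2 ‖∇f‖²` per round and `γ · 4 L̃ / (p α) = 1`, so `8 X` rounds give
  -- `γ/2 · 8 X ε² = δ`. The constants of BC, HB and PAGE arise in the same way.
  have hT := rounds_le (C := 8) (by norm_num) hX0
  refine ⟨rounds 8 X, one_le_rounds _ _, by linarith, ?_⟩
  intro S _ ν _ 𝒞 h𝒞 Ω _ μ _ ξ A hξ hA hξA
  dsimp only
  refine ⟨?_, fun i => ?_⟩
  · have H := hξ.noisePair hA hξA
    have hF := hf.hasLipGrad
    have hstepm := hf.measurable_stepPP h𝒞 γ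
    set Y : ℕ → Ω → E d × (Fin n → E d) := fun t ω =>
      ((runPP f 𝒞 γ x₀ (fun t => ξ t ω) (fun t => A t ω) t).x,
        (runPP f 𝒞 γ x₀ (fun t => ξ t ω) (fun t => A t ω) t).g) with hY
    have hY0 : Measurable[history A 0] (Y 0) := measurable_of_eq_const
      (x₀, fun i => gradient (f i) x₀) fun _ => rfl
    have hYs : ∀ t ω, Y (t + 1) ω = stepPP f 𝒞 γ (Y t ω) (ξ t ω, A (t + 0) ω) :=
      fun t ω => rfl
    have hYm : ∀ t, Measurable (Y t) := H.measurable_run hstepm hY0 hYs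
    refine hF.meanSqAtOutput_rounds_le hb (x₀ := x₀) (c := γ / 2) (fun ω => rfl)
      (fun t => (hYm t).fst) ?_ (by positivity) (fun T => ?_) (fun hX2 => ?_)
    · rw [hXdef, div_mul_eq_mul_div, le_div_iff₀ (by positivity)]
      nlinarith [mul_nonneg (mul_nonneg hL hδ) (sq_nonneg ε)]
    · have key := H.sum_lintegral_le hstepm hY0 hYs (D := fun _ => True) (fun _ => trivial)
        (fun _ _ _ => trivial)
        (Ψ := fun s => gap (avg f) s.1 + γ / (p * α) * gradErr f s.2 s.1)
        (N := fun s => γ / 2 * ‖gradient (avg f) s.1‖ ^ 2) (c := 0)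
        ((hF.measurable_gap measurable_fst).add
          ((hf.measurable_gradErr measurable_snd measurable_fst).const_mul _))
        (hF.measurable_sq_norm_gradient measurable_fst _) (fun s => by positivity)
        (fun t s _ => by
          have := hξ.isProbabilityMeasure t
          have := hA.isProbabilityMeasure (t + 0)
          refine ⟨_, (ExpLE.const (gap_nonneg hb _)).add (ExpLE.const_mul (ExpLE.mean fun i =>
            expLE_participate h𝒞 hα1 hp.le hp1 i (hξ.map_eval t i) (hA.map_eval (t + 0) i)
              (s.2 i) (gradient (f i) (s.1 - γ • mean s.2))) (by positivity)), ?_⟩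
          rw [mean_const_mul, add_zero]
          exact hf.potential_decrease hγ ha ha1 (stepsize_mul_le hR) s.1 s.2) T
      -- The initial estimators are exact, so the initial potential is the gap alone.
      refine key.trans (le_of_eq ?_)
      have : gradErr f (fun i => gradient (f i) x₀) x₀ = 0 := by simp [gradErr, mean]
      simp [hY, runPP, this]
    · have hLpos : 0 < rms L := by
        refine hL.lt_of_ne fun h0 => ?_
        rw [hXdef, ← h0] at hX2
        norm_num at hX2
      have h1 : γ * (4 * rms L / (p * α)) = 1 := stepsize_mul (by positivity)
      refine le_of_eq ?_
      calc δ = γ * (4 * rms L / (p * α)) * δ := by rw [h1, one_mul]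
        _ = _ := by rw [hXdef]; field_simp; ring
  · rw [lintegral_cost_runPP f 𝒞 γ x₀ ξ hA i]
    have e : (1 : ℝ≥0∞) + (rounds 8 X : ℝ≥0∞) * ENNReal.ofReal p =
        ENNReal.ofReal (1 + (rounds 8 X : ℝ) * p) := by
      rw [ENNReal.ofReal_add zero_le_one (by positivity), ENNReal.ofReal_mul (by positivity)]
      simp
    rw [e]
    apply ENNReal.ofReal_le_ofReal
    have e2 : rms L * δ / (α * ε ^ 2) = p * X := by rw [hXdef]; field_simp
    rw [e2]
    have := mul_nonneg hp.le hX0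
    nlinarith

end PartialParticipation

/-! ### EF21-BC. -/

section Bidirectional

variable {n d : ℕ} {f : Fin n → E d → ℝ} {L : Fin n → ℝ}

/-- The first part balances the node error. The descent step costs `γ` and the master error costs `2
γ / αM · 8 / αM · 2 = 32 γ / αM²`; since `γ ≤ γ / αM²`, a gain of `33 γ / αM²` suffices, which
explains the weight `66`. The second part balances `‖g‖²`: with `q ≤ 1/20` the cost is at most `164
/ 400` in units of `γ`. -/
lemma coefficients_BC {γ αw αM l : ℝ} (hγ : 0 < γ) (hαw : 0 < αw) (hαw1 : αw ≤ 1) (hαM : 0 < αM)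
    (hαM1 : αM ≤ 1) (hl : 0 ≤ l) (hγL : γ * (20 * l / (αw * αM)) ≤ 1) :
    γ + 2 * γ / αM * (8 / αM * 2) ≤ 66 * γ / (αw * αM ^ 2) * (αw / 2) ∧
    66 * γ / (αw * αM ^ 2) * (2 / αw * (l ^ 2 * γ ^ 2)) +
      2 * γ / αM * (8 / αM * (2 * (l ^ 2 * γ ^ 2))) ≤ γ / 2 - l * γ ^ 2 / 2 := by
  constructor
  · have e1 : 66 * γ / (αw * αM ^ 2) * (αw / 2) = 33 * (γ / αM ^ 2) := by field_simp; norm_num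
    have e2 : 2 * γ / αM * (8 / αM * 2) = 32 * (γ / αM ^ 2) := by field_simp; norm_num
    have : γ ≤ γ / αM ^ 2 := by
      rw [le_div_iff₀ (by positivity)]
      nlinarith [pow_le_one₀ hαM.le hαM1 (n := 2)]
    rw [e1, e2]
    linarith
  · set q := γ * l / (αw * αM) with hq
    have hq0 : 0 ≤ q := by positivity
    have hq1 : q ≤ 1 / 20 := by
      have : γ * (20 * l / (αw * αM)) = 20 * q := by rw [hq]; ring
      linarith
    have e1 : 66 * γ / (αw * αM ^ 2) * (2 / αw * (l ^ 2 * γ ^ 2)) = γ * (132 * q ^ 2) := by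
      rw [hq]; field_simp; ring
    have e2 : 2 * γ / αM * (8 / αM * (2 * (l ^ 2 * γ ^ 2))) = γ * (32 * (q ^ 2 * αw ^ 2)) := by
      rw [hq]; field_simp; ring
    have e3 : l * γ ^ 2 = γ * (q * (αw * αM)) := by rw [hq]; field_simp
    rw [e1, e2, e3]
    have h5 : αw ^ 2 ≤ 1 := pow_le_one₀ hαw.le hαw1
    have h6 : αw * αM ≤ 1 := mul_le_one₀ hαw1 hαM.le hαM1
    have h7 : q ^ 2 ≤ 1 / 400 := by nlinarith
    have h8 : q * (αw * αM) ≤ 1 / 20 * 1 := by gcongr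
    have h9 : q ^ 2 * αw ^ 2 ≤ 1 / 400 * 1 := by gcongr
    have : 132 * q ^ 2 + 32 * (q ^ 2 * αw ^ 2) ≤ 1 / 2 - q * (αw * αM) / 2 := by linarith
    have := mul_le_mul_of_nonneg_left this hγ.le
    linarith

/-- The error of `g` is split through the mean of the node estimators. The weight `2 γ / αM` makes
the contraction of the master error gain `γ`, exactly its share in the descent step. The node error
at the new point is moved back to `x` twice: once with contraction, and once, as seen by the master,
by the cruder `gradErr_le_two`. -/
lemma IsSmooth.potential_decrease_BC (hf : IsSmooth f L) {γ αw αM : ℝ} (hγ : 0 < γ) (hαw : 0 < αw)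
    (hαw1 : αw ≤ 1) (hαM : 0 < αM) (hαM1 : αM ≤ 1) (hγL : γ * (20 * rms L / (αw * αM)) ≤ 1)
    (x : E d) (gw : Fin n → E d) (g : E d) :
    gap (avg f) (x - γ • g) + 66 * γ / (αw * αM ^ 2) * ((1 - αw) * gradErr f gw (x - γ • g)) +
      2 * γ / αM * ((1 - αM / 2) * ‖g - mean gw‖ ^ 2 + 8 / αM * gradErr f gw (x - γ • g)) +
      γ / 2 * ‖gradient (avg f) x‖ ^ 2 ≤
    gap (avg f) x + 66 * γ / (αw * αM ^ 2) * gradErr f gw x +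
      2 * γ / αM * ‖g - mean gw‖ ^ 2 := by
  have h1 := hf.hasLipGrad.step hγ x g
  have h2 := hf.gradErr_contract hαw hαw1 gw x (x - γ • g)
  have h3 := hf.gradErr_le_two gw x (x - γ • g)
  have h4 : ‖g - gradient (avg f) x‖ ^ 2 ≤ 2 * ‖g - mean gw‖ ^ 2 + 2 * gradErr f gw x := by
    have := norm_add_sq_le_two (g - mean gw) (mean gw - gradient (avg f) x)
    rw [sub_add_sub_cancel] at this
    linarith [hf.norm_mean_sub_sq_le gw x]
  have e : ‖x - γ • g - x‖ ^ 2 = γ ^ 2 * ‖g‖ ^ 2 := by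
    rw [sub_sub_cancel_left, norm_neg, norm_smul, Real.norm_of_nonneg hγ.le, mul_pow]
  rw [e] at h2 h3
  obtain ⟨hGc, hP⟩ := coefficients_BC hγ hαw hαw1 hαM hαM1 (rms_nonneg L) hγL
  have hG := gradErr_nonneg f gw x
  have hW : 2 * γ / αM * (αM / 2) = γ := by field_simp
  have h5 := mul_le_mul_of_nonneg_left h2 (show 0 ≤ 66 * γ / (αw * αM ^ 2) by positivity)
  have h6 := mul_le_mul_of_nonneg_left h3 (show 0 ≤ 2 * γ / αM * (8 / αM) by positivity)
  have h7 := mul_le_mul_of_nonneg_right hP (sq_nonneg ‖g‖)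
  have h8 := mul_le_mul_of_nonneg_right hGc hG
  have h9 : 2 * γ / αM * (αM / 2) * ‖g - mean gw‖ ^ 2 = γ * ‖g - mean gw‖ ^ 2 := by rw [hW]
  have h10 := mul_le_mul_of_nonneg_left h4 (show 0 ≤ γ / 2 by positivity)
  unfold gap
  clear hP hGc hW h2 h3 h4 e hγL
  generalize 66 * γ / (αw * αM ^ 2) = l1 at *
  generalize 2 * γ / αM = l2 at *
  generalize 8 / αM = k8 at *
  generalize 2 / αw = k2 at *
  generalize gradErr f gw (x - γ • g) = D at *
  generalize gradErr f gw x = G at *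
  linarith

/-- One round of EF21-BC on the iterate and the estimators of the nodes and of the master. -/
noncomputable def stepBC {S S' : Type*} (f : Fin n → E d → ℝ) (𝒞w : S → E d → E d)
    (𝒞M : S' → E d → E d) (γ : ℝ) (s : E d × (Fin n → E d) × E d)
    (w : (Fin n → S) × (Unit → S')) : E d × (Fin n → E d) × E d :=
  (s.1 - γ • s.2.2,
    fun i => s.2.1 i + 𝒞w (w.1 i) (gradient (f i) (s.1 - γ • s.2.2) - s.2.1 i),
    s.2.2 + 𝒞M (w.2 ()) (mean (fun i =>
      s.2.1 i + 𝒞w (w.1 i) (gradient (f i) (s.1 - γ • s.2.2) - s.2.1 i)) - s.2.2))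

lemma IsSmooth.measurable_stepBC {S S' : Type*} [MeasurableSpace S] [MeasurableSpace S']
    {ν : Measure S} {ν' : Measure S'} {αw αM : ℝ} (hf : IsSmooth f L) {𝒞w : S → E d → E d}
    {𝒞M : S' → E d → E d} (h𝒞w : IsContractive 𝒞w ν αw) (h𝒞M : IsContractive 𝒞M ν' αM) (γ : ℝ) :
    Measurable (Function.uncurry (stepBC f 𝒞w 𝒞M γ)) := by
  have hg := fun i => (hf.continuous_gradient i).measurable
  have hx : Measurable fun p : (E d × (Fin n → E d) × E d) × ((Fin n → S) × (Unit → S')) =>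
      p.1.1 - γ • p.1.2.2 := by fun_prop
  have hgw : Measurable fun p : (E d × (Fin n → E d) × E d) × ((Fin n → S) × (Unit → S')) =>
      fun i => p.1.2.1 i +
        𝒞w (p.2.1 i) (gradient (f i) (p.1.1 - γ • p.1.2.2) - p.1.2.1 i) := by
    refine measurable_pi_lambda _ fun i => Measurable.add (by fun_prop) ?_
    exact h𝒞w.measurable_apply (by fun_prop) (((hg i).comp hx).sub (by fun_prop))
  refine hx.prodMk (hgw.prodMk (Measurable.add (by fun_prop) ?_))
  exact h𝒞M.measurable_apply (by fun_prop) ((measurable_mean hgw).sub (by fun_prop))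

/-- Writing `𝒞 y = (𝒞 y - y) + y` gives the factor `2 (1 - α) + 2 ≤ 4`. -/
lemma expLE_sq_norm_compress {S : Type*} [MeasurableSpace S] {ν : Measure S}
    [IsProbabilityMeasure ν] {α : ℝ} {𝒞 : S → E d → E d} (h𝒞 : IsContractive 𝒞 ν α)
    (hα : 0 ≤ α) (hα1 : α ≤ 1) (y : E d) :
    ExpLE ν (fun s => ‖𝒞 s y‖ ^ 2) (4 * ‖y‖ ^ 2) := by
  have hm : Measurable fun s => 𝒞 s y := h𝒞.measurable_apply measurable_id measurable_const
  refine (((h𝒞.expLE hα1 y).const_mul (c := 2) (by norm_num)).add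
    (ExpLE.const (c := 2 * ‖y‖ ^ 2) (by positivity))).mono (by fun_prop) (fun _ => sq_nonneg _)
    (fun s => ?_) ?_
  · have := norm_add_sq_le_two (𝒞 s y - y) y
    rwa [sub_add_cancel] at this
  · nlinarith [sq_nonneg ‖y‖]

/-- For frozen node inputs the master compressor contracts the distance of `g` to the new mean
estimator by `1 - αM`. That mean differs from the old one by the average of the compressed messages,
whose mean square is at most four times the node error; with the Young factor `2 / αM` this makes `8
/ αM`. -/
lemma expLE_master {S S' : Type*} [MeasurableSpace S] [MeasurableSpace S'] {ν : Measure S}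
    {ν' : Measure S'} [IsProbabilityMeasure ν] {αw αM : ℝ} {𝒞w : S → E d → E d}
    {𝒞M : S' → E d → E d} (h𝒞w : IsContractive 𝒞w ν αw) (h𝒞M : IsContractive 𝒞M ν' αM)
    (hαw : 0 ≤ αw) (hαw1 : αw ≤ 1) (hαM : 0 < αM) (hαM1 : αM ≤ 1)
    {ρ : Measure (Fin n → S)} {σ : Measure (Unit → S')} [IsProbabilityMeasure ρ]
    [IsProbabilityMeasure σ] (hρ : ∀ i, ρ.map (fun s => s i) = ν)
    (hσ : σ.map (fun s => s ()) = ν') (gw y : Fin n → E d) (g : E d) :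
    ExpLE (ρ.prod σ)
      (fun w => ‖g + 𝒞M (w.2 ()) (mean (fun i => gw i + 𝒞w (w.1 i) (y i - gw i)) - g) -
        mean (fun i => gw i + 𝒞w (w.1 i) (y i - gw i))‖ ^ 2)
      ((1 - αM / 2) * ‖g - mean gw‖ ^ 2 + 8 / αM * mean fun i => ‖gw i - y i‖ ^ 2) := by
  have hgw : Measurable fun ξ : Fin n → S => fun i => gw i + 𝒞w (ξ i) (y i - gw i) :=
    measurable_pi_lambda _ fun i => measurable_const.add
      (h𝒞w.measurable_apply (measurable_pi_apply i) measurable_const)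
  have hmean := measurable_mean hgw
  have hm : Measurable fun w : (Fin n → S) × (Unit → S') =>
      ‖g + 𝒞M (w.2 ()) (mean (fun i => gw i + 𝒞w (w.1 i) (y i - gw i)) - g) -
        mean (fun i => gw i + 𝒞w (w.1 i) (y i - gw i))‖ ^ 2 := by
    have h1 : Measurable fun w : (Fin n → S) × (Unit → S') =>
        mean (fun i => gw i + 𝒞w (w.1 i) (y i - gw i)) := hmean.comp measurable_fst
    have h2 : Measurable fun w : (Fin n → S) × (Unit → S') =>
        𝒞M (w.2 ()) (mean (fun i => gw i + 𝒞w (w.1 i) (y i - gw i)) - g) :=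
      h𝒞M.measurable_apply (by fun_prop) (h1.sub measurable_const)
    exact ((measurable_const.add h2).sub h1).norm.pow_const 2
  have hstep : ExpLE ρ (fun ξ => (1 - αM / 2) * ‖g - mean gw‖ ^ 2 +
      2 / αM * mean fun i => ‖𝒞w (ξ i) (y i - gw i)‖ ^ 2)
      ((1 - αM / 2) * ‖g - mean gw‖ ^ 2 +
        2 / αM * mean fun i => 4 * ‖y i - gw i‖ ^ 2) := by
    refine (ExpLE.const (mul_nonneg (by linarith) (sq_nonneg _))).add
      (ExpLE.const_mul (ExpLE.mean fun i => ?_) (by positivity))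
    have := expLE_sq_norm_compress h𝒞w hαw hαw1 (y i - gw i)
    rw [← hρ i] at this
    exact this.of_map (measurable_pi_apply i)
  refine ExpLE.prod hm (h := fun ξ => (1 - αM) *
    ‖g - mean (fun i => gw i + 𝒞w (ξ i) (y i - gw i))‖ ^ 2) (fun ξ => ?_)
    (hstep.mono (by fun_prop) (fun ξ => mul_nonneg (by linarith) (sq_nonneg _)) (fun ξ => ?_)
      (le_of_eq ?_))
  · have := h𝒞M.expLE_update hαM1 g (mean (fun i => gw i + 𝒞w (ξ i) (y i - gw i)))
    rw [← hσ] at this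
    exact this.of_map (measurable_pi_apply ())
  · have h1 := contraction_young hαM hαM1 (g - mean gw)
      (-mean fun i => 𝒞w (ξ i) (y i - gw i))
    have h2 := norm_mean_sq_le fun i => 𝒞w (ξ i) (y i - gw i)
    have e : g - mean gw + -mean (fun i => 𝒞w (ξ i) (y i - gw i)) =
        g - mean (fun i => gw i + 𝒞w (ξ i) (y i - gw i)) := by
      rw [mean_add]; abel
    rw [e, norm_neg] at h1
    refine h1.trans ?_
    gcongr
  · simp_rw [norm_sub_rev (y _)]
    rw [mean_const_mul]
    ring

theorem complexity_BC (n : ℕ) (L : Fin n → ℝ) (αw αM : ℝ) (hαw : 0 < αw) (hαw1 : αw ≤ 1)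
    (hαM : 0 < αM) (hαM1 : αM ≤ 1) :
    ∃ γ : ℝ, 0 < γ ∧
    ∀ (d : ℕ) (f : Fin n → E d → ℝ), IsSmooth f L → BddBelow (Set.range (avg f)) →
    ∀ (x₀ : E d) (ε : ℝ), 0 < ε →
    ∃ T : ℕ, 1 ≤ T ∧ (T : ℝ) ≤ 10000 * (rms L * gap (avg f) x₀ / (αw * αM * ε ^ 2)) + 1 ∧
    ∀ (S : Type*) [MeasurableSpace S] (ν : Measure S) [IsProbabilityMeasure ν]
      (𝒞w : S → E d → E d), IsContractive 𝒞w ν αw →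
    ∀ (S' : Type*) [MeasurableSpace S'] (ν' : Measure S') [IsProbabilityMeasure ν']
      (𝒞M : S' → E d → E d), IsContractive 𝒞M ν' αM →
    ∀ (Ω : Type*) [MeasurableSpace Ω] (μ : Measure Ω) [IsProbabilityMeasure μ]
      (ξ : ℕ → Ω → Fin n → S) (ζ : ℕ → Ω → Unit → S'),
      IsFreshNoise (fun _ => ν) ξ μ → IsFreshNoise (fun _ => ν') ζ μ → IndepNoise ξ ζ μ →
    let run := fun t ω => runBC f 𝒞w 𝒞M γ x₀ (fun t => ξ t ω) (fun t => ζ t ω ()) t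
    meanSqAtOutput μ (gradient (avg f)) (fun t ω => (run t ω).x) T ≤ ENNReal.ofReal (ε ^ 2) ∧
    ∀ i ω, ((run T ω).cost i : ℝ) ≤
      10000 * (rms L * gap (avg f) x₀ / (αw * αM * ε ^ 2) + 1) := by
  have hL := rms_nonneg L
  have hR : 0 ≤ 20 * rms L / (αw * αM) := by positivity
  refine ⟨stepsize (20 * rms L / (αw * αM)), stepsize_pos hR, ?_⟩
  intro d f hf hb x₀ ε hε
  have hδ := gap_nonneg hb x₀
  set δ := gap (avg f) x₀ with hδdef
  set γ := stepsize (20 * rms L / (αw * αM)) with hγdef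
  have hγ : 0 < γ := stepsize_pos hR
  set X := rms L * δ / (αw * αM * ε ^ 2) with hXdef
  have hX0 : 0 ≤ X := by positivity
  have hT := rounds_le (C := 40) (by norm_num) hX0
  refine ⟨rounds 40 X, one_le_rounds _ _, by linarith, ?_⟩
  intro S _ ν _ 𝒞w h𝒞w S' _ ν' _ 𝒞M h𝒞M Ω _ μ _ ξ ζ hξ hζ hξζ
  dsimp only
  refine ⟨?_, fun i ω => ?_⟩
  · have H := hξ.noisePair hζ hξζ
    have hF := hf.hasLipGrad
    have hstepm := hf.measurable_stepBC h𝒞w h𝒞M γ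
    set Y : ℕ → Ω → E d × (Fin n → E d) × E d := fun t ω =>
      ((runBC f 𝒞w 𝒞M γ x₀ (fun t => ξ t ω) (fun t => ζ t ω ()) t).x,
        (runBC f 𝒞w 𝒞M γ x₀ (fun t => ξ t ω) (fun t => ζ t ω ()) t).gw,
        (runBC f 𝒞w 𝒞M γ x₀ (fun t => ξ t ω) (fun t => ζ t ω ()) t).g) with hY
    have hY0 : Measurable[history ζ 0] (Y 0) := measurable_of_eq_const
      (x₀, fun i => gradient (f i) x₀, gradient (avg f) x₀) fun _ => rfl
    have hYs : ∀ t ω, Y (t + 1) ω = stepBC f 𝒞w 𝒞M γ (Y t ω) (ξ t ω, ζ (t + 0) ω) :=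
      fun t ω => rfl
    have hYm : ∀ t, Measurable (Y t) := H.measurable_run hstepm hY0 hYs
    refine hF.meanSqAtOutput_rounds_le hb (x₀ := x₀) (c := γ / 2) (fun ω => rfl)
      (fun t => (hYm t).fst) ?_ (by positivity) (fun T => ?_) (fun hX2 => ?_)
    · have := mul_le_one₀ hαw1 hαM.le hαM1
      rw [hXdef, div_mul_eq_mul_div, le_div_iff₀ (by positivity)]
      nlinarith [mul_nonneg (mul_nonneg hL hδ) (sq_nonneg ε)]
    · have key := H.sum_lintegral_le hstepm hY0 hYs (D := fun _ => True) (fun _ => trivial)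
        (fun _ _ _ => trivial)
        (Ψ := fun s => gap (avg f) s.1 + 66 * γ / (αw * αM ^ 2) * gradErr f s.2.1 s.1 +
          2 * γ / αM * ‖s.2.2 - mean s.2.1‖ ^ 2)
        (N := fun s => γ / 2 * ‖gradient (avg f) s.1‖ ^ 2) (c := 0)
        (((hF.measurable_gap measurable_fst).add
          ((hf.measurable_gradErr (by fun_prop) measurable_fst).const_mul _)).add (by fun_prop))
        (hF.measurable_sq_norm_gradient measurable_fst _) (fun s => by positivity)
        (fun t s _ => by
          have := hξ.isProbabilityMeasure t
          have := hζ.isProbabilityMeasure (t + 0)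
          refine ⟨_, ((ExpLE.const (gap_nonneg hb _)).add (ExpLE.const_mul
            (ExpLE.mean fun i => (hξ.expLE t i (h𝒞w.expLE_update hαw1 (s.2.1 i)
              (gradient (f i) (s.1 - γ • s.2.2)))).fst) (by positivity))).add
            (ExpLE.const_mul (expLE_master h𝒞w h𝒞M hαw.le hαw1 hαM hαM1
              (fun i => hξ.map_eval t i) (hζ.map_eval (t + 0) ()) s.2.1
              (fun i => gradient (f i) (s.1 - γ • s.2.2)) s.2.2) (by positivity)), ?_⟩
          rw [mean_const_mul, add_zero]
          exact hf.potential_decrease_BC hγ hαw hαw1 hαM hαM1 (stepsize_mul_le hR) s.1 s.2.1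
            s.2.2) T
      refine key.trans (le_of_eq ?_)
      have : gradErr f (fun i => gradient (f i) x₀) x₀ = 0 := by simp [gradErr, mean]
      simp [hY, runBC, this, hf.gradient_avg]
    · have hLpos : 0 < rms L := by
        refine hL.lt_of_ne fun h0 => ?_
        rw [hXdef, ← h0] at hX2
        norm_num at hX2
      have h1 : γ * (20 * rms L / (αw * αM)) = 1 := stepsize_mul (by positivity)
      refine le_of_eq ?_
      calc δ = γ * (20 * rms L / (αw * αM)) * δ := by rw [h1, one_mul]
        _ = _ := by rw [hXdef]; field_simp; ring
  · have hc : ∀ t, (runBC f 𝒞w 𝒞M γ x₀ (fun t => ξ t ω) (fun t => ζ t ω ()) t).cost i = t + 1 := by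
      intro t
      induction t with
      | zero => rfl
      | succ t ih => simp only [runBC, ih]
    rw [hc]
    push_cast
    linarith

end Bidirectional

/-! ### EF21-HB. -/

section HeavyBall

variable {n d : ℕ} {f : Fin n → E d → ℝ} {L : Fin n → ℝ}

/-- The recursion of `w = v - g`: since the new `w` is `η v = η (w + g)`, its square contracts by
`η` up to `‖g‖² / (1 - η)`. The difference of the two sides is a sum of squares. -/
lemma norm_smul_add_sq_le {V : Type*} [SeminormedAddCommGroup V] [NormedSpace ℝ V] {η : ℝ}
    (hη : 0 ≤ η) (hη1 : η < 1) (a b : V) :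
    ‖η • (a + b)‖ ^ 2 ≤ η * ‖a‖ ^ 2 + 1 / (1 - η) * ‖b‖ ^ 2 := by
  have hβ : 0 < 1 - η := by linarith
  have h1 : ‖η • (a + b)‖ ≤ η * ‖a‖ + η * ‖b‖ := by
    rw [norm_smul, Real.norm_of_nonneg hη, ← mul_add]
    gcongr
    exact norm_add_le _ _
  have h2 : ‖η • (a + b)‖ ^ 2 ≤ (η * ‖a‖ + η * ‖b‖) ^ 2 := by gcongr
  refine h2.trans ?_
  have e : η * ‖a‖ ^ 2 + 1 / (1 - η) * ‖b‖ ^ 2 - (η * ‖a‖ + η * ‖b‖) ^ 2 =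
      η / (1 - η) * ((1 - η) * ‖a‖ - η * ‖b‖) ^ 2 + (1 + η) * ‖b‖ ^ 2 := by
    field_simp
    ring
  have : 0 ≤ η / (1 - η) * ((1 - η) * ‖a‖ - η * ‖b‖) ^ 2 + (1 + η) * ‖b‖ ^ 2 := by positivity
  linarith

/-- The potential of the extrapolated iterate `z = x - c (v - g)`, where `c = γ / (1 - η)`. -/
noncomputable def potentialHB (f : Fin n → E d → ℝ) (c a b : ℝ)
    (s : E d × (Fin n → E d) × E d) : ℝ :=
  gap (avg f) (s.1 - c • (s.2.2 - mean s.2.1)) + a * gradErr f s.2.1 s.1 +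
    b * ‖s.2.2 - mean s.2.1‖ ^ 2

/-- In units of `c`, with `qa = c l / α` and `qb = c l / β`, the weight of `‖w‖²` is chosen so that
its contraction `β` yields `2 β² qb² + 8 β² qa²`. The first summand covers the distance between `x`
and the extrapolated point, with factor `3/2`. The second equals the `‖w‖²`-part of the displacement
`x' - x`. Then `qa + qb ≤ 1/8` makes the total cost in `‖g‖²` affordable. -/
lemma coefficients_HB {c α β l : ℝ} (hc : 0 < c) (hα : 0 < α) (hβ : 0 < β) (hβ1 : β ≤ 1)
    (hl : 0 ≤ l) (hcL : c * (8 * l * (1 / α + 1 / β)) ≤ 1) :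
    3 / 2 * (c * (l ^ 2 * c ^ 2)) + 2 * (2 * c / α * (2 / α * (l ^ 2 * (c * β) ^ 2))) ≤
      c ^ 3 * l ^ 2 * (2 / β + 8 * β / α ^ 2) * β ∧
    c ^ 3 * l ^ 2 * (2 / β + 8 * β / α ^ 2) * (1 / β) +
      2 * (2 * c / α * (2 / α * (l ^ 2 * (c * β) ^ 2))) ≤ c / 2 - l * c ^ 2 / 2 := by
  set qa := c * l / α with hqa
  set qb := c * l / β with hqb
  have hqa0 : 0 ≤ qa := by positivity
  have hqb0 : 0 ≤ qb := by positivity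
  have hq : qa + qb ≤ 1 / 8 := by
    have : c * (8 * l * (1 / α + 1 / β)) = 8 * (qa + qb) := by rw [hqa, hqb]; ring
    linarith
  have e1 : 2 * c / α * (2 / α * (l ^ 2 * (c * β) ^ 2)) = c * (4 * (qa ^ 2 * β ^ 2)) := by
    rw [hqa]; field_simp; ring
  have e2 : c ^ 3 * l ^ 2 * (2 / β + 8 * β / α ^ 2) * β =
      c * (2 * (β ^ 2 * qb ^ 2) + 8 * (qa ^ 2 * β ^ 2)) := by
    rw [hqa, hqb]; field_simp
  have e3 : c * (l ^ 2 * c ^ 2) = c * (β ^ 2 * qb ^ 2) := by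
    rw [hqb]; field_simp
  have e4 : l * c ^ 2 = c * (qb * β) := by rw [hqb]; field_simp
  have e5 : c ^ 3 * l ^ 2 * (2 / β + 8 * β / α ^ 2) * (1 / β) =
      c * (2 * qb ^ 2 + 8 * qa ^ 2) := by
    rw [hqa, hqb]; field_simp
  rw [e1, e2, e3, e4, e5]
  constructor
  · have : 0 ≤ c * (β ^ 2 * qb ^ 2) := by positivity
    linarith
  · have h7 : β ^ 2 ≤ 1 := pow_le_one₀ hβ.le hβ1
    have h8 : qa ^ 2 * β ^ 2 ≤ qa ^ 2 * 1 := by gcongr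
    have h9 : qb * β ≤ qb * 1 := by gcongr
    have h10 : 2 * qb ^ 2 + 16 * qa ^ 2 ≤ 1 / 4 := by nlinarith
    have h11 : 2 * qb ^ 2 + 8 * qa ^ 2 + 2 * (4 * (qa ^ 2 * β ^ 2)) ≤ 1 / 2 - qb * β / 2 := by
      linarith
    have := mul_le_mul_of_nonneg_left h11 hc.le
    linarith

/-- The point `z = x - c (v - g)` performs the plain step `z ↦ z - c g` with the larger stepsize `c
= γ / (1 - η)`, so `HasLipGrad.step` is applied at `z`. The estimators and the claimed gradient
bound live at `x`; since `‖x - z‖ = c ‖w‖` with `w = v - g`, passing between the two points costs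
multiples of `L̃² c² ‖w‖²`, and this is why `‖w‖²` belongs to the potential. -/
lemma IsSmooth.potential_decrease_HB (hf : IsSmooth f L) {c α η β : ℝ} (hc : 0 < c) (hα : 0 < α)
    (hα1 : α ≤ 1) (hη : 0 ≤ η) (hβ : 0 < β) (hηβ : β = 1 - η)
    (hcL : c * (8 * rms L * (1 / α + 1 / β)) ≤ 1)
    (x : E d) (g : Fin n → E d) (v : E d) :
    gap (avg f) (x - (c * β) • v - c • (η • v)) +
      2 * c / α * ((1 - α) * gradErr f g (x - (c * β) • v)) +
      c ^ 3 * rms L ^ 2 * (2 / β + 8 * β / α ^ 2) * ‖η • v‖ ^ 2 +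
      c / 4 * ‖gradient (avg f) x‖ ^ 2 ≤
    potentialHB f c (2 * c / α) (c ^ 3 * rms L ^ 2 * (2 / β + 8 * β / α ^ 2)) (x, g, v) := by
  unfold potentialHB
  dsimp only
  have hF := hf.hasLipGrad
  set w := v - mean g with hw
  set z := x - c • w with hz
  have hv : v = w + mean g := by rw [hw]; abel
  have hz' : x - (c * β) • v - c • (η • v) = z - c • mean g := by
    rw [hz, hw, hηβ]; module
  have h1 := hF.step hc z (mean g)
  have h2 := hf.gradErr_contract hα hα1 g x (x - (c * β) • v)
  have hzx : ‖gradient (avg f) x - gradient (avg f) z‖ ^ 2 ≤ rms L ^ 2 * c ^ 2 * ‖w‖ ^ 2 := by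
    have h := hF.lipschitz x z
    rw [hz, sub_sub_cancel, norm_smul, Real.norm_of_nonneg hc.le] at h
    calc _ ≤ (rms L * (c * ‖w‖)) ^ 2 := by gcongr
      _ = _ := by ring
  have h3 : ‖mean g - gradient (avg f) z‖ ^ 2 ≤
      2 * gradErr f g x + 2 * (rms L ^ 2 * c ^ 2 * ‖w‖ ^ 2) := by
    have := norm_add_sq_le_two (mean g - gradient (avg f) x)
      (gradient (avg f) x - gradient (avg f) z)
    rw [sub_add_sub_cancel] at this
    linarith [hf.norm_mean_sub_sq_le g x]
  have h4 : ‖gradient (avg f) x‖ ^ 2 ≤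
      2 * ‖gradient (avg f) z‖ ^ 2 + 2 * (rms L ^ 2 * c ^ 2 * ‖w‖ ^ 2) := by
    have := norm_add_sq_le_two (gradient (avg f) z) (gradient (avg f) x - gradient (avg f) z)
    rw [add_sub_cancel] at this
    linarith
  have h5 := norm_smul_add_sq_le hη (by linarith : η < 1) w (mean g)
  rw [← hv, ← hηβ] at h5
  have h6 : ‖x - (c * β) • v - x‖ ^ 2 ≤ (c * β) ^ 2 * (2 * ‖w‖ ^ 2 + 2 * ‖mean g‖ ^ 2) := by
    rw [sub_sub_cancel_left, norm_neg, norm_smul, Real.norm_of_nonneg (by positivity), mul_pow, hv]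
    gcongr
    exact norm_add_sq_le_two _ _
  rw [hz']
  obtain ⟨hWc, hPc⟩ := coefficients_HB hc hα hβ (by linarith) (rms_nonneg L) hcL
  have h7 := mul_le_mul_of_nonneg_left h2 (show 0 ≤ 2 * c / α by positivity)
  have h8 := mul_le_mul_of_nonneg_left h6
    (show 0 ≤ 2 * c / α * (2 / α * rms L ^ 2) by positivity)
  have e8 : 2 * c / α * ((1 - α / 2) * gradErr f g x +
      2 / α * (rms L ^ 2 * ‖x - (c * β) • v - x‖ ^ 2)) =
      2 * c / α * gradErr f g x - c * gradErr f g x +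
      2 * c / α * (2 / α * rms L ^ 2) * ‖x - (c * β) • v - x‖ ^ 2 := by
    have e5 : 2 * c / α * (α / 2) = c := by field_simp
    have : 2 * c / α * ((1 - α / 2) * gradErr f g x) =
        2 * c / α * gradErr f g x - 2 * c / α * (α / 2) * gradErr f g x := by ring
    rw [mul_add, this, e5]; ring
  rw [e8] at h7
  have e9 : 2 * c / α * (2 / α * rms L ^ 2) * ((c * β) ^ 2 * (2 * ‖w‖ ^ 2 + 2 * ‖mean g‖ ^ 2)) =
      2 * (2 * c / α * (2 / α * (rms L ^ 2 * (c * β) ^ 2))) * (‖w‖ ^ 2 + ‖mean g‖ ^ 2) := by ring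
  rw [e9] at h8
  have hlb0 : 0 ≤ c ^ 3 * rms L ^ 2 * (2 / β + 8 * β / α ^ 2) := by positivity
  generalize 2 * (2 * c / α * (2 / α * (rms L ^ 2 * (c * β) ^ 2))) = k at *
  generalize c ^ 3 * rms L ^ 2 * (2 / β + 8 * β / α ^ 2) = lb at *
  have h9 := mul_le_mul_of_nonneg_left h5 hlb0
  have h10 := mul_le_mul_of_nonneg_right hWc (sq_nonneg ‖w‖)
  have h11 := mul_le_mul_of_nonneg_right hPc (sq_nonneg ‖mean g‖)
  have h12 := mul_le_mul_of_nonneg_left h3 (show 0 ≤ c / 2 by positivity)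
  have h13 := mul_le_mul_of_nonneg_left h4 (show 0 ≤ c / 4 by positivity)
  have h14 : lb * (η * ‖w‖ ^ 2 + 1 / β * ‖mean g‖ ^ 2) =
      lb * ‖w‖ ^ 2 - lb * β * ‖w‖ ^ 2 + lb * (1 / β) * ‖mean g‖ ^ 2 := by rw [hηβ]; ring
  rw [h14] at h9
  unfold gap
  linarith

/-- One round of EF21-HB on the iterate, the estimators and the momentum. -/
noncomputable def stepHB {S : Type*} (f : Fin n → E d → ℝ) (𝒞 : S → E d → E d) (γ η : ℝ)
    (s : E d × (Fin n → E d) × E d) (w : (Fin n → S) × Unit) : E d × (Fin n → E d) × E d :=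
  (s.1 - γ • s.2.2,
    fun i => s.2.1 i + 𝒞 (w.1 i) (gradient (f i) (s.1 - γ • s.2.2) - s.2.1 i),
    η • s.2.2 + mean (fun i =>
      s.2.1 i + 𝒞 (w.1 i) (gradient (f i) (s.1 - γ • s.2.2) - s.2.1 i)))

lemma IsSmooth.measurable_stepHB {S : Type*} [MeasurableSpace S]
    {ν : Measure S} {α : ℝ} (hf : IsSmooth f L) {𝒞 : S → E d → E d}
    (h𝒞 : IsContractive 𝒞 ν α) (γ η : ℝ) :
    Measurable (Function.uncurry (stepHB f 𝒞 γ η)) := by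
  have hg := fun i => (hf.continuous_gradient i).measurable
  have hx : Measurable fun p : (E d × (Fin n → E d) × E d) × ((Fin n → S) × Unit) =>
      p.1.1 - γ • p.1.2.2 := by fun_prop
  have hgw : Measurable fun p : (E d × (Fin n → E d) × E d) × ((Fin n → S) × Unit) =>
      fun i => p.1.2.1 i +
        𝒞 (p.2.1 i) (gradient (f i) (p.1.1 - γ • p.1.2.2) - p.1.2.1 i) := by
    refine measurable_pi_lambda _ fun i => Measurable.add (by fun_prop) ?_
    exact h𝒞.measurable_apply (by fun_prop) (((hg i).comp hx).sub (by fun_prop))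
  exact hx.prodMk (hgw.prodMk (Measurable.add (by fun_prop) (measurable_mean hgw)))

theorem complexity_HB (n : ℕ) (L : Fin n → ℝ) (α η : ℝ) (hα : 0 < α) (hα1 : α ≤ 1)
    (hη : 0 ≤ η) (hη1 : η < 1) :
    ∃ γ : ℝ, 0 < γ ∧
    ∀ (d : ℕ) (f : Fin n → E d → ℝ), IsSmooth f L → BddBelow (Set.range (avg f)) →
    ∀ (x₀ : E d) (ε : ℝ), 0 < ε →
    ∃ T : ℕ, 1 ≤ T ∧
      (T : ℝ) ≤ 10000 * (rms L * gap (avg f) x₀ / ε ^ 2 * (1 / α + 1 / (1 - η))) + 1 ∧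
    ∀ (S : Type*) [MeasurableSpace S] (ν : Measure S) [IsProbabilityMeasure ν]
      (𝒞 : S → E d → E d), IsContractive 𝒞 ν α →
    ∀ (Ω : Type*) [MeasurableSpace Ω] (μ : Measure Ω) [IsProbabilityMeasure μ]
      (ξ : ℕ → Ω → Fin n → S), IsFreshNoise (fun _ => ν) ξ μ →
    let run := fun t ω => runHB f 𝒞 γ η x₀ (fun t => ξ t ω) t
    meanSqAtOutput μ (gradient (avg f)) (fun t ω => (run t ω).x) T ≤ ENNReal.ofReal (ε ^ 2) ∧
    ∀ i ω, ((run T ω).cost i : ℝ) ≤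
      10000 * (rms L * gap (avg f) x₀ / ε ^ 2 * (1 / α + 1 / (1 - η)) + 1) := by
  have hL := rms_nonneg L
  have hβ : 0 < 1 - η := by linarith
  have hR : 0 ≤ 8 * rms L * (1 / α + 1 / (1 - η)) := by positivity
  -- The stepsize tuned to the smoothness is that of `z`; the method itself runs with `γ = c (1 -
  -- η)`.
  refine ⟨stepsize (8 * rms L * (1 / α + 1 / (1 - η))) * (1 - η),
    mul_pos (stepsize_pos hR) hβ, ?_⟩
  intro d f hf hb x₀ ε hε
  have hδ := gap_nonneg hb x₀
  set δ := gap (avg f) x₀ with hδdef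
  set c := stepsize (8 * rms L * (1 / α + 1 / (1 - η))) with hcdef
  have hc : 0 < c := stepsize_pos hR
  set X := rms L * δ / ε ^ 2 * (1 / α + 1 / (1 - η)) with hXdef
  have hX0 : 0 ≤ X := by positivity
  have hT := rounds_le (C := 32) (by norm_num) hX0
  refine ⟨rounds 32 X, one_le_rounds _ _, by linarith, ?_⟩
  intro S _ ν _ 𝒞 h𝒞 Ω _ μ _ ξ hξ
  dsimp only
  refine ⟨?_, fun i ω => ?_⟩
  · have H := hξ.noisePair_unit
    have hF := hf.hasLipGrad
    have hstepm := hf.measurable_stepHB h𝒞 (c * (1 - η)) η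
    set Y : ℕ → Ω → E d × (Fin n → E d) × E d := fun t ω =>
      ((runHB f 𝒞 (c * (1 - η)) η x₀ (fun t => ξ t ω) t).x,
        (runHB f 𝒞 (c * (1 - η)) η x₀ (fun t => ξ t ω) t).g,
        (runHB f 𝒞 (c * (1 - η)) η x₀ (fun t => ξ t ω) t).v) with hY
    have hY0 : Measurable[history (fun (_ : ℕ) (_ : Ω) => ()) 0] (Y 0) := measurable_of_eq_const
      (x₀, fun i => gradient (f i) x₀, mean fun i => gradient (f i) x₀) fun _ => rfl
    have hYs : ∀ t ω, Y (t + 1) ω = stepHB f 𝒞 (c * (1 - η)) η (Y t ω) (ξ t ω, ()) :=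
      fun t ω => rfl
    have hYm : ∀ t, Measurable (Y t) := H.measurable_run hstepm hY0 hYs
    refine hF.meanSqAtOutput_rounds_le hb (x₀ := x₀) (c := c / 4) (fun ω => rfl)
      (fun t => (hYm t).fst) ?_ (by positivity) (fun T => ?_) (fun hX2 => ?_)
    · have h1 : 1 ≤ 1 / α := by rw [le_div_iff₀ hα]; linarith
      have h2 : 0 ≤ 1 / (1 - η) := by positivity
      have e : X * ε ^ 2 = rms L * δ * (1 / α + 1 / (1 - η)) := by rw [hXdef]; field_simp
      rw [e]
      exact le_mul_of_one_le_right (by positivity) (by linarith)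
    · have key := H.sum_lintegral_le hstepm hY0 hYs (D := fun _ => True) (fun _ => trivial)
        (fun _ _ _ => trivial)
        (Ψ := potentialHB f c (2 * c / α)
          (c ^ 3 * rms L ^ 2 * (2 / (1 - η) + 8 * (1 - η) / α ^ 2)))
        (N := fun s => c / 4 * ‖gradient (avg f) s.1‖ ^ 2) (c := 0)
        (((hF.measurable_gap (by fun_prop)).add
          ((hf.measurable_gradErr (by fun_prop) measurable_fst).const_mul _)).add (by fun_prop))
        (hF.measurable_sq_norm_gradient measurable_fst _) (fun s => by positivity)
        (fun t s _ => by
          have := hξ.isProbabilityMeasure t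
          have : IsProbabilityMeasure (μ.map fun _ : Ω => ()) :=
            Measure.isProbabilityMeasure_map measurable_const.aemeasurable
          have hE := ((ExpLE.const (gap_nonneg hb (s.1 - (c * (1 - η)) • s.2.2 -
              c • (η • s.2.2)))).add (ExpLE.const_mul (c := 2 * c / α)
            (ExpLE.mean fun i => (hξ.expLE t i (h𝒞.expLE_update hα1 (s.2.1 i)
              (gradient (f i) (s.1 - (c * (1 - η)) • s.2.2)))).fst
                (σ := μ.map fun _ : Ω => ())) (by positivity))).add
            (ExpLE.const (c := c ^ 3 * rms L ^ 2 * (2 / (1 - η) + 8 * (1 - η) / α ^ 2) *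
              ‖η • s.2.2‖ ^ 2) (by positivity))
          refine ⟨_, hE.congr fun w => ?_, ?_⟩
          -- The new `v - g` equals `η v`, so within the round only the estimator error is random.
          · simp only [potentialHB, stepHB, add_sub_cancel_right, gradErr]
          · rw [mean_const_mul, add_zero]
            exact hf.potential_decrease_HB hc hα hα1 hη hβ rfl (stepsize_mul_le hR) s.1 s.2.1
              s.2.2) T
      refine key.trans (le_of_eq ?_)
      have : gradErr f (fun i => gradient (f i) x₀) x₀ = 0 := by simp [gradErr, mean]
      simp [hY, runHB, this, potentialHB]
    · have hLpos : 0 < rms L := by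
        refine hL.lt_of_ne fun h0 => ?_
        rw [hXdef, ← h0] at hX2
        norm_num at hX2
      have h1 : c * (8 * rms L * (1 / α + 1 / (1 - η))) = 1 := stepsize_mul (by positivity)
      refine le_of_eq ?_
      calc δ = c * (8 * rms L * (1 / α + 1 / (1 - η))) * δ := by rw [h1, one_mul]
        _ = _ := by rw [hXdef]; field_simp; ring
  · have hcost : ∀ t, (runHB f 𝒞 (c * (1 - η)) η x₀ (fun t => ξ t ω) t).cost i = t + 1 := by
      intro t
      induction t with
      | zero => rfl
      | succ t ih => simp only [runHB, ih]
    rw [hcost]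
    push_cast
    linarith

end HeavyBall

/-! ### Centered errors and batches. -/

section Variance

variable {d : ℕ}

/-- A centered error `Y` of variance at most `w` adds at most `w` to a squared norm. -/
lemma expLE_add_centered {W : Type*} [MeasurableSpace W] {ρ : Measure W} [IsProbabilityMeasure ρ]
    {Y : W → E d} (hm : Measurable Y) (hi : Integrable Y ρ) (h0 : ∫ z, Y z ∂ρ = 0) {w : ℝ}
    (hw : 0 ≤ w) (hv : ∫⁻ z, ‖Y z‖ₑ ^ 2 ∂ρ ≤ ENNReal.ofReal w) (a : E d) :
    ExpLE ρ (fun z => ‖a + Y z‖ ^ 2) (‖a‖ ^ 2 + w) where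
  measurable := by fun_prop
  nonneg _ := sq_nonneg _
  bound_nonneg := by positivity
  lintegral_le := by
    have hsq : Integrable (fun z => ‖Y z‖ ^ 2) ρ := by
      refine ⟨(hm.norm.pow_const 2).aestronglyMeasurable, ?_⟩
      rw [hasFiniteIntegral_iff_ofReal (ae_of_all _ fun _ => sq_nonneg _)]
      simp_rw [ofReal_norm_sq]
      exact hv.trans_lt ENNReal.ofReal_lt_top
    have hin : Integrable (fun z => (inner ℝ a (Y z) : ℝ)) ρ := hi.const_inner a
    -- The cross term has zero mean; integrability of `‖Y‖²`, from the variance bound, allows the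
    -- square to be expanded under the integral.
    have e : ∀ z, ‖a + Y z‖ ^ 2 = ‖a‖ ^ 2 + 2 * inner ℝ a (Y z) + ‖Y z‖ ^ 2 :=
      fun z => norm_add_sq_real a (Y z)
    have hlin : Integrable (fun z => ‖a‖ ^ 2 + 2 * (inner ℝ a (Y z) : ℝ)) ρ :=
      (integrable_const _).add (hin.const_mul 2)
    have hint : Integrable (fun z => ‖a + Y z‖ ^ 2) ρ := by
      simp_rw [e]
      exact hlin.add hsq
    rw [← ofReal_integral_eq_lintegral_ofReal hint (ae_of_all _ fun _ => sq_nonneg _)]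
    apply ENNReal.ofReal_le_ofReal
    simp_rw [e]
    rw [integral_add hlin hsq,
      integral_add (integrable_const _) (hin.const_mul 2), integral_const_mul,
      integral_inner hi, h0, inner_zero_right, integral_const]
    have hle : ∫ z, ‖Y z‖ ^ 2 ∂ρ ≤ w := by
      rw [integral_eq_lintegral_of_nonneg_ae (ae_of_all _ fun _ => sq_nonneg _)
        hsq.aestronglyMeasurable]
      simp_rw [ofReal_norm_sq]
      exact ENNReal.toReal_le_of_le_ofReal hw hv
    simpa using hle

/-- Variances of independent centered vectors add. The first sample is split off the product measure
and contributes `w` on top of the frozen sum of the others. -/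
lemma expLE_sum_centered {W : Type*} [MeasurableSpace W] {ρ : Measure W} [IsProbabilityMeasure ρ]
    {Y : W → E d} (hm : Measurable Y) (hi : Integrable Y ρ) (h0 : ∫ z, Y z ∂ρ = 0) {w : ℝ}
    (hw : 0 ≤ w) (hv : ∫⁻ z, ‖Y z‖ₑ ^ 2 ∂ρ ≤ ENNReal.ofReal w) (k : ℕ) :
    ExpLE (Measure.pi fun _ : Fin k => ρ) (fun z => ‖∑ j, Y (z j)‖ ^ 2) (k * w) := by
  induction k with
  | zero => simpa using ExpLE.const (ρ := Measure.pi fun _ : Fin 0 => ρ) le_rfl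
  | succ k ih =>
    have hmp := measurePreserving_piFinSuccAbove (fun _ : Fin (k + 1) => ρ) 0
    have hk : Measurable fun u : W × (Fin k → W) => ‖(∑ j, Y (u.2 j)) + Y u.1‖ ^ 2 := by
      have : Measurable fun u : W × (Fin k → W) => ∑ j, Y (u.2 j) :=
        Finset.measurable_sum _ fun j _ => by fun_prop
      fun_prop
    have hE : ExpLE (ρ.prod (Measure.pi fun _ : Fin k => ρ))
        (fun u : W × (Fin k → W) => ‖(∑ j, Y (u.2 j)) + Y u.1‖ ^ 2) (k * w + w) :=
      ExpLE.prod_symm (h := fun zs : Fin k → W => ‖∑ j, Y (zs j)‖ ^ 2 + w) hk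
        (fun zs => expLE_add_centered hm hi h0 hw hv (∑ j, Y (zs j))) (ih.add (ExpLE.const hw))
    have hE' : ExpLE ((Measure.pi fun _ : Fin (k + 1) => ρ).map
        (MeasurableEquiv.piFinSuccAbove (fun _ : Fin (k + 1) => W) 0))
        (fun u : W × (Fin k → W) => ‖(∑ j, Y (u.2 j)) + Y u.1‖ ^ 2) (k * w + w) := by
      rw [hmp.map_eq]; exact hE
    refine ((ExpLE.of_map hmp.measurable hE').congr fun z => ?_).mono_right (le_of_eq ?_)
    · rw [Fin.sum_univ_succ, add_comm]
      rfl
    · push_cast; ring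

lemma IsUnbiasedBoundedVariance.expLE_batch {Z : Type*} [MeasurableSpace Z] {D : Measure Z}
    [IsProbabilityMeasure D] {h : E d → Z → E d} {G : E d → E d} {σ : ℝ}
    (H : IsUnbiasedBoundedVariance D h G σ) (x : E d) {k : ℕ} (hk : 1 ≤ k) :
    ExpLE (Measure.pi fun _ : Fin k => D) (fun z => ‖(mean fun j => h x (z j)) - G x‖ ^ 2)
      (σ ^ 2 / k) := by
  have hm : Measurable (h x) := H.measurable.comp measurable_prodMk_left
  have hk0 : (0 : ℝ) < k := by exact_mod_cast hk
  have hs := expLE_sum_centered (ρ := D) (Y := fun z => h x z - G x) (hm.sub_const _)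
    ((H.integrable x).sub (integrable_const _))
    (by rw [integral_sub (H.integrable x) (integrable_const _), H.unbiased]; simp)
    (sq_nonneg σ) (H.variance x) k
  refine ((hs.const_mul (c := ((k : ℝ)⁻¹) ^ 2) (by positivity)).congr fun z => ?_).mono_right
    (le_of_eq (by field_simp))
  rw [← mean_const hk (G x), ← mean_sub, mean, norm_smul, mul_pow, mean_const hk]
  simp

end Variance

/-! ### EF21-SGD. -/

section Stochastic

variable {n d : ℕ} {f : Fin n → E d → ℝ} {L : Fin n → ℝ}

/-- The compressor aims at the noisy target `u` instead of `y`. Young's inequality is used twice,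
with `α / 2` to replace `u` by `y` after the update and with `α / 4` before it. This reduces the
rate from `α` to `α / 4`, and the noise factors add up to `2 + 6 / α ≤ 8 / α`. -/
lemma IsContractive.expLE_update_inexact {S : Type*} [MeasurableSpace S] {ν : Measure S}
    [IsProbabilityMeasure ν] {α : ℝ} {𝒞 : S → E d → E d} (h𝒞 : IsContractive 𝒞 ν α) (hα : 0 < α)
    (hα1 : α ≤ 1) (g y u : E d) :
    ExpLE ν (fun s => ‖g + 𝒞 s (u - g) - y‖ ^ 2)
      ((1 - α / 4) * ‖g - y‖ ^ 2 + 8 / α * ‖u - y‖ ^ 2) := by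
  have hm : Measurable fun s => 𝒞 s (u - g) := h𝒞.measurable_apply measurable_id measurable_const
  have hs : 0 < α / 2 := by positivity
  refine (((h𝒞.expLE_update hα1 g u).const_mul (c := 1 + α / 2) (by positivity)).add
    (ExpLE.const (c := (1 + 1 / (α / 2)) * ‖u - y‖ ^ 2) (by positivity))).mono (by fun_prop)
    (fun _ => sq_nonneg _) (fun s => ?_) ?_
  · have := norm_add_sq_le_young (g + 𝒞 s (u - g) - u) (u - y) hs
    rwa [sub_add_sub_cancel] at this
  · have h1 := norm_add_sq_le_young (g - y) (y - u) (s := α / 4) (by positivity)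
    rw [sub_add_sub_cancel, norm_sub_rev y u] at h1
    have e1 : 1 / (α / 2) = 2 * (1 / α) := by field_simp
    have e2 : 1 / (α / 4) = 4 * (1 / α) := by field_simp
    have e3 : 8 / α = 8 * (1 / α) := by ring
    rw [e2] at h1
    rw [e1, e3]
    have hr : 1 ≤ 1 / α := by rw [le_div_iff₀ hα]; linarith
    have h2 : (1 + α / 2) * ((1 - α) * ‖g - u‖ ^ 2) ≤ (1 - α / 2) * ‖g - u‖ ^ 2 := by
      nlinarith [mul_nonneg (sq_nonneg α) (sq_nonneg ‖g - u‖)]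
    have h3 := mul_le_mul_of_nonneg_left h1 (show 0 ≤ 1 - α / 2 by linarith)
    have h4 : (1 - α / 2) * ((1 + α / 4) * ‖g - y‖ ^ 2) ≤ (1 - α / 4) * ‖g - y‖ ^ 2 := by
      nlinarith [mul_nonneg (sq_nonneg α) (sq_nonneg ‖g - y‖)]
    have h5 : (1 - α / 2) * ((1 + 4 * (1 / α)) * ‖u - y‖ ^ 2) ≤
        1 * ((1 + 4 * (1 / α)) * ‖u - y‖ ^ 2) := by
      gcongr
      linarith
    have h6 : 0 ≤ (1 / α - 1) * ‖u - y‖ ^ 2 := mul_nonneg (by linarith) (sq_nonneg _)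
    nlinarith

/-- One round of EF21-SGD on the pair of the iterate and the estimators. -/
noncomputable def stepSGD {S Z : Type*} {τ : Fin n → ℕ} (h : Fin n → E d → Z → E d)
    (𝒞 : S → E d → E d) (γ : ℝ) (s : E d × (Fin n → E d))
    (w : (Fin n → S) × (∀ i, Fin (τ i) → Z)) : E d × (Fin n → E d) :=
  (s.1 - γ • mean s.2, fun i =>
    s.2 i + 𝒞 (w.1 i) ((mean fun j => h i (s.1 - γ • mean s.2) (w.2 i j)) - s.2 i))

lemma measurable_stepSGD {S Z : Type*} [MeasurableSpace S] [MeasurableSpace Z] {ν : Measure S}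
    {α : ℝ} {τ : Fin n → ℕ} {h : Fin n → E d → Z → E d} {𝒞 : S → E d → E d}
    (hh : ∀ i, Measurable (Function.uncurry (h i))) (h𝒞 : IsContractive 𝒞 ν α) (γ : ℝ) :
    Measurable (Function.uncurry (stepSGD (τ := τ) h 𝒞 γ)) := by
  have hx : Measurable fun p : (E d × (Fin n → E d)) × ((Fin n → S) × (∀ i, Fin (τ i) → Z)) =>
      p.1.1 - γ • mean p.1.2 := by fun_prop
  refine hx.prodMk (measurable_pi_lambda _ fun i => Measurable.add (by fun_prop) ?_)
  refine h𝒞.measurable_apply (by fun_prop) (Measurable.sub (measurable_mean ?_) (by fun_prop))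
  refine measurable_pi_lambda _ fun j => (hh i).comp (hx.prodMk ?_)
  fun_prop

lemma expLE_stochastic {S Z : Type*} [MeasurableSpace S] [MeasurableSpace Z] {ν : Measure S}
    [IsProbabilityMeasure ν] {α : ℝ} {τ : Fin n → ℕ} {h : E d → Z → E d} {𝒞 : S → E d → E d}
    (h𝒞 : IsContractive 𝒞 ν α) (hα : 0 < α) (hα1 : α ≤ 1) {D : Measure Z}
    [IsProbabilityMeasure D] {G : E d → E d} {s : ℝ} (H : IsUnbiasedBoundedVariance D h G s)
    {ρ : Measure (Fin n → S)} {σ : Measure (∀ i, Fin (τ i) → Z)} [IsProbabilityMeasure ρ]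
    [IsProbabilityMeasure σ] (i : Fin n) (hτ : 1 ≤ τ i) (hρ : ρ.map (fun s => s i) = ν)
    (hσ : σ.map (fun z => z i) = Measure.pi fun _ : Fin (τ i) => D) (g x : E d) :
    ExpLE (ρ.prod σ) (fun w => ‖g + 𝒞 (w.1 i) ((mean fun j => h x (w.2 i j)) - g) - G x‖ ^ 2)
      ((1 - α / 4) * ‖g - G x‖ ^ 2 + 8 / α * (s ^ 2 / τ i)) := by
  have hhx : Measurable (h x) := H.measurable.comp measurable_prodMk_left
  have hmean : Measurable fun w : (Fin n → S) × (∀ i, Fin (τ i) → Z) =>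
      mean fun j => h x (w.2 i j) :=
    measurable_mean (measurable_pi_lambda _ fun j => hhx.comp (by fun_prop))
  have hm : Measurable fun w : (Fin n → S) × (∀ i, Fin (τ i) → Z) =>
      ‖g + 𝒞 (w.1 i) ((mean fun j => h x (w.2 i j)) - g) - G x‖ ^ 2 := by
    have h1 : Measurable fun w : (Fin n → S) × (∀ i, Fin (τ i) → Z) =>
        𝒞 (w.1 i) ((mean fun j => h x (w.2 i j)) - g) :=
      h𝒞.measurable_apply (by fun_prop) (hmean.sub_const g)
    exact ((measurable_const.add h1).sub_const _).norm.pow_const 2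
  have hb := H.expLE_batch x hτ
  rw [← hσ] at hb
  refine ExpLE.prod_symm hm (fun z => ?_) ((ExpLE.const (mul_nonneg (by linarith)
    (sq_nonneg ‖g - G x‖))).add ((hb.of_map (measurable_pi_apply i)).const_mul
      (c := 8 / α) (by positivity)))
  have hu := h𝒞.expLE_update_inexact hα hα1 g (G x) (mean fun j => h x (z i j))
  rw [← hρ] at hu
  have := Measure.isProbabilityMeasure_map (μ := ρ) (measurable_pi_apply i).aemeasurable
  exact hu.of_map (measurable_pi_apply i)

theorem complexity_SGD (n : ℕ) (L σ : Fin n → ℝ) (α : ℝ) (hn : 0 < n) (hα : 0 < α) (hα1 : α ≤ 1) :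
    ∃ γ : ℝ, 0 < γ ∧
    ∀ (d : ℕ) (f : Fin n → E d → ℝ), IsSmooth f L → BddBelow (Set.range (avg f)) →
    ∀ (x₀ : E d) (ε : ℝ), 0 < ε →
    ∃ (T : ℕ) (τ : Fin n → ℕ), 1 ≤ T ∧ (∀ i, 1 ≤ τ i) ∧
      (T : ℝ) ≤ 10000 * (rms L * gap (avg f) x₀ / (α * ε ^ 2)) + 1 ∧
    ∀ (Z : Type*) [MeasurableSpace Z] (D : Fin n → Measure Z) [∀ i, IsProbabilityMeasure (D i)]
      (h : Fin n → E d → Z → E d),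
      (∀ i, IsUnbiasedBoundedVariance (D i) (h i) (gradient (f i)) (σ i)) →
    ∀ (S : Type*) [MeasurableSpace S] (ν : Measure S) [IsProbabilityMeasure ν]
      (𝒞 : S → E d → E d), IsContractive 𝒞 ν α →
    ∀ (Ω : Type*) [MeasurableSpace Ω] (μ : Measure Ω) [IsProbabilityMeasure μ]
      (ξ : ℕ → Ω → Fin n → S) (z : ℕ → Ω → ∀ i, Fin (τ i) → Z),
      IsFreshNoise (fun _ => ν) ξ μ →
      IsFreshNoise (fun i => Measure.pi fun _ : Fin (τ i) => D i) z μ → IndepNoise ξ z μ →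
    let run := fun t ω => runSGD h 𝒞 γ x₀ (fun t => ξ t ω) (fun t => z t ω) t
    meanSqAtOutput μ (gradient (avg f)) (fun t ω => (run t ω).x) T ≤ ENNReal.ofReal (ε ^ 2) ∧
    ∀ ω, (mean fun i => ((run T ω).cost i : ℝ)) ≤
      10000 * (rms L * gap (avg f) x₀ / (α * ε ^ 2) +
        rms L * gap (avg f) x₀ * (mean fun i => σ i ^ 2) / (α ^ 3 * ε ^ 4) + 1) := by
  have hL := rms_nonneg L
  have hR : 0 ≤ 4 * rms L / (α / 4) := by positivity
  refine ⟨stepsize (4 * rms L / (α / 4)), stepsize_pos hR, ?_⟩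
  intro d f hf hb x₀ ε hε
  have hδ := gap_nonneg hb x₀
  set δ := gap (avg f) x₀ with hδdef
  set γ := stepsize (4 * rms L / (α / 4)) with hγdef
  have hγ : 0 < γ := stepsize_pos hR
  set X := rms L * δ / (α * ε ^ 2) with hXdef
  have hX0 : 0 ≤ X := by positivity
  -- The initial gap alone would need `32 X` rounds; doubling this leaves half of the budget to the
  -- noise.
  have hT := rounds_le (C := 64) (by norm_num) hX0
  set T := rounds 64 X with hTdef
  have hT1 : 1 ≤ T := one_le_rounds _ _
  have hT1' : (1 : ℝ) ≤ T := by exact_mod_cast hT1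
  -- Large batches are affordable only if `X` is bounded below, because their cost is charged to `X
  -- σ² / (α² ε²)`. For `X ≤ 1/2` single samples suffice: the output is the deterministic point
  -- `x₀`, whatever the initial estimators are.
  obtain ⟨τ, hτdef⟩ : ∃ τ : Fin n → ℕ, ∀ i, τ i =
      if X ≤ 1 / 2 then 1 else ⌊144 * σ i ^ 2 / (α ^ 2 * ε ^ 2)⌋₊ + 1 := ⟨_, fun _ => rfl⟩
  have hτ1 : ∀ i, 1 ≤ τ i := fun i => by rw [hτdef]; split_ifs <;> omega
  refine ⟨T, τ, hT1, hτ1, by linarith, ?_⟩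
  intro Z _ D _ h hh S _ ν _ 𝒞 h𝒞 Ω _ μ _ ξ z hξ hz hξz
  dsimp only
  refine ⟨?_, fun ω => ?_⟩
  · have H := hξ.noisePair hz hξz
    have hF := hf.hasLipGrad
    have hG := hF.continuous_gradient.measurable
    have hstepm := measurable_stepSGD (τ := τ) (fun i => (hh i).measurable) h𝒞 γ
    set Y : ℕ → Ω → E d × (Fin n → E d) := fun t ω =>
      ((runSGD h 𝒞 γ x₀ (fun t => ξ t ω) (fun t => z t ω) t).x,
        (runSGD h 𝒞 γ x₀ (fun t => ξ t ω) (fun t => z t ω) t).g) with hY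
    have hinit : Measurable fun u : ∀ i, Fin (τ i) → Z =>
        ((x₀, fun i => mean fun j => h i x₀ (u i j)) : E d × (Fin n → E d)) := by
      refine measurable_const.prodMk (measurable_pi_lambda _ fun i => measurable_mean
        (measurable_pi_lambda _ fun j => ?_))
      have : Measurable (h i x₀) := (hh i).measurable.comp measurable_prodMk_left
      exact this.comp (by fun_prop)
    have hY0 : Measurable[history z 1] (Y 0) := by
      have h0 : Measurable[history z 1] (z 0) := (comap_measurable (z 0)).mono
        (le_iSup₂_of_le (f := fun s (_ : s ∈ Set.Iio 1) => MeasurableSpace.comap (z s) _) 0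
          (by simp) le_rfl) le_rfl
      exact hinit.comp h0
    have hYs : ∀ t ω, Y (t + 1) ω = stepSGD h 𝒞 γ (Y t ω) (ξ t ω, z (t + 1) ω) :=
      fun t ω => rfl
    have hYm : ∀ t, Measurable (Y t) := H.measurable_run hstepm hY0 hYs
    by_cases hX2 : X ≤ 1 / 2
    · rw [hTdef, rounds, if_pos hX2]
      refine meanSqAtOutput_one_le (x₀ := x₀) (fun ω => rfl) hG (fun t => (hYm t).fst) ?_
      have h1 := hF.sq_norm_gradient_le hb x₀
      have h2 : rms L * δ = X * (α * ε ^ 2) := by rw [hXdef]; field_simp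
      have h3 : X * (α * ε ^ 2) ≤ 1 / 2 * (1 * ε ^ 2) := by gcongr
      linarith
    · push Not at hX2
      set Sg := mean fun i => σ i ^ 2 / (τ i : ℝ) with hSg
      have hSg0 : 0 ≤ Sg := mean_nonneg fun i => by positivity
      have hSg1 : Sg ≤ α ^ 2 * ε ^ 2 / 144 := by
        rw [← mean_const hn (α ^ 2 * ε ^ 2 / 144)]
        refine mean_le_mean fun i => ?_
        have hτ0 : (0 : ℝ) < τ i := by exact_mod_cast hτ1 i
        rw [div_le_iff₀ hτ0, hτdef, if_neg hX2.not_ge]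
        have := (Nat.lt_floor_add_one (144 * σ i ^ 2 / (α ^ 2 * ε ^ 2))).le
        rw [div_le_iff₀ (by positivity)] at this
        push_cast
        linarith
      have hbase := H.sum_lintegral_le hstepm hY0 hYs (D := fun _ => True) (fun _ => trivial)
        (fun _ _ _ => trivial)
        (Ψ := fun s => gap (avg f) s.1 + γ / (α / 4) * gradErr f s.2 s.1)
        (N := fun s => γ / 2 * ‖gradient (avg f) s.1‖ ^ 2) (c := γ / (α / 4) * (8 / α * Sg))
        ((hF.measurable_gap measurable_fst).add
          ((hf.measurable_gradErr measurable_snd measurable_fst).const_mul _))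
        (hF.measurable_sq_norm_gradient measurable_fst _) (fun s => by positivity)
        (fun t s _ => by
          have := hξ.isProbabilityMeasure t
          have := hz.isProbabilityMeasure (t + 1)
          refine ⟨_, (ExpLE.const (gap_nonneg hb (s.1 - γ • mean s.2))).add
            (ExpLE.const_mul (ExpLE.mean fun i => expLE_stochastic h𝒞 hα hα1 (hh i) i (hτ1 i)
              (hξ.map_eval t i) (hz.map_eval (t + 1) i) (s.2 i) (s.1 - γ • mean s.2)) (by positivity)), ?_⟩
          rw [mean_add, mean_const_mul, mean_const_mul]
          have := hf.potential_decrease hγ (a := α / 4) (by positivity) (by linarith)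
            (stepsize_mul_le hR) s.1 s.2
          unfold gradErr at this ⊢
          linarith) T
      -- Here the initial estimators carry noise, so the initial potential exceeds the gap by the
      -- weighted batch variance.
      have hE0 : ExpLE μ (fun ω => gap (avg f) (Y 0 ω).1 +
          γ / (α / 4) * gradErr f (Y 0 ω).2 (Y 0 ω).1) (δ + γ / (α / 4) * Sg) :=
        (ExpLE.const hδ).add (ExpLE.const_mul (ExpLE.mean fun i =>
          (hz.expLE 0 i ((hh i).expLE_batch x₀ (hτ1 i))).of_map (hz.measurable 0)) (by positivity))
      refine meanSqAtOutput_le (c := γ / 2) hT1 hG (fun t => (hYm t).fst) (by positivity)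
        hE0.bound_nonneg (b := γ / (α / 4) * (8 / α * Sg)) (by positivity)
        (hbase.trans (by gcongr; exact hE0.lintegral_le)) ?_
      have hLpos : 0 < rms L := by
        refine hL.lt_of_ne fun h0 => ?_
        rw [hXdef, ← h0] at hX2
        norm_num at hX2
      have h1 : γ * (4 * rms L / (α / 4)) = 1 := stepsize_mul (by positivity)
      have h2 : δ = 16 * γ * X * ε ^ 2 := by
        calc δ = γ * (4 * rms L / (α / 4)) * δ := by rw [h1, one_mul]
          _ = _ := by rw [hXdef]; field_simp; ring
      have h3 : X ≤ T / 64 := by linarith [le_rounds (C := 64) hX2]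
      have h4 : γ / (α / 4) * Sg ≤ γ * ε ^ 2 / 36 * T := by
        calc γ / (α / 4) * Sg ≤ γ / (α / 4) * (α ^ 2 * ε ^ 2 / 144) := by gcongr
          _ = γ * ε ^ 2 / 36 * α := by field_simp; norm_num
          _ ≤ γ * ε ^ 2 / 36 * T := by gcongr; linarith
      have h5 : γ / (α / 4) * (8 / α * Sg) ≤ γ * ε ^ 2 * (2 / 9) := by
        calc γ / (α / 4) * (8 / α * Sg) ≤ γ / (α / 4) * (8 / α * (α ^ 2 * ε ^ 2 / 144)) := by gcongr
          _ = _ := by field_simp; norm_num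
      have h6 : δ ≤ 16 * γ * (T / 64) * ε ^ 2 := by rw [h2]; gcongr
      have h7 := mul_le_mul_of_nonneg_left h5 (show (0 : ℝ) ≤ T by linarith)
      -- In units of `γ T ε²` the gap, the initial noise and the accumulated noise take `1/4`,
      -- `1/36` and `2/9`. They add up to the available `1/2`, which is where the `144` in the batch
      -- size comes from.
      linarith
  · have hc : ∀ t i, (runSGD h 𝒞 γ x₀ (fun t => ξ t ω) (fun t => z t ω) t).cost i =
        (t + 1) * τ i := by
      intro t i
      induction t with
      | zero => simp [runSGD]
      | succ t ih => simp only [runSGD, ih]; ring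
    simp_rw [hc]
    push_cast
    rw [mean_const_mul]
    have hσ0 : 0 ≤ mean fun i => σ i ^ 2 := mean_nonneg fun i => sq_nonneg _
    have e : rms L * δ * (mean fun i => σ i ^ 2) / (α ^ 3 * ε ^ 4) =
        X * ((mean fun i => σ i ^ 2) / (α ^ 2 * ε ^ 2)) := by rw [hXdef]; field_simp
    rw [e]
    set s := (mean fun i => σ i ^ 2) / (α ^ 2 * ε ^ 2) with hs
    have hs0 : 0 ≤ s := by positivity
    have hXs : 0 ≤ X * s := by positivity
    by_cases hX2 : X ≤ 1 / 2
    · have hτ : ∀ i, (τ i : ℝ) = 1 := fun i => by rw [hτdef, if_pos hX2, Nat.cast_one]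
      have : T = 1 := by rw [hTdef, rounds, if_pos hX2]
      simp_rw [hτ]
      rw [mean_const hn, this]
      push_cast
      linarith
    · push Not at hX2
      have h1 : (mean fun i => (τ i : ℝ)) ≤ 144 * s + 1 := by
        calc (mean fun i => (τ i : ℝ))
            ≤ mean fun i => 144 / (α ^ 2 * ε ^ 2) * σ i ^ 2 + 1 := by
              refine mean_le_mean fun i => ?_
              rw [hτdef, if_neg hX2.not_ge]
              push_cast
              have := Nat.floor_le (show 0 ≤ 144 * σ i ^ 2 / (α ^ 2 * ε ^ 2) by positivity)
              rw [div_mul_eq_mul_div]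
              linarith
          _ = 144 * s + 1 := by
              rw [mean_add, mean_const_mul, mean_const hn, hs]; ring
      -- Initialization uses one more batch, hence `T + 1`. Because `X > 1/2`, the additive
      -- constants are absorbed: `T + 1 ≤ 64 X + 2 ≤ 68 X`.
      calc ((T : ℝ) + 1) * (mean fun i => (τ i : ℝ)) ≤ (68 * X) * (144 * s + 1) :=
            mul_le_mul (by linarith) h1 (mean_nonneg fun i => Nat.cast_nonneg _) (by positivity)
        _ ≤ _ := by nlinarith

end Stochastic

/-! ### EF21-PAGE. -/

section Page

variable {n m d : ℕ} {L : Fin n → ℝ}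

/-- A stochastic gradient difference of one node, shifted by `a`. -/
lemma IsAvgSmooth.expLE {q : Measure (Fin m)} [IsProbabilityMeasure q] {f : Fin m → E d → ℝ}
    {l : ℝ} (H : IsAvgSmooth q f l) (x y a : E d) :
    ExpLE q (fun j => ‖a + (gradient (f j) y - gradient (f j) x)‖ ^ 2)
      (‖a + (gradient (avg f) y - gradient (avg f) x)‖ ^ 2 + l ^ 2 * ‖y - x‖ ^ 2) := by
  have hi : Integrable (fun j => gradient (f j) y - gradient (f j) x) q := .of_finite
  refine (expLE_add_centered (ρ := q) (Y := fun j => (gradient (f j) y - gradient (f j) x) -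
    (gradient (avg f) y - gradient (avg f) x)) (measurable_of_countable _) .of_finite ?_
    (by positivity) (H.variance x y) _).congr fun j => ?_
  · rw [integral_sub hi (integrable_const _), H.unbiased]
    simp
  · rw [add_assoc, add_sub_cancel]

/-- The update of the PAGE estimator `v` when the iterate moves from `x` to `y`. -/
noncomputable def pageUpdate (f : Fin m → E d → ℝ) (x y v : E d) (c : Bool × Fin m) : E d :=
  if c.1 then gradient (avg f) y else v + (gradient (f c.2) y - gradient (f c.2) x)

/-- The reference point `u` is left free because two choices are needed: `u = v` measures how far
the PAGE estimator moves, and `u = ∇f(y)` measures its new error. -/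
lemma expLE_pageUpdate {p : ℝ} (hp : 0 ≤ p) (hp1 : p ≤ 1) {q : Measure (Fin m)}
    [IsProbabilityMeasure q] {f : Fin m → E d → ℝ} {l : ℝ} (H : IsAvgSmooth q f l)
    (x y v u : E d) :
    ExpLE ((bernoulliLaw p).prod q) (fun c => ‖pageUpdate f x y v c - u‖ ^ 2)
      (p * ‖gradient (avg f) y - u‖ ^ 2 + (1 - p) *
        (‖v - u + (gradient (avg f) y - gradient (avg f) x)‖ ^ 2 + l ^ 2 * ‖y - x‖ ^ 2)) := by
  refine ExpLE.prod (measurable_of_countable _) (fun b => ?_)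
    (expLE_bernoulliLaw hp hp1 (sq_nonneg _) (by positivity))
  cases b with
  | true => simpa [pageUpdate] using ExpLE.const (ρ := q) (sq_nonneg ‖gradient (avg f) y - u‖)
  | false =>
    simp only [pageUpdate, Bool.false_eq_true, if_false]
    exact (H.expLE x y (v - u)).congr fun j => by rw [sub_add_eq_add_sub]

/-- One round of EF21-PAGE on the iterate, the estimators and the PAGE estimators. -/
noncomputable def stepPAGE {S : Type*} (f : Fin n → Fin m → E d → ℝ) (𝒞 : S → E d → E d) (γ : ℝ)
    (s : E d × (Fin n → E d) × (Fin n → E d)) (w : (Fin n → S) × (Fin n → Bool × Fin m)) :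
    E d × (Fin n → E d) × (Fin n → E d) :=
  (s.1 - γ • mean s.2.1,
    fun i => s.2.1 i + 𝒞 (w.1 i)
      (pageUpdate (f i) s.1 (s.1 - γ • mean s.2.1) (s.2.2 i) (w.2 i) - s.2.1 i),
    fun i => pageUpdate (f i) s.1 (s.1 - γ • mean s.2.1) (s.2.2 i) (w.2 i))

/-- The summands of a node are only assumed differentiable, so their gradients need not be
continuous. -/
lemma measurable_gradient (h : E d → ℝ) : Measurable (gradient h) :=
  (InnerProductSpace.toDual ℝ (E d)).symm.continuous.measurable.comp (measurable_fderiv ℝ h)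

lemma measurable_stepPAGE {S : Type*} [MeasurableSpace S] {ν : Measure S}
    {α : ℝ} {f : Fin n → Fin m → E d → ℝ} {𝒞 : S → E d → E d} (h𝒞 : IsContractive 𝒞 ν α) (γ : ℝ) :
    Measurable (Function.uncurry (stepPAGE f 𝒞 γ)) := by
  have hx : Measurable fun p : (E d × (Fin n → E d) × (Fin n → E d)) ×
      ((Fin n → S) × (Fin n → Bool × Fin m)) => p.1.1 - γ • mean p.1.2.1 := by fun_prop
  have hu : ∀ i, Measurable fun r : (E d × E d × E d) × (Bool × Fin m) =>
      pageUpdate (f i) r.1.1 r.1.2.1 r.1.2.2 r.2 := by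
    intro i
    refine measurable_from_prod_countable_left fun c => ?_
    have h1 := measurable_gradient (avg (f i))
    have h2 := measurable_gradient (f i c.2)
    unfold pageUpdate
    dsimp only
    split_ifs <;> fun_prop
  have hv : ∀ i, Measurable fun p : (E d × (Fin n → E d) × (Fin n → E d)) ×
      ((Fin n → S) × (Fin n → Bool × Fin m)) =>
      pageUpdate (f i) p.1.1 (p.1.1 - γ • mean p.1.2.1) (p.1.2.2 i) (p.2.2 i) := fun i =>
    (hu i).comp ((measurable_fst.fst.prodMk (hx.prodMk (by fun_prop))).prodMk (by fun_prop))
  refine hx.prodMk (Measurable.prodMk (measurable_pi_lambda _ fun i =>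
    Measurable.add (by fun_prop) ?_) (measurable_pi_lambda _ hv))
  exact h𝒞.measurable_apply (by fun_prop) ((hv i).sub (by fun_prop))

/-- The compressor tracks the moving target `v`. For a frozen new target it contracts by `1 - α`,
and the movement of the target enters through `contraction_young` with factor `2 / α`. -/
lemma expLE_compress_pageUpdate {S : Type*} [MeasurableSpace S] {ν : Measure S} {α p : ℝ}
    {𝒞 : S → E d → E d} (h𝒞 : IsContractive 𝒞 ν α) (hα : 0 < α) (hα1 : α ≤ 1) (hp : 0 ≤ p)
    (hp1 : p ≤ 1) {q : Measure (Fin m)} [IsProbabilityMeasure q] {f : Fin m → E d → ℝ} {l : ℝ}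
    (H : IsAvgSmooth q f l) {ρ : Measure (Fin n → S)} {σ : Measure (Fin n → Bool × Fin m)}
    [IsProbabilityMeasure ρ] [IsProbabilityMeasure σ] (i : Fin n) (hρ : ρ.map (fun s => s i) = ν)
    (hσ : σ.map (fun s => s i) = (bernoulliLaw p).prod q) (x y g v : E d) :
    ExpLE (ρ.prod σ) (fun w => ‖g + 𝒞 (w.1 i) (pageUpdate f x y v (w.2 i) - g) -
        pageUpdate f x y v (w.2 i)‖ ^ 2)
      ((1 - α / 2) * ‖g - v‖ ^ 2 + 2 / α * (p * ‖gradient (avg f) y - v‖ ^ 2 + (1 - p) *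
        (‖gradient (avg f) y - gradient (avg f) x‖ ^ 2 + l ^ 2 * ‖y - x‖ ^ 2))) := by
  have hu : Measurable fun w : (Fin n → S) × (Fin n → Bool × Fin m) =>
      pageUpdate f x y v (w.2 i) :=
    (measurable_of_countable (pageUpdate f x y v)).comp (by fun_prop)
  have hm : Measurable fun w : (Fin n → S) × (Fin n → Bool × Fin m) =>
      ‖g + 𝒞 (w.1 i) (pageUpdate f x y v (w.2 i) - g) - pageUpdate f x y v (w.2 i)‖ ^ 2 := by
    have h1 : Measurable fun w : (Fin n → S) × (Fin n → Bool × Fin m) =>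
        𝒞 (w.1 i) (pageUpdate f x y v (w.2 i) - g) :=
      h𝒞.measurable_apply (by fun_prop) (hu.sub_const g)
    exact ((measurable_const.add h1).sub hu).norm.pow_const 2
  have hP := expLE_pageUpdate hp hp1 H x y v v
  rw [sub_self, zero_add, ← hσ] at hP
  have hP' := (ExpLE.const (ρ := σ) (mul_nonneg (show 0 ≤ 1 - α / 2 by linarith)
    (sq_nonneg ‖g - v‖))).add ((hP.of_map (measurable_pi_apply i)).const_mul
      (c := 2 / α) (by positivity))
  have hcu : Measurable fun c : Fin n → Bool × Fin m => pageUpdate f x y v (c i) :=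
    (measurable_of_countable (pageUpdate f x y v)).comp (measurable_pi_apply i)
  refine ExpLE.prod_symm (h := fun c => (1 - α) * ‖g - pageUpdate f x y v (c i)‖ ^ 2) hm
    (fun c => ?_) (hP'.mono (by fun_prop) (fun c => mul_nonneg (by linarith) (sq_nonneg _))
      (fun c => ?_) le_rfl)
  · have := h𝒞.expLE_update hα1 g (pageUpdate f x y v (c i))
    rw [← hρ] at this
    exact this.of_map (measurable_pi_apply i)
  · have := contraction_young hα hα1 (g - v) (v - pageUpdate f x y v (c i))
    rwa [sub_add_sub_cancel, norm_sub_rev v] at this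

/-- The PAGE error contracts at rate `p`. Its weight `γ / p + 8 γ / α²` repays exactly the `γ` lost
in the descent step and the `8 γ p / α²` lost through the movement of `v`. In the second part `1 / p
= M + 1 ≤ 2 M` turns the variance term into `2 (γ √M k)²`; this is the source of `√m` in the rate.
-/
lemma coefficients_PAGE {γ α p M l k : ℝ} (hγ : 0 < γ) (hα : 0 < α) (hα1 : α ≤ 1) (hp : 0 < p)
    (hM : 1 ≤ M) (hpM : 1 / p = M + 1) (hl : 0 ≤ l) (hk : 0 ≤ k)
    (hγR : γ * (8 * ((l + k) / α + √M * k)) ≤ 1) :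
    γ + 2 * γ / α * (2 / α * (2 * p)) = (γ / p + 8 * γ / α ^ 2) * p ∧
    2 * γ / α * (2 / α * ((2 * l ^ 2 + k ^ 2) * γ ^ 2)) +
      (γ / p + 8 * γ / α ^ 2) * (k ^ 2 * γ ^ 2) ≤ γ / 2 - l * γ ^ 2 / 2 := by
  constructor
  · field_simp; ring
  · set qa := γ * ((l + k) / α) with hqa
    set qb := γ * (√M * k) with hqb
    have hqa0 : 0 ≤ qa := by positivity
    have hqb0 : 0 ≤ qb := by positivity
    have hq : qa + qb ≤ 1 / 8 := by
      have : γ * (8 * ((l + k) / α + √M * k)) = 8 * (qa + qb) := by rw [hqa, hqb]; ring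
      linarith
    have h1 : (γ * l / α) ^ 2 + (γ * k / α) ^ 2 ≤ qa ^ 2 := by
      have e : qa = γ * l / α + γ * k / α := by rw [hqa]; ring
      have : 0 ≤ (γ * l / α) * (γ * k / α) := by positivity
      rw [e]; nlinarith
    have h2 : (1 / p) * (γ * k) ^ 2 ≤ 2 * qb ^ 2 := by
      have e : qb ^ 2 = M * (γ * k) ^ 2 := by
        rw [hqb, mul_pow, mul_pow, Real.sq_sqrt (by linarith)]; ring
      rw [e, hpM]
      nlinarith [sq_nonneg (γ * k)]
    have h3 : γ * l ≤ qa := by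
      have : l + k ≤ (l + k) / α := by
        rw [le_div_iff₀ hα]
        nlinarith
      rw [hqa]
      nlinarith
    have e1 : 2 * γ / α * (2 / α * ((2 * l ^ 2 + k ^ 2) * γ ^ 2)) +
        (γ / p + 8 * γ / α ^ 2) * (k ^ 2 * γ ^ 2) =
        γ * (8 * (γ * l / α) ^ 2 + 12 * (γ * k / α) ^ 2 + (1 / p) * (γ * k) ^ 2) := by
      field_simp; ring
    have e2 : γ / 2 - l * γ ^ 2 / 2 = γ * (1 / 2 - γ * l / 2) := by ring
    rw [e1, e2]
    apply mul_le_mul_of_nonneg_left _ hγ.le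
    have h4 : 0 ≤ (γ * l / α) ^ 2 := sq_nonneg _
    have h5 : 12 * qa ^ 2 + 2 * qb ^ 2 ≤ 3 / 16 := by nlinarith
    linarith

/-- The error of `g` is split at `v`: `V'` and `P'` stand for the expected new values of `‖g - v‖²`
and of the PAGE error. The weight `2 γ / α` makes the contraction of the first gain `γ`. -/
lemma IsSmooth.potential_decrease_PAGE {f : Fin n → E d → ℝ} (hf : IsSmooth f L)
    {γ α p M k : ℝ} (hγ : 0 < γ) (hα : 0 < α)
    (hα1 : α ≤ 1) (hp : 0 < p) (hM : 1 ≤ M) (hpM : 1 / p = M + 1) (hk : 0 ≤ k)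
    (hγR : γ * (8 * ((rms L + k) / α + √M * k)) ≤ 1) (x : E d) (g v : Fin n → E d) {V' P' : ℝ}
    (hV : V' ≤ (1 - α / 2) * (mean fun i => ‖g i - v i‖ ^ 2) + 2 / α * (2 * p * gradErr f v x +
      (2 * rms L ^ 2 + k ^ 2) * ‖x - γ • mean g - x‖ ^ 2))
    (hP : P' ≤ (1 - p) * gradErr f v x + k ^ 2 * ‖x - γ • mean g - x‖ ^ 2) :
    gap (avg f) (x - γ • mean g) + 2 * γ / α * V' + (γ / p + 8 * γ / α ^ 2) * P' +
      γ / 2 * ‖gradient (avg f) x‖ ^ 2 ≤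
    gap (avg f) x + 2 * γ / α * (mean fun i => ‖g i - v i‖ ^ 2) +
      (γ / p + 8 * γ / α ^ 2) * gradErr f v x := by
  have h1 := hf.hasLipGrad.step hγ x (mean g)
  have e : ‖x - γ • mean g - x‖ ^ 2 = γ ^ 2 * ‖mean g‖ ^ 2 := by
    rw [sub_sub_cancel_left, norm_neg, norm_smul, Real.norm_of_nonneg hγ.le, mul_pow]
  rw [e] at hV hP
  have h2 : ‖mean g - gradient (avg f) x‖ ^ 2 ≤
      2 * (mean fun i => ‖g i - v i‖ ^ 2) + 2 * gradErr f v x := by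
    have h3 := norm_add_sq_le_two (mean g - mean v) (mean v - gradient (avg f) x)
    rw [sub_add_sub_cancel, ← mean_sub] at h3
    linarith [hf.norm_mean_sub_sq_le v x, norm_mean_sq_le fun i => g i - v i]
  obtain ⟨hA, hB⟩ := coefficients_PAGE hγ hα hα1 hp hM hpM (rms_nonneg L) hk hγR
  have hC : 2 * γ / α * (α / 2) = γ := by field_simp
  have h3 := mul_le_mul_of_nonneg_left hV (show 0 ≤ 2 * γ / α by positivity)
  have h4 := mul_le_mul_of_nonneg_left hP (show 0 ≤ γ / p + 8 * γ / α ^ 2 by positivity)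
  have h5 := mul_le_mul_of_nonneg_right hB (sq_nonneg ‖mean g‖)
  have h6 := mul_le_mul_of_nonneg_left h2 (show 0 ≤ γ / 2 by positivity)
  have h7 : (γ + 2 * γ / α * (2 / α * (2 * p))) * gradErr f v x =
      (γ / p + 8 * γ / α ^ 2) * p * gradErr f v x := by rw [hA]
  have h8 : 2 * γ / α * (α / 2) * (mean fun i => ‖g i - v i‖ ^ 2) =
      γ * mean fun i => ‖g i - v i‖ ^ 2 := by rw [hC]
  unfold gap
  clear hA hB hC hV hP h2 e hγR hpM
  generalize 2 * γ / α = l1 at *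
  generalize γ / p + 8 * γ / α ^ 2 = l2 at *
  generalize 2 / α = k2 at *
  generalize (mean fun i => ‖g i - v i‖ ^ 2) = V at *
  generalize gradErr f v x = P at *
  linarith

/-- A round costs `p m + 2 (1 - p) ≤ 3` summand gradients on average, because full gradients are
rare enough that `p m ≤ 1`. -/
lemma lintegral_cost_runPAGE_le {S Ω : Type*} [MeasurableSpace Ω] {μ : Measure Ω}
    [IsProbabilityMeasure μ] (f : Fin n → Fin m → E d → ℝ) (𝒞 : S → E d → E d) (γ : ℝ) (x₀ : E d)
    (ξ : ℕ → Ω → Fin n → S) {c : ℕ → Ω → Fin n → Bool × Fin m} {p : ℝ} {q : Fin n → Measure (Fin m)}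
    [∀ i, IsProbabilityMeasure (q i)] (hp : 0 ≤ p) (hp1 : p ≤ 1) (hpm : p * m ≤ 1)
    (hc : IsFreshNoise (fun i => (bernoulliLaw p).prod (q i)) c μ) (i : Fin n) (T : ℕ) :
    ∫⁻ ω, ((runPAGE f 𝒞 γ x₀ (fun t => ξ t ω) (fun t => c t ω) T).cost i : ℝ≥0∞) ∂μ ≤
      m + T * 3 := by
  induction T with
  | zero => simp [runPAGE]
  | succ T ih =>
    have hci : Measurable fun ω => c T ω i := (measurable_pi_apply i).comp (hc.measurable T)
    have hcm : Measurable fun ω => (c T ω i).1 := measurable_fst.comp hci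
    have hlaw : μ.map (fun ω => (c T ω i).1) = bernoulliLaw p := by
      have h1 := Measure.map_map (μ := μ) measurable_fst hci
      rw [hc.law_eq T i, Measure.map_fst_prod] at h1
      simpa [Function.comp_def] using h1.symm
    have e : ∀ ω, ((runPAGE f 𝒞 γ x₀ (fun t => ξ t ω) (fun t => c t ω) (T + 1)).cost i : ℝ≥0∞) =
        (runPAGE f 𝒞 γ x₀ (fun t => ξ t ω) (fun t => c t ω) T).cost i +
          (fun b : Bool => if b then (m : ℝ≥0∞) else 2) (c T ω i).1 := by
      intro ω
      simp only [runPAGE]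
      split_ifs <;> simp
    rw [lintegral_add_map hcm
      (measurable_of_countable fun b : Bool => if b then (m : ℝ≥0∞) else 2) e, hlaw]
    have hb := (expLE_bernoulliLaw (u := m) (v := 2) hp hp1 (by positivity)
      (by norm_num)).lintegral_le
    have e2 : ∀ b : Bool, ENNReal.ofReal (if b = true then (m : ℝ) else 2) =
        if b = true then (m : ℝ≥0∞) else 2 := by
      intro b; cases b <;> simp
    simp_rw [e2] at hb
    calc _ ≤ ((m : ℝ≥0∞) + T * 3) + 3 := by
          refine add_le_add ih (hb.trans ?_)
          refine (ENNReal.ofReal_le_ofReal (show p * m + (1 - p) * 2 ≤ 3 by linarith)).trans ?_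
          simp
      _ = _ := by push_cast; ring

theorem complexity_PAGE (n m : ℕ) (L ℓ : Fin n → ℝ) (α : ℝ) (hn : 0 < n) (hm : 0 < m) (hα : 0 < α)
    (hα1 : α ≤ 1) :
    let p : ℝ := 1 / ((m : ℝ) + 1)
    let ℓt : ℝ := √(1 - p) * rms ℓ
    ∃ γ : ℝ, 0 < γ ∧
    ∀ (d : ℕ) (f : Fin n → Fin m → E d → ℝ) (q : Fin n → Measure (Fin m))
      [∀ i, IsProbabilityMeasure (q i)], IsSmooth (fun i => avg (f i)) L →
      (∀ i, IsAvgSmooth (q i) (f i) (ℓ i)) →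
      BddBelow (Set.range (avg fun i => avg (f i))) →
    ∀ (x₀ : E d) (ε : ℝ), 0 < ε →
    let F : E d → ℝ := avg fun i => avg (f i)
    let B : ℝ := (rms L + ℓt) * gap F x₀ / (α * ε ^ 2) + √(m : ℝ) * ℓt * gap F x₀ / ε ^ 2
    ∃ T : ℕ, 1 ≤ T ∧ (T : ℝ) ≤ 10000 * B + 1 ∧
    ∀ (S : Type*) [MeasurableSpace S] (ν : Measure S) [IsProbabilityMeasure ν]
      (𝒞 : S → E d → E d), IsContractive 𝒞 ν α →
    ∀ (Ω : Type*) [MeasurableSpace Ω] (μ : Measure Ω) [IsProbabilityMeasure μ]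
      (ξ : ℕ → Ω → Fin n → S) (c : ℕ → Ω → Fin n → Bool × Fin m),
      IsFreshNoise (fun _ => ν) ξ μ →
      IsFreshNoise (fun i => (bernoulliLaw p).prod (q i)) c μ → IndepNoise ξ c μ →
    let run := fun t ω => runPAGE f 𝒞 γ x₀ (fun t => ξ t ω) (fun t => c t ω) t
    meanSqAtOutput μ (gradient F) (fun t ω => (run t ω).x) T ≤ ENNReal.ofReal (ε ^ 2) ∧
    (∑ i, ∫⁻ ω, ((run T ω).cost i : ENNReal) ∂μ) / n ≤ ENNReal.ofReal (10000 * (m + B)) := by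
  intro p ℓt
  have hL := rms_nonneg L
  have hM : (1 : ℝ) ≤ m := by exact_mod_cast hm
  have hp : 0 < p := by positivity
  have hp1 : p ≤ 1 := by
    rw [div_le_one (by positivity)]
    linarith
  have hpM : 1 / p = m + 1 := one_div_one_div _
  have hpm : p * m ≤ 1 := by
    have : p * (m + 1) = 1 := by rw [← hpM, mul_one_div_cancel hp.ne']
    linarith
  have hk : 0 ≤ ℓt := mul_nonneg (Real.sqrt_nonneg _) (rms_nonneg ℓ)
  have hksq : ℓt ^ 2 = (1 - p) * rms ℓ ^ 2 := by
    rw [mul_pow, Real.sq_sqrt (by linarith)]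
  -- From here on `p` and `ℓt` are used only through the facts recorded above.
  clear_value ℓt p
  have hR : 0 ≤ 8 * ((rms L + ℓt) / α + √(m : ℝ) * ℓt) := by positivity
  refine ⟨stepsize (8 * ((rms L + ℓt) / α + √(m : ℝ) * ℓt)), stepsize_pos hR, ?_⟩
  intro d f q _ hf hfa hb x₀ ε hε F B
  have hδ : 0 ≤ gap F x₀ := gap_nonneg hb x₀
  set γ := stepsize (8 * ((rms L + ℓt) / α + √(m : ℝ) * ℓt)) with hγdef
  have hγ : 0 < γ := stepsize_pos hR
  have hB : B = (rms L + ℓt) * gap F x₀ / (α * ε ^ 2) + √(m : ℝ) * ℓt * gap F x₀ / ε ^ 2 := rfl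
  clear_value B
  have hB0 : 0 ≤ B := by rw [hB]; positivity
  have hBε : B * ε ^ 2 = ((rms L + ℓt) / α + √(m : ℝ) * ℓt) * gap F x₀ := by
    rw [hB]; field_simp
  have hT := rounds_le (C := 16) (by norm_num) hB0
  refine ⟨rounds 16 B, one_le_rounds _ _, by linarith, ?_⟩
  intro S _ ν _ 𝒞 h𝒞 Ω _ μ _ ξ c hξ hc hξc
  dsimp only
  refine ⟨?_, ?_⟩
  · have H := hξ.noisePair hc hξc
    have hF := hf.hasLipGrad
    have hstepm := measurable_stepPAGE (f := f) h𝒞 γ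
    set Y : ℕ → Ω → E d × (Fin n → E d) × (Fin n → E d) := fun t ω =>
      ((runPAGE f 𝒞 γ x₀ (fun t => ξ t ω) (fun t => c t ω) t).x,
        (runPAGE f 𝒞 γ x₀ (fun t => ξ t ω) (fun t => c t ω) t).g,
        (runPAGE f 𝒞 γ x₀ (fun t => ξ t ω) (fun t => c t ω) t).v) with hY
    have hY0 : Measurable[history c 0] (Y 0) := measurable_of_eq_const
      (x₀, fun i => gradient (avg (f i)) x₀, fun i => gradient (avg (f i)) x₀) fun _ => rfl
    have hYs : ∀ t ω, Y (t + 1) ω = stepPAGE f 𝒞 γ (Y t ω) (ξ t ω, c (t + 0) ω) :=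
      fun t ω => rfl
    have hYm : ∀ t, Measurable (Y t) := H.measurable_run hstepm hY0 hYs
    refine hF.meanSqAtOutput_rounds_le hb (x₀ := x₀) (c := γ / 2) (fun ω => rfl)
      (fun t => (hYm t).fst) ?_ (by positivity) (fun T => ?_) (fun hX2 => ?_)
    · rw [hBε]
      gcongr
      have h1 : rms L + ℓt ≤ (rms L + ℓt) / α := by
        rw [le_div_iff₀ hα]
        nlinarith
      have h2 : 0 ≤ √(m : ℝ) * ℓt := by positivity
      linarith
    · have key := H.sum_lintegral_le hstepm hY0 hYs (D := fun _ => True) (fun _ => trivial)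
        (fun _ _ _ => trivial)
        (Ψ := fun s => gap F s.1 + 2 * γ / α * (mean fun i => ‖s.2.1 i - s.2.2 i‖ ^ 2) +
          (γ / p + 8 * γ / α ^ 2) * gradErr (fun i => avg (f i)) s.2.2 s.1)
        (N := fun s => γ / 2 * ‖gradient F s.1‖ ^ 2) (c := 0)
        (((hF.measurable_gap measurable_fst).add (by fun_prop)).add
          ((hf.measurable_gradErr (by fun_prop) measurable_fst).const_mul _))
        (hF.measurable_sq_norm_gradient measurable_fst _) (fun s => by positivity)
        (fun t s _ => by
          have := hξ.isProbabilityMeasure t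
          have := hc.isProbabilityMeasure (t + 0)
          refine ⟨_, ((ExpLE.const (gap_nonneg hb (s.1 - γ • mean s.2.1))).add
            (ExpLE.const_mul (ExpLE.mean fun i => expLE_compress_pageUpdate h𝒞 hα hα1 hp.le hp1
              (hfa i) i (hξ.map_eval t i) (hc.map_eval (t + 0) i) s.1 (s.1 - γ • mean s.2.1)
              (s.2.1 i) (s.2.2 i)) (by positivity))).add
            (ExpLE.const_mul (ExpLE.mean fun i => (hc.expLE (t + 0) i (expLE_pageUpdate hp.le hp1
              (hfa i) s.1 (s.1 - γ • mean s.2.1) (s.2.2 i)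
              (gradient (avg (f i)) (s.1 - γ • mean s.2.1)))).snd) (by positivity)), ?_⟩
          rw [add_zero]
          set y := s.1 - γ • mean s.2.1 with hy
          refine hf.potential_decrease_PAGE hγ hα hα1 hp hM hpM hk (stepsize_mul_le hR) s.1 s.2.1
            s.2.2 ?_ ?_
          · rw [← hy]
            calc _ ≤ mean fun i => (1 - α / 2) * ‖s.2.1 i - s.2.2 i‖ ^ 2 + 2 / α *
                  (2 * p * ‖s.2.2 i - gradient (avg (f i)) s.1‖ ^ 2 +
                    (2 * L i ^ 2 * ‖y - s.1‖ ^ 2 + (1 - p) * ℓ i ^ 2 * ‖y - s.1‖ ^ 2)) := by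
                  refine mean_le_mean fun i => ?_
                  have h1 := hf.norm_sub_sq_le i y s.1
                  have h2 := norm_sub_sq_le_two (gradient (avg (f i)) y - gradient (avg (f i)) s.1)
                    (s.2.2 i - gradient (avg (f i)) s.1)
                  rw [sub_sub_sub_cancel_right] at h2
                  have h3 := mul_le_mul_of_nonneg_left h2 hp.le
                  -- The gradient displacement occurs with coefficient `2 p` from the full-gradient
                  -- branch and `1 - p` from the other, in total `1 + p ≤ 2`.
                  have h4 := mul_le_mul_of_nonneg_left h1 (show 0 ≤ 1 + p by linarith)
                  have h5 : 0 ≤ (1 - p) * (L i ^ 2 * ‖y - s.1‖ ^ 2) :=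
                    mul_nonneg (by linarith) (by positivity)
                  refine add_le_add le_rfl (mul_le_mul_of_nonneg_left ?_ (by positivity))
                  linarith
              _ = _ := by
                  rw [mean_add, mean_const_mul, mean_const_mul, mean_add, mean_const_mul, mean_add,
                    mean_mul_const, mean_mul_const, mean_const_mul, mean_const_mul, hksq,
                    sq_rms L, sq_rms ℓ, gradErr]
                  ring
          · rw [← hy]
            -- A full gradient resets the error to zero. Otherwise the old error is kept and the
            -- centered sampling noise is added, with no Young loss.
            refine le_of_eq ?_
            calc _ = mean fun i => (1 - p) * ‖s.2.2 i - gradient (avg (f i)) s.1‖ ^ 2 +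
                  (1 - p) * ℓ i ^ 2 * ‖y - s.1‖ ^ 2 := by
                  congr 1
                  funext i
                  rw [sub_self, norm_zero, sub_add_sub_cancel]
                  ring
              _ = _ := by
                  rw [mean_add, mean_const_mul, mean_mul_const, mean_const_mul, hksq, sq_rms ℓ,
                    gradErr]) T
      refine key.trans (le_of_eq ?_)
      have : gradErr (fun i => avg (f i)) (fun i => gradient (avg (f i)) x₀) x₀ = 0 := by
        simp [gradErr, mean]
      have h0 : (mean fun _ : Fin n => (0 : ℝ)) = 0 := by simp [mean]
      simp [hY, runPAGE, this, h0, F]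
    -- If this factor vanished, so would `B`, contrary to `B > 1/2`; hence the stepsize is not the
    -- default one.
    · have hRpos : 0 < (rms L + ℓt) / α + √(m : ℝ) * ℓt := by
        refine lt_of_le_of_ne (by positivity) fun h0 => ?_
        rw [← h0, zero_mul] at hBε
        have : 0 < B * ε ^ 2 := by
          have : 0 < B := by linarith
          positivity
        linarith
      have h1 : γ * (8 * ((rms L + ℓt) / α + √(m : ℝ) * ℓt)) = 1 := stepsize_mul (by positivity)
      refine le_of_eq ?_
      calc gap F x₀ = γ * (8 * ((rms L + ℓt) / α + √(m : ℝ) * ℓt)) * gap F x₀ := by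
            rw [h1, one_mul]
        _ = γ * 8 * (B * ε ^ 2) := by rw [hBε]; ring
        _ = _ := by ring
  · have hn0 : (n : ℝ≥0∞) ≠ 0 := by exact_mod_cast hn.ne'
    refine ENNReal.div_le_of_le_mul ?_
    calc _ ≤ ∑ _i : Fin n, ((m : ℝ≥0∞) + (rounds 16 B : ℕ) * 3) :=
          Finset.sum_le_sum fun i _ => lintegral_cost_runPAGE_le f 𝒞 γ x₀ ξ hp.le hp1 hpm hc i _
      _ = ENNReal.ofReal ((m : ℝ) + (rounds 16 B : ℕ) * 3) * n := by
          rw [Finset.sum_const, Finset.card_univ, Fintype.card_fin, nsmul_eq_mul, mul_comm,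
            ENNReal.ofReal_add (by positivity) (by positivity), ENNReal.ofReal_mul (by positivity)]
          simp
      _ ≤ _ := by
          gcongr
          linarith

end Page

/-! ### EF21-Prox. -/

section Prox

variable {n d : ℕ} {r : E d → EReal} {γ : ℝ}

lemma IsProperClosedConvex.coe_toReal (hr : IsProperClosedConvex r) {x : E d} (hx : r x ≠ ⊤) :
    ((r x).toReal : EReal) = r x := EReal.coe_toReal hx (hr.ne_bot x)

lemma IsProperClosedConvex.toReal_convex (hr : IsProperClosedConvex r) {x y : E d}
    (hx : r x ≠ ⊤) (hy : r y ≠ ⊤) {a b : ℝ} (ha : 0 ≤ a) (hb : 0 ≤ b) (hab : a + b = 1) :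
    r (a • x + b • y) ≠ ⊤ ∧
      (r (a • x + b • y)).toReal ≤ a * (r x).toReal + b * (r y).toReal := by
  have h := hr.convex (x := (x, (r x).toReal)) (y := (y, (r y).toReal))
    (by simp [hr.coe_toReal hx]) (by simp [hr.coe_toReal hy]) ha hb hab
  have h' : r (a • x + b • y) ≤ ((a * (r x).toReal + b * (r y).toReal : ℝ) : EReal) := h
  have ht : r (a • x + b • y) ≠ ⊤ := fun h0 => EReal.coe_ne_top _ (top_le_iff.1 (h0 ▸ h'))
  refine ⟨ht, ?_⟩
  rwa [← hr.coe_toReal ht, EReal.coe_le_coe_iff] at h'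

/-- The proximal problems of `r` with parameter `γ` are solved by `prox γ r`. -/
structure HasProx (γ : ℝ) (r : E d → EReal) : Prop where
  isMinOn : ∀ x, IsMinOn (fun z => r z + ((‖z - x‖ ^ 2 / (2 * γ) : ℝ) : EReal)) Set.univ
    (prox γ r x)

/-- The quadratic penalty has the larger curvature `1 / (2 γ) > k`, so the objective is coercive. A
lower semicontinuous function attains its minimum on a large compact ball, and outside it the value
at a point `u` of the domain is exceeded. -/
lemma IsProperClosedConvex.exists_isMinOn (hr : IsProperClosedConvex r) {x : E d} {a b k : ℝ}
    (hb : 0 ≤ b) (hk : k < 1 / (2 * γ))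
    (hlow : ∀ z, r z ≠ ⊤ → a - b * ‖z - x‖ - k * ‖z - x‖ ^ 2 ≤ (r z).toReal) :
    ∃ y, IsMinOn (fun z => r z + ((‖z - x‖ ^ 2 / (2 * γ) : ℝ) : EReal)) Set.univ y := by
  obtain ⟨u, hu⟩ := hr.proper
  set M := (r u).toReal + ‖u - x‖ ^ 2 / (2 * γ) with hM
  set κ := 1 / (2 * γ) - k with hκ
  have hκ0 : 0 < κ := sub_pos.2 hk
  -- With this radius `κ R - b > |M - a|`, and `R ≥ 1` allows this inequality to be multiplied by
  -- `‖z - x‖`.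
  set R := (b + |M - a|) / κ + 1 with hR
  have hR1 : 1 ≤ R := by
    have : 0 ≤ (b + |M - a|) / κ := by positivity
    linarith
  have hfar : ∀ z, r z ≠ ⊤ → R < ‖z - x‖ → M < (r z).toReal + ‖z - x‖ ^ 2 / (2 * γ) := by
    intro z hz hzR
    have h1 := hlow z hz
    have h2 : κ * R = b + |M - a| + κ := by rw [hR]; field_simp
    have h3 : κ * R < κ * ‖z - x‖ := by gcongr
    have h4 : M - a ≤ |M - a| := le_abs_self _
    have h5 : 0 ≤ |M - a| := abs_nonneg _
    have h6 : ‖z - x‖ ^ 2 / (2 * γ) = (κ + k) * ‖z - x‖ ^ 2 := by rw [hκ]; ring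
    rw [h6]
    have h7 : |M - a| < κ * ‖z - x‖ - b := by linarith
    have h8 : |M - a| * 1 ≤ (κ * ‖z - x‖ - b) * ‖z - x‖ := by
      gcongr <;> linarith
    have h9 : |M - a| < (κ * ‖z - x‖ - b) * ‖z - x‖ := by nlinarith
    nlinarith
  have huR : u ∈ Metric.closedBall x R := by
    rw [mem_closedBall_iff_norm]
    by_contra h
    exact lt_irrefl _ (hfar u hu (not_le.1 h))
  have hcont : Continuous fun z : E d => ((‖z - x‖ ^ 2 / (2 * γ) : ℝ) : EReal) :=
    continuous_coe_real_ereal.comp (by fun_prop)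
  have hlsc : LowerSemicontinuous fun z => r z + ((‖z - x‖ ^ 2 / (2 * γ) : ℝ) : EReal) :=
    hr.closed.add' hcont.lowerSemicontinuous fun z =>
      EReal.continuousAt_add (Or.inr (EReal.coe_ne_bot _)) (Or.inr (EReal.coe_ne_top _))
  obtain ⟨y, -, hy⟩ := (hlsc.lowerSemicontinuousOn (Metric.closedBall x R)).exists_isMinOn
    ⟨u, huR⟩ (isCompact_closedBall x R)
  refine ⟨y, fun z _ => ?_⟩
  by_cases hz : z ∈ Metric.closedBall x R
  · exact isMinOn_iff.1 hy z hz
  · refine le_trans (isMinOn_iff.1 hy u huR) ?_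
    beta_reduce
    by_cases hzt : r z = ⊤
    · rw [hzt, EReal.top_add_coe]
      exact le_top
    · rw [← hr.coe_toReal hu, ← hr.coe_toReal hzt]
      rw [mem_closedBall_iff_norm, not_le] at hz
      exact_mod_cast (hfar z hzt hz).le

namespace HasProx

variable (hp : HasProx γ r) (hr : IsProperClosedConvex r)
include hp hr

lemma ne_top (x : E d) : r (prox γ r x) ≠ ⊤ := by
  obtain ⟨u, hu⟩ := hr.proper
  intro h
  have := isMinOn_iff.1 (hp.isMinOn x) u (Set.mem_univ u)
  rw [h, EReal.top_add_coe, top_le_iff, ← hr.coe_toReal hu, ← EReal.coe_add] at this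
  exact EReal.coe_ne_top _ this

lemma toReal_le (x : E d) {u : E d} (hu : r u ≠ ⊤) :
    (r (prox γ r x)).toReal + ‖prox γ r x - x‖ ^ 2 / (2 * γ) ≤
      (r u).toReal + ‖u - x‖ ^ 2 / (2 * γ) := by
  have := isMinOn_iff.1 (hp.isMinOn x) u (Set.mem_univ u)
  rw [← hr.coe_toReal hu, ← hr.coe_toReal (hp.ne_top hr x)] at this
  exact_mod_cast this

/-- The variational inequality of the proximal map. -/
lemma toReal_add_inner_le (hγ : 0 < γ) (x : E d) {u : E d} (hu : r u ≠ ⊤) :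
    (r (prox γ r x)).toReal + γ⁻¹ * inner ℝ (x - prox γ r x) (u - prox γ r x) ≤ (r u).toReal := by
  set y := prox γ r x with hy
  -- The minimizer is compared with the point `(1 - t) y + t u` of the segment. Convexity and
  -- division by `t` leave an error linear in `t`, which vanishes as `t → 0`.
  have key : ∀ t : ℝ, 0 < t → t ≤ 1 →
      (r y).toReal + γ⁻¹ * inner ℝ (x - y) (u - y) - (r u).toReal ≤
        t * (‖u - y‖ ^ 2 / (2 * γ)) := by
    intro t ht ht1
    obtain ⟨h1, h2⟩ := hr.toReal_convex (hp.ne_top hr x) hu (sub_nonneg.2 ht1) ht.le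
      (sub_add_cancel 1 t)
    have h3 := hp.toReal_le hr x h1
    rw [← hy] at h2 h3
    have e : (1 - t) • y + t • u - x = (y - x) + t • (u - y) := by module
    rw [e, norm_add_sq_real, inner_smul_right, norm_smul, Real.norm_of_nonneg ht.le] at h3
    have e2 : inner ℝ (x - y) (u - y) = - inner ℝ (y - x) (u - y) := by
      rw [← inner_neg_left, neg_sub]
    rw [e2]
    have h4 : t * ((r y).toReal + γ⁻¹ * -inner ℝ (y - x) (u - y) - (r u).toReal) ≤
        t * (t * (‖u - y‖ ^ 2 / (2 * γ))) := by
      have e3 : (‖y - x‖ ^ 2 + 2 * (t * inner ℝ (y - x) (u - y)) + (t * ‖u - y‖) ^ 2) / (2 * γ) =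
          ‖y - x‖ ^ 2 / (2 * γ) + t * (γ⁻¹ * inner ℝ (y - x) (u - y)) +
            t * (t * (‖u - y‖ ^ 2 / (2 * γ))) := by field_simp
      rw [e3] at h3
      linarith
    exact le_of_mul_le_mul_left h4 ht
  have hlim : Filter.Tendsto (fun t : ℝ => t * (‖u - y‖ ^ 2 / (2 * γ)))
      (nhdsWithin 0 (Set.Ioi 0)) (nhds 0) := by
    have : Continuous fun t : ℝ => t * (‖u - y‖ ^ 2 / (2 * γ)) := by fun_prop
    simpa using (this.tendsto 0).mono_left nhdsWithin_le_nhds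
  have := ge_of_tendsto hlim (Filter.mem_of_superset (Ioc_mem_nhdsGT one_pos)
    fun t ht => key t ht.1 ht.2)
  linarith

/-- The variational inequalities at the two images, each tested with the other, add up to `‖a - b‖²
≤ ⟪x - y, a - b⟫`. -/
lemma norm_sub_le (hγ : 0 < γ) (x y : E d) : ‖prox γ r x - prox γ r y‖ ≤ ‖x - y‖ := by
  have h1 := hp.toReal_add_inner_le hr hγ x (hp.ne_top hr y)
  have h2 := hp.toReal_add_inner_le hr hγ y (hp.ne_top hr x)
  set a := prox γ r x
  set b := prox γ r y
  have h3 : γ⁻¹ * (inner ℝ (x - a) (b - a) + inner ℝ (y - b) (a - b)) ≤ 0 := by linarith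
  have h4 : inner ℝ (x - a) (b - a) + inner ℝ (y - b) (a - b) ≤ 0 := by
    by_contra! h
    have := mul_pos (inv_pos.2 hγ) h
    linarith
  have e : inner ℝ (x - a) (b - a) + inner ℝ (y - b) (a - b) =
      ‖a - b‖ ^ 2 - inner ℝ (x - y) (a - b) := by
    rw [← neg_sub a b, inner_neg_right, ← real_inner_self_eq_norm_sq, neg_add_eq_sub,
      ← inner_sub_left, ← inner_sub_left]
    congr 1
    abel
  have h5 := real_inner_le_norm (x - y) (a - b)
  by_contra! h
  nlinarith [norm_nonneg (x - y)]

lemma continuous (hγ : 0 < γ) : Continuous (prox γ r) := by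
  refine (LipschitzWith.of_dist_le_mul (K := 1) fun x y => ?_).continuous
  simpa [dist_eq_norm] using hp.norm_sub_le hr hγ x y

/-- One inexact proximal gradient step `x ↦ prox (x - γ g)`. -/
lemma step {F : E d → ℝ} {L : ℝ} (hF : HasLipGrad F L) (hγ : 0 < γ) {x : E d} (hx : r x ≠ ⊤)
    (g : E d) :
    F (prox γ r (x - γ • g)) + (r (prox γ r (x - γ • g))).toReal +
      (1 / (2 * γ) - L / 2) * ‖prox γ r (x - γ • g) - x‖ ^ 2 ≤
    F x + (r x).toReal + γ / 2 * ‖g - gradient F x‖ ^ 2 := by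
  have h1 := hp.toReal_add_inner_le hr hγ (x - γ • g) hx
  set y := prox γ r (x - γ • g)
  have h2 := hF.descent x y
  have e1 : inner ℝ (x - γ • g - y) (x - y) = ‖y - x‖ ^ 2 + γ * inner ℝ g (y - x) := by
    have : x - γ • g - y = -((y - x) + γ • g) := by abel
    rw [this, ← neg_sub y x, inner_neg_neg, inner_add_left, real_inner_self_eq_norm_sq,
      real_inner_smul_left]
  -- Scaled by `1 / (2 γ)`, this square is the Young inequality that trades the inner product of `g
  -- - ∇F(x)` and `y - x` for half of the `‖y - x‖² / γ` supplied by the variational inequality.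
  have h3 : 0 ≤ ‖(y - x) + γ • (g - gradient F x)‖ ^ 2 := sq_nonneg _
  rw [norm_add_sq_real, inner_smul_right, norm_smul, Real.norm_of_nonneg hγ.le,
    real_inner_comm, inner_sub_left] at h3
  rw [e1] at h1
  have h4 := mul_le_mul_of_nonneg_left h3 (show 0 ≤ 1 / (2 * γ) by positivity)
  have e2 : γ⁻¹ * (‖y - x‖ ^ 2 + γ * inner ℝ g (y - x)) =
      2 * (1 / (2 * γ) * ‖y - x‖ ^ 2) + inner ℝ g (y - x) := by field_simp
  have e3 : 1 / (2 * γ) * (‖y - x‖ ^ 2 + 2 * (γ * (inner ℝ g (y - x) -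
      inner ℝ (gradient F x) (y - x))) + (γ * ‖g - gradient F x‖) ^ 2) =
      1 / (2 * γ) * ‖y - x‖ ^ 2 + (inner ℝ g (y - x) - inner ℝ (gradient F x) (y - x)) +
        γ / 2 * ‖g - gradient F x‖ ^ 2 := by field_simp
  rw [e2] at h1
  rw [mul_zero, e3] at h4
  linarith

/-- The exact and the inexact proximal step differ by at most `γ ‖g - ∇F(x)‖`, because the prox is
nonexpansive. The gradient mapping is thus controlled by the step actually taken and the estimation
error. -/
lemma norm_gradMap_sq_le (hγ : 0 < γ) (F : E d → ℝ) (x g : E d) :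
    ‖gradMap γ r F x‖ ^ 2 ≤
      2 / γ ^ 2 * ‖prox γ r (x - γ • g) - x‖ ^ 2 + 2 * ‖g - gradient F x‖ ^ 2 := by
  have h1 := hp.norm_sub_le hr hγ (x - γ • g) (x - γ • gradient F x)
  set y := prox γ r (x - γ • g)
  set z := prox γ r (x - γ • gradient F x) with hz
  have e : x - γ • g - (x - γ • gradient F x) = -(γ • (g - gradient F x)) := by module
  rw [e, norm_neg, norm_smul, Real.norm_of_nonneg hγ.le] at h1
  have h2 := norm_sub_sq_le_two (y - z) (y - x)
  rw [sub_sub_sub_cancel_left] at h2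
  have h3 : ‖y - z‖ ^ 2 ≤ (γ * ‖g - gradient F x‖) ^ 2 := by gcongr
  rw [gradMap, ← hz, norm_smul, norm_inv, Real.norm_of_nonneg hγ.le, mul_pow]
  calc γ⁻¹ ^ 2 * ‖x - z‖ ^ 2
      ≤ γ⁻¹ ^ 2 * (2 * (γ * ‖g - gradient F x‖) ^ 2 + 2 * ‖y - x‖ ^ 2) := by
        gcongr
        linarith
    _ = _ := by field_simp; ring

end HasProx

variable {f : Fin n → E d → ℝ} {L : Fin n → ℝ} {Φinf : ℝ}

lemma le_add_toReal (hr : IsProperClosedConvex r) {F : E d → ℝ}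
    (hΦ : (Φinf : EReal) = ⨅ x, ((F x : ℝ) : EReal) + r x) {x : E d} (hx : r x ≠ ⊤) :
    Φinf ≤ F x + (r x).toReal := by
  have h : (Φinf : EReal) ≤ ((F x : ℝ) : EReal) + r x := hΦ ▸ iInf_le _ x
  rw [← hr.coe_toReal hx] at h
  exact_mod_cast h

/-- A lower bound on `F + r` together with the descent inequality for `F` bounds `r` from below by a
quadratic of curvature `l / 2`, which the proximal penalty dominates for small `γ`. -/
lemma HasLipGrad.hasProx {F : E d → ℝ} {l : ℝ} (hF : HasLipGrad F l)
    (hr : IsProperClosedConvex r) (hΦ : (Φinf : EReal) = ⨅ x, ((F x : ℝ) : EReal) + r x)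
    (hγ : l / 2 < 1 / (2 * γ)) : HasProx γ r where
  isMinOn x := by
    refine Classical.epsilon_spec (hr.exists_isMinOn (a := Φinf - F x) (b := ‖gradient F x‖)
      (norm_nonneg _) hγ fun z hz => ?_)
    have h1 := le_add_toReal hr hΦ hz
    have h2 := hF.descent x z
    have h3 := real_inner_le_norm (gradient F x) (z - x)
    linarith

/-- One round of EF21-Prox on the iterate and the estimators. -/
noncomputable def stepProx {S : Type*} (f : Fin n → E d → ℝ) (r : E d → EReal) (𝒞 : S → E d → E d)
    (γ : ℝ) (s : E d × (Fin n → E d)) (w : (Fin n → S) × Unit) : E d × (Fin n → E d) :=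
  (prox γ r (s.1 - γ • mean s.2),
    fun i => s.2 i + 𝒞 (w.1 i) (gradient (f i) (prox γ r (s.1 - γ • mean s.2)) - s.2 i))

lemma IsSmooth.measurable_stepProx {S : Type*} [MeasurableSpace S] {ν : Measure S} {α : ℝ}
    (hf : IsSmooth f L) {𝒞 : S → E d → E d} (h𝒞 : IsContractive 𝒞 ν α)
    (hp : Measurable (prox γ r)) : Measurable (Function.uncurry (stepProx f r 𝒞 γ)) := by
  have hg := fun i => (hf.continuous_gradient i).measurable
  have hx : Measurable fun p : (E d × (Fin n → E d)) × ((Fin n → S) × Unit) =>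
      prox γ r (p.1.1 - γ • mean p.1.2) := hp.comp (by fun_prop)
  refine hx.prodMk (measurable_pi_lambda _ fun i => Measurable.add (by fun_prop) ?_)
  exact h𝒞.measurable_apply (by fun_prop) (((hg i).comp hx).sub (by fun_prop))

/-- The contraction gains `γ` times the error; the descent step uses `γ/2` and the gradient mapping
`γ/8`. Of the gain of `1/2` in units of `‖y - x‖² / γ`, smoothness takes at most `1/8`, the gradient
drift `1/4` and the gradient mapping `1/8`. This exhausts it and fixes the factor `γ / 16`. -/
lemma IsSmooth.potential_decrease_Prox (hf : IsSmooth f L) (hp : HasProx γ r)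
    (hr : IsProperClosedConvex r) (hγ : 0 < γ) {α : ℝ} (hα : 0 < α) (hα1 : α ≤ 1)
    (hγL : γ * (4 * rms L / α) = 1) {x : E d} (hx : r x ≠ ⊤) (g : Fin n → E d) :
    avg f (prox γ r (x - γ • mean g)) + (r (prox γ r (x - γ • mean g))).toReal +
      2 * γ / α * ((1 - α) * gradErr f g (prox γ r (x - γ • mean g))) +
      γ / 16 * ‖gradMap γ r (avg f) x‖ ^ 2 ≤
    avg f x + (r x).toReal + 2 * γ / α * gradErr f g x := by
  have h1 := hp.step hr hf.hasLipGrad hγ hx (mean g)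
  have h2 := hp.norm_gradMap_sq_le hr hγ (avg f) x (mean g)
  set y := prox γ r (x - γ • mean g)
  have h3 := hf.gradErr_contract hα hα1 g x y
  have h4 := hf.norm_mean_sub_sq_le g x
  have hLe : rms L = α / (4 * γ) := by
    rw [eq_div_iff (by positivity)]
    field_simp at hγL
    linarith
  have h5 := mul_le_mul_of_nonneg_left h3 (show 0 ≤ 2 * γ / α by positivity)
  have h6 := mul_le_mul_of_nonneg_left h2 (show 0 ≤ γ / 16 by positivity)
  have h7 := mul_le_mul_of_nonneg_left h4 (show 0 ≤ 5 / 8 * γ by positivity)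
  have h8 := mul_nonneg hγ.le (gradErr_nonneg f g x)
  have e5 : 2 * γ / α * ((1 - α / 2) * gradErr f g x + 2 / α * (rms L ^ 2 * ‖y - x‖ ^ 2)) =
      2 * γ / α * gradErr f g x - γ * gradErr f g x + 1 / 4 * (1 / γ * ‖y - x‖ ^ 2) := by
    rw [hLe]; field_simp; ring
  have e6 : γ / 16 * (2 / γ ^ 2 * ‖y - x‖ ^ 2 + 2 * ‖mean g - gradient (avg f) x‖ ^ 2) =
      1 / 8 * (1 / γ * ‖y - x‖ ^ 2) + γ / 8 * ‖mean g - gradient (avg f) x‖ ^ 2 := by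
    field_simp
    ring
  have e1 : (1 / (2 * γ) - rms L / 2) * ‖y - x‖ ^ 2 =
      1 / 2 * (1 / γ * ‖y - x‖ ^ 2) - α / 8 * (1 / γ * ‖y - x‖ ^ 2) := by
    rw [hLe]; field_simp; ring
  have h9 : α / 8 * (1 / γ * ‖y - x‖ ^ 2) ≤ 1 / 8 * (1 / γ * ‖y - x‖ ^ 2) := by gcongr
  rw [e5] at h5
  rw [e6] at h6
  rw [e1] at h1
  linarith

theorem complexity_Prox (n : ℕ) (L : Fin n → ℝ) (α : ℝ) (hL : 0 < rms L) (hα : 0 < α)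
    (hα1 : α ≤ 1) :
    ∃ γ : ℝ, 0 < γ ∧
    ∀ (d : ℕ) (f : Fin n → E d → ℝ) (r : E d → EReal), IsSmooth f L → IsProperClosedConvex r →
    ∀ Φinf : ℝ, (Φinf : EReal) = ⨅ x, ((avg f x : ℝ) : EReal) + r x →
    ∀ (x₀ : E d) (ε : ℝ), r x₀ ≠ ⊤ → 0 < ε →
    ∃ T : ℕ, 1 ≤ T ∧
      (T : ℝ) ≤ 10000 * (rms L * (avg f x₀ + (r x₀).toReal - Φinf) / (α * ε ^ 2)) + 1 ∧
    ∀ (S : Type*) [MeasurableSpace S] (ν : Measure S) [IsProbabilityMeasure ν]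
      (𝒞 : S → E d → E d), IsContractive 𝒞 ν α →
    ∀ (Ω : Type*) [MeasurableSpace Ω] (μ : Measure Ω) [IsProbabilityMeasure μ]
      (ξ : ℕ → Ω → Fin n → S), IsFreshNoise (fun _ => ν) ξ μ →
    let run := fun t ω => runProx f r 𝒞 γ x₀ (fun t => ξ t ω) t
    meanSqAtOutput μ (gradMap γ r (avg f)) (fun t ω => (run t ω).x) T ≤
      ENNReal.ofReal (ε ^ 2) ∧
    ∀ i ω, ((run T ω).cost i : ℝ) ≤
      10000 * (rms L * (avg f x₀ + (r x₀).toReal - Φinf) / (α * ε ^ 2) + 1) := by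
  set γ := stepsize (4 * rms L / α) with hγdef
  have hγ : 0 < γ := stepsize_pos (by positivity)
  have hγL : γ * (4 * rms L / α) = 1 := stepsize_mul (by positivity)
  refine ⟨γ, hγ, ?_⟩
  intro d f r hf hr Φinf hΦ x₀ ε hx₀ hε
  have hF := hf.hasLipGrad
  have hΦ' := fun {x : E d} (hx : r x ≠ ⊤) => le_add_toReal hr hΦ hx
  have hδ : 0 ≤ avg f x₀ + (r x₀).toReal - Φinf := sub_nonneg.2 (hΦ' hx₀)
  set δ := avg f x₀ + (r x₀).toReal - Φinf with hδdef
  set X := rms L * δ / (α * ε ^ 2) with hXdef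
  have hX0 : 0 ≤ X := by positivity
  have hT : ((⌊64 * X⌋₊ + 1 : ℕ) : ℝ) ≤ 64 * X + 1 := by
    push_cast
    have := Nat.floor_le (show 0 ≤ 64 * X by positivity)
    linarith
  have hp : HasProx γ r := hF.hasProx hr hΦ (by
    rw [lt_div_iff₀ (by positivity)]
    field_simp at hγL
    nlinarith)
  -- No separate single-round case is needed: `rms L > 0` ties the stepsize to the smoothness for
  -- every value of `X`.
  refine ⟨⌊64 * X⌋₊ + 1, Nat.le_add_left _ _, by linarith, ?_⟩
  intro S _ ν _ 𝒞 h𝒞 Ω _ μ _ ξ hξ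
  dsimp only
  refine ⟨?_, fun i ω => ?_⟩
  · have H := hξ.noisePair_unit
    have hpm : Measurable (prox γ r) := (hp.continuous hr hγ).measurable
    have hGm : Measurable (gradMap γ r (avg f)) := by
      have := hF.continuous_gradient.measurable
      unfold gradMap
      fun_prop
    have hrm : Measurable fun x => (r x).toReal := hr.closed.measurable.ereal_toReal
    have hstepm := hf.measurable_stepProx h𝒞 hpm
    set Y : ℕ → Ω → E d × (Fin n → E d) := fun t ω =>
      ((runProx f r 𝒞 γ x₀ (fun t => ξ t ω) t).x, (runProx f r 𝒞 γ x₀ (fun t => ξ t ω) t).g)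
      with hY
    have hY0 : Measurable[history (fun (_ : ℕ) (_ : Ω) => ()) 0] (Y 0) := measurable_of_eq_const
      (x₀, fun i => gradient (f i) x₀) fun _ => rfl
    have hYs : ∀ t ω, Y (t + 1) ω = stepProx f r 𝒞 γ (Y t ω) (ξ t ω, ()) := fun t ω => rfl
    have hYm : ∀ t, Measurable (Y t) := H.measurable_run hstepm hY0 hYs
    refine meanSqAtOutput_le (c := γ / 16) (δ := δ) (b := 0) (Nat.le_add_left _ _) hGm
      (fun t => (hYm t).fst) (by positivity) hδ le_rfl ?_ ?_
    -- The invariant keeps the iterates in the domain of `r`; only there is `(r x).toReal` the true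
    -- value and the potential bounded below by `0`.
    · have key := H.sum_lintegral_le hstepm hY0 hYs (D := fun s => r s.1 ≠ ⊤) (fun _ => hx₀)
        (fun _ _ _ => hp.ne_top hr _)
        (Ψ := fun s => avg f s.1 + (r s.1).toReal - Φinf + 2 * γ / α * gradErr f s.2 s.1)
        (N := fun s => γ / 16 * ‖gradMap γ r (avg f) s.1‖ ^ 2) (c := 0)
        ((((hF.differentiable.continuous.measurable.comp measurable_fst).add
          (hrm.comp measurable_fst)).sub_const _).add
          ((hf.measurable_gradErr (by fun_prop) measurable_fst).const_mul _))
        (by fun_prop) (fun s => by positivity)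
        (fun t s hs => by
          have := hξ.isProbabilityMeasure t
          have : IsProbabilityMeasure (μ.map fun _ : Ω => ()) :=
            Measure.isProbabilityMeasure_map measurable_const.aemeasurable
          have hE := (ExpLE.const (sub_nonneg.2 (hΦ' (hp.ne_top hr (s.1 - γ • mean s.2))))).add
            (ExpLE.const_mul (c := 2 * γ / α)
            (ExpLE.mean fun i => (hξ.expLE t i (h𝒞.expLE_update hα1 (s.2 i)
              (gradient (f i) (prox γ r (s.1 - γ • mean s.2))))).fst
                (σ := μ.map fun _ : Ω => ())) (by positivity))
          refine ⟨_, hE.congr fun w => ?_, ?_⟩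
          · simp only [stepProx, gradErr]
          · rw [mean_const_mul, add_zero]
            have := hf.potential_decrease_Prox hp hr hγ hα hα1 hγL hs s.2
            unfold gradErr at this
            unfold gradErr
            linarith)
      refine (key _).trans (le_of_eq ?_)
      have : gradErr f (fun i => gradient (f i) x₀) x₀ = 0 := by simp [gradErr, mean]
      simp [hY, runProx, this, hδdef]
    · have h1 : 64 * X ≤ ((⌊64 * X⌋₊ + 1 : ℕ) : ℝ) := by
        push_cast
        exact (Nat.lt_floor_add_one _).le
      have e : δ + ((⌊64 * X⌋₊ + 1 : ℕ) : ℝ) * 0 = γ / 16 * (64 * X) * ε ^ 2 := by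
        calc _ = γ * (4 * rms L / α) * δ := by rw [hγL]; ring
          _ = _ := by rw [hXdef]; field_simp; ring
      rw [e]
      gcongr
  · have hcost : ∀ t, (runProx f r 𝒞 γ x₀ (fun t => ξ t ω) t).cost i = t + 1 := by
      intro t
      induction t with
      | zero => rfl
      | succ t ih => simp only [runProx, ih]
    rw [hcost]
    push_cast at hT ⊢
    linarith

end Prox

end EF21

/-! ### The six complexity bounds with one constant. -/

theorem corollary1 :
    ∃ K : ℝ, 0 < K ∧
    -- EF21-PP
    (∀ (n : ℕ) (L : Fin n → ℝ) (α p : ℝ), 0 < n → 0 < α → α ≤ 1 → 0 < p → p ≤ 1 →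
      ∃ γ : ℝ, 0 < γ ∧
      ∀ (d : ℕ) (f : Fin n → E d → ℝ), IsSmooth f L → BddBelow (Set.range (avg f)) →
      ∀ (x₀ : E d) (ε : ℝ), 0 < ε →
      ∃ T : ℕ, 1 ≤ T ∧ (T : ℝ) ≤ K * (rms L * gap (avg f) x₀ / (p * α * ε ^ 2)) + 1 ∧
      ∀ (S : Type*) [MeasurableSpace S] (ν : Measure S) [IsProbabilityMeasure ν]
        (𝒞 : S → E d → E d), IsContractive 𝒞 ν α →
      ∀ (Ω : Type*) [MeasurableSpace Ω] (μ : Measure Ω) [IsProbabilityMeasure μ]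
        (ξ : ℕ → Ω → Fin n → S) (A : ℕ → Ω → Fin n → Bool),
        IsFreshNoise (fun _ => ν) ξ μ → IsFreshNoise (fun _ => bernoulliLaw p) A μ →
        IndepNoise ξ A μ →
      let run := fun t ω => runPP f 𝒞 γ x₀ (fun t => ξ t ω) (fun t => A t ω) t
      meanSqAtOutput μ (gradient (avg f)) (fun t ω => (run t ω).x) T ≤ ENNReal.ofReal (ε ^ 2) ∧
      ∀ i, ∫⁻ ω, ((run T ω).cost i : ENNReal) ∂μ ≤
        ENNReal.ofReal (K * (rms L * gap (avg f) x₀ / (α * ε ^ 2) + 1))) ∧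
    -- EF21-BC
    (∀ (n : ℕ) (L : Fin n → ℝ) (αw αM : ℝ), 0 < n → 0 < αw → αw ≤ 1 → 0 < αM → αM ≤ 1 →
      ∃ γ : ℝ, 0 < γ ∧
      ∀ (d : ℕ) (f : Fin n → E d → ℝ), IsSmooth f L → BddBelow (Set.range (avg f)) →
      ∀ (x₀ : E d) (ε : ℝ), 0 < ε →
      ∃ T : ℕ, 1 ≤ T ∧ (T : ℝ) ≤ K * (rms L * gap (avg f) x₀ / (αw * αM * ε ^ 2)) + 1 ∧
      ∀ (S : Type*) [MeasurableSpace S] (ν : Measure S) [IsProbabilityMeasure ν]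
        (𝒞w : S → E d → E d), IsContractive 𝒞w ν αw →
      ∀ (S' : Type*) [MeasurableSpace S'] (ν' : Measure S') [IsProbabilityMeasure ν']
        (𝒞M : S' → E d → E d), IsContractive 𝒞M ν' αM →
      ∀ (Ω : Type*) [MeasurableSpace Ω] (μ : Measure Ω) [IsProbabilityMeasure μ]
        (ξ : ℕ → Ω → Fin n → S) (ζ : ℕ → Ω → Unit → S'),
        IsFreshNoise (fun _ => ν) ξ μ → IsFreshNoise (fun _ => ν') ζ μ → IndepNoise ξ ζ μ →
      let run := fun t ω => runBC f 𝒞w 𝒞M γ x₀ (fun t => ξ t ω) (fun t => ζ t ω ()) t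
      meanSqAtOutput μ (gradient (avg f)) (fun t ω => (run t ω).x) T ≤ ENNReal.ofReal (ε ^ 2) ∧
      ∀ i ω, ((run T ω).cost i : ℝ) ≤
        K * (rms L * gap (avg f) x₀ / (αw * αM * ε ^ 2) + 1)) ∧
    -- EF21-HB
    (∀ (n : ℕ) (L : Fin n → ℝ) (α η : ℝ), 0 < n → 0 < α → α ≤ 1 → 0 ≤ η → η < 1 →
      ∃ γ : ℝ, 0 < γ ∧
      ∀ (d : ℕ) (f : Fin n → E d → ℝ), IsSmooth f L → BddBelow (Set.range (avg f)) →
      ∀ (x₀ : E d) (ε : ℝ), 0 < ε →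
      ∃ T : ℕ, 1 ≤ T ∧
        (T : ℝ) ≤ K * (rms L * gap (avg f) x₀ / ε ^ 2 * (1 / α + 1 / (1 - η))) + 1 ∧
      ∀ (S : Type*) [MeasurableSpace S] (ν : Measure S) [IsProbabilityMeasure ν]
        (𝒞 : S → E d → E d), IsContractive 𝒞 ν α →
      ∀ (Ω : Type*) [MeasurableSpace Ω] (μ : Measure Ω) [IsProbabilityMeasure μ]
        (ξ : ℕ → Ω → Fin n → S), IsFreshNoise (fun _ => ν) ξ μ →
      let run := fun t ω => runHB f 𝒞 γ η x₀ (fun t => ξ t ω) t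
      meanSqAtOutput μ (gradient (avg f)) (fun t ω => (run t ω).x) T ≤ ENNReal.ofReal (ε ^ 2) ∧
      ∀ i ω, ((run T ω).cost i : ℝ) ≤
        K * (rms L * gap (avg f) x₀ / ε ^ 2 * (1 / α + 1 / (1 - η)) + 1)) ∧
    -- EF21-Prox
    (∀ (n : ℕ) (L : Fin n → ℝ) (α : ℝ), 0 < n → 0 < rms L → 0 < α → α ≤ 1 →
      ∃ γ : ℝ, 0 < γ ∧
      ∀ (d : ℕ) (f : Fin n → E d → ℝ) (r : E d → EReal), IsSmooth f L → IsProperClosedConvex r →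
      ∀ Φinf : ℝ, (Φinf : EReal) = ⨅ x, ((avg f x : ℝ) : EReal) + r x →
      ∀ (x₀ : E d) (ε : ℝ), r x₀ ≠ ⊤ → 0 < ε →
      ∃ T : ℕ, 1 ≤ T ∧
        (T : ℝ) ≤ K * (rms L * (avg f x₀ + (r x₀).toReal - Φinf) / (α * ε ^ 2)) + 1 ∧
      ∀ (S : Type*) [MeasurableSpace S] (ν : Measure S) [IsProbabilityMeasure ν]
        (𝒞 : S → E d → E d), IsContractive 𝒞 ν α →
      ∀ (Ω : Type*) [MeasurableSpace Ω] (μ : Measure Ω) [IsProbabilityMeasure μ]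
        (ξ : ℕ → Ω → Fin n → S), IsFreshNoise (fun _ => ν) ξ μ →
      let run := fun t ω => runProx f r 𝒞 γ x₀ (fun t => ξ t ω) t
      meanSqAtOutput μ (gradMap γ r (avg f)) (fun t ω => (run t ω).x) T ≤
        ENNReal.ofReal (ε ^ 2) ∧
      ∀ i ω, ((run T ω).cost i : ℝ) ≤
        K * (rms L * (avg f x₀ + (r x₀).toReal - Φinf) / (α * ε ^ 2) + 1)) ∧
    -- EF21-SGD
    (∀ (n : ℕ) (L σ : Fin n → ℝ) (α : ℝ), 0 < n → 0 < α → α ≤ 1 →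
      ∃ γ : ℝ, 0 < γ ∧
      ∀ (d : ℕ) (f : Fin n → E d → ℝ), IsSmooth f L → BddBelow (Set.range (avg f)) →
      ∀ (x₀ : E d) (ε : ℝ), 0 < ε →
      ∃ (T : ℕ) (τ : Fin n → ℕ), 1 ≤ T ∧ (∀ i, 1 ≤ τ i) ∧
        (T : ℝ) ≤ K * (rms L * gap (avg f) x₀ / (α * ε ^ 2)) + 1 ∧
      ∀ (Z : Type*) [MeasurableSpace Z] (D : Fin n → Measure Z) [∀ i, IsProbabilityMeasure (D i)]
        (h : Fin n → E d → Z → E d),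
        (∀ i, IsUnbiasedBoundedVariance (D i) (h i) (gradient (f i)) (σ i)) →
      ∀ (S : Type*) [MeasurableSpace S] (ν : Measure S) [IsProbabilityMeasure ν]
        (𝒞 : S → E d → E d), IsContractive 𝒞 ν α →
      ∀ (Ω : Type*) [MeasurableSpace Ω] (μ : Measure Ω) [IsProbabilityMeasure μ]
        (ξ : ℕ → Ω → Fin n → S) (z : ℕ → Ω → ∀ i, Fin (τ i) → Z),
        IsFreshNoise (fun _ => ν) ξ μ →
        IsFreshNoise (fun i => Measure.pi fun _ : Fin (τ i) => D i) z μ → IndepNoise ξ z μ →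
      let run := fun t ω => runSGD h 𝒞 γ x₀ (fun t => ξ t ω) (fun t => z t ω) t
      meanSqAtOutput μ (gradient (avg f)) (fun t ω => (run t ω).x) T ≤ ENNReal.ofReal (ε ^ 2) ∧
      ∀ ω, (mean fun i => ((run T ω).cost i : ℝ)) ≤
        K * (rms L * gap (avg f) x₀ / (α * ε ^ 2) +
          rms L * gap (avg f) x₀ * (mean fun i => σ i ^ 2) / (α ^ 3 * ε ^ 4) + 1)) ∧
    -- EF21-PAGE, with probability `p = 1 / (m + 1)` of a full gradient
    (∀ (n m : ℕ) (L ℓ : Fin n → ℝ) (α : ℝ), 0 < n → 0 < m → 0 < α → α ≤ 1 →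
      let p : ℝ := 1 / ((m : ℝ) + 1)
      let ℓt : ℝ := √(1 - p) * rms ℓ
      ∃ γ : ℝ, 0 < γ ∧
      ∀ (d : ℕ) (f : Fin n → Fin m → E d → ℝ) (q : Fin n → Measure (Fin m))
        [∀ i, IsProbabilityMeasure (q i)], IsSmooth (fun i => avg (f i)) L →
        (∀ i, IsAvgSmooth (q i) (f i) (ℓ i)) →
        BddBelow (Set.range (avg fun i => avg (f i))) →
      ∀ (x₀ : E d) (ε : ℝ), 0 < ε →
      let F : E d → ℝ := avg fun i => avg (f i)
      let B : ℝ := (rms L + ℓt) * gap F x₀ / (α * ε ^ 2) + √(m : ℝ) * ℓt * gap F x₀ / ε ^ 2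
      ∃ T : ℕ, 1 ≤ T ∧ (T : ℝ) ≤ K * B + 1 ∧
      ∀ (S : Type*) [MeasurableSpace S] (ν : Measure S) [IsProbabilityMeasure ν]
        (𝒞 : S → E d → E d), IsContractive 𝒞 ν α →
      ∀ (Ω : Type*) [MeasurableSpace Ω] (μ : Measure Ω) [IsProbabilityMeasure μ]
        (ξ : ℕ → Ω → Fin n → S) (c : ℕ → Ω → Fin n → Bool × Fin m),
        IsFreshNoise (fun _ => ν) ξ μ →
        IsFreshNoise (fun i => (bernoulliLaw p).prod (q i)) c μ → IndepNoise ξ c μ →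
      let run := fun t ω => runPAGE f 𝒞 γ x₀ (fun t => ξ t ω) (fun t => c t ω) t
      meanSqAtOutput μ (gradient F) (fun t ω => (run t ω).x) T ≤ ENNReal.ofReal (ε ^ 2) ∧
      (∑ i, ∫⁻ ω, ((run T ω).cost i : ENNReal) ∂μ) / n ≤ ENNReal.ofReal (K * (m + B))) := by
  -- The largest demand comes from the gradient count of EF21-SGD, `68 · 144 = 9792`.
  refine ⟨10000, by norm_num, ?_, ?_, ?_, ?_, ?_, ?_⟩
  · exact fun n L α p _ => complexity_PP n L α p
  · exact fun n L αw αM _ => complexity_BC n L αw αM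
  · exact fun n L α η _ => complexity_HB n L α η
  · exact fun n L α _ => complexity_Prox n L α
  · exact complexity_SGD
  · exact complexity_PAGE
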